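/- Let $d\ge 1$ and $m\ge 2d+1$ be integers, let $t_1<t_2<\dots<t_m$ be real numbers, and let $C(m,2d)\subset\mathbb R^{2d}$ be the cyclic polytope, i.e. the convex hull of the points $p_i=(t_i,t_i^2,\dots,t_i^{2d})$, $1\le i\le m$. A triangulation of $C(m,2d)$ is a (face-to-face) subdivision of it into $2d$-dimensional simplices whose vertices are among the $p_i$. Increasing $(d+1)$-tuples from $\{1,\dots,m\}$ are identified with the $d$-simplices spanned by the corresponding points. For a triangulation $S$ of $C(m,2d)$, let $e(S)$ be the set of $d$-simplices that are faces of simplices of $S$ and do not lie on any lower facet of $C(m,2d)$ (lower with respect to the last coordinate). A bistellar flip of $S$ is given by $2d+2$ vertices of $S$, no $2d+1$ of them in a hyperplane, such that $S$ restricts to a triangulation of their convex hull $X$ using those vertices; it replaces the part of $S$ inside $X$ by the other triangulation of $X$ using those vertices. A tuple $(i_0,\dots,i_d)$ from $\{1,\dots,m\}$ is separated if $i_x+2\le i_{x+1}$ for $0\le x\le d-1$. A tuple $X=(x_0,\dots,x_d)$ intertwines $Y=(y_0,\dots,y_d)$ if $x_0<y_0<x_1<y_1<\dots<x_d<y_d$,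 and a set of tuples is non-intertwining if no two of its elements intertwine (in either order). If $R$ is a non-intertwining set of separated $(d+1)$-tuples from $\{1,\dots,m\}$ and $A\notin R$ is a separated $(d+1)$-tuple from $\{1,\dots,m\}$, then $A$ is called a complement for $R$ if $R\cup\{A\}=e(S)$ for some triangulation $S$ of $C(m,2d)$. Two tuples $A\neq B$ are exchangeable if they are both complements for some common $R$. Then: 1. Two triangulations $S$ and $T$ of $C(m,2d)$ are related by a bistellar flip if and only if $e(S)$ and $e(T)$ have all but one $(d+1)$-tuple in common, i.e. $|e(S)\setminus e(T)|=|e(T)\setminus e(S)|=1$. 2. Two separated $(d+1)$-tuples $A$ and $B$ from $\{1,\dots,m\}$ are exchangeable if and only if they intertwine in some order. 3. Let $A$ and $B$ be exchangeable, and let $R$ be a set of $(d+1)$-tuples. Then $A$ and $B$ are both complements for $R$ if and only if $R$ is a non-intertwining set of separated $(d+1)$-tuples from $\{1,\dots,m\}$ that contains neither $A$ nor $B$, has cardinality $\binom{m-d-1}{d}-1$, and contains every separated $(d+1)$-tuple other than $A$ and $B$ all of whose entries lie in $A\cup B$. -/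

import Mathlib

/-- The point `(s, s ^ 2, …, s ^ δ)` of the moment curve in `ℝ ^ δ`. -/
def momentPoint (δ : ℕ) (s : ℝ) : Fin δ → ℝ := fun j => s ^ (j.val + 1)

/-- The convex hull of the points of the moment curve in `ℝ ^ δ` whose labels lie in `V`,
the label `i` standing for the point with parameter `t i`. -/
def labelHull (δ : ℕ) (t : ℕ → ℝ) (V : Set ℕ) : Set (Fin δ → ℝ) :=
  convexHull ℝ ((fun i => momentPoint δ (t i)) '' V)

/-- The cyclic polytope `C(m, δ)`, with parameters `t 1 < t 2 < … < t m`. -/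
def cyclicPolytope (δ m : ℕ) (t : ℕ → ℝ) : Set (Fin δ → ℝ) :=
  labelHull δ t (Set.Icc 1 m)

/-- The points with labels in `V` are affinely independent. -/
def LabelsIndep (δ : ℕ) (t : ℕ → ℝ) (V : Finset ℕ) : Prop :=
  AffineIndependent ℝ (fun i : V => momentPoint δ (t i))

/-- `S` is (the set of vertex sets of the `δ`-simplices of) a triangulation of the convex hull of
the points with labels in `V`, using only these points as vertices. -/
structure IsTriangulationOf (δ : ℕ) (t : ℕ → ℝ) (V : Set ℕ) (S : Finset (Finset ℕ)) : Prop where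
  vertices : ∀ σ ∈ S, (σ : Set ℕ) ⊆ V
  card : ∀ σ ∈ S, σ.card = δ + 1
  indep : ∀ σ ∈ S, LabelsIndep δ t σ
  cover : (⋃ σ ∈ S, labelHull δ t (σ : Set ℕ)) = labelHull δ t V
  inter : ∀ σ ∈ S, ∀ τ ∈ S,
    labelHull δ t (σ : Set ℕ) ∩ labelHull δ t (τ : Set ℕ) = labelHull δ t ((σ ∩ τ : Finset ℕ) : Set ℕ)

/-- `S` is a triangulation of the cyclic polytope `C(m, δ)`. -/
def IsCyclicTriangulation (δ m : ℕ) (t : ℕ → ℝ) (S : Finset (Finset ℕ)) : Prop :=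
  IsTriangulationOf δ t (Set.Icc 1 m) S

/-- `T` is a bistellar flip of `S`: there are `δ + 2` vertices of `S`, no `δ + 1` of them in a
hyperplane, such that `S` restricts to a triangulation `P` of their convex hull, and `T` arises
from `S` by replacing `P` with the other triangulation `Q` of that hull on these vertices. -/
def IsBistellarFlip (δ : ℕ) (t : ℕ → ℝ) (S T : Finset (Finset ℕ)) : Prop :=
  ∃ Z : Finset ℕ, Z.card = δ + 2 ∧ (∀ z ∈ Z, ∃ σ ∈ S, z ∈ σ) ∧
    (∀ W ⊆ Z, W.card = δ + 1 → LabelsIndep δ t W) ∧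
    ∃ P Q : Finset (Finset ℕ),
      IsTriangulationOf δ t (Z : Set ℕ) P ∧ IsTriangulationOf δ t (Z : Set ℕ) Q ∧ P ≠ Q ∧
      P ⊆ S ∧ T = (S \ P) ∪ Q

/-- The unit vector of the last coordinate of `ℝ ^ δ`, which is the upward direction. -/
def upVector (δ : ℕ) : Fin δ → ℝ := fun j => if j.val + 1 = δ then 1 else 0

/-- `F` is a lower facet of `C(m, δ)`: a face of dimension `δ - 1` on which a linear functional
that decreases in the upward direction attains its maximum over the polytope. -/
def IsLowerFacet (δ m : ℕ) (t : ℕ → ℝ) (F : Set (Fin δ → ℝ)) : Prop :=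
  Module.finrank ℝ (vectorSpan ℝ F) + 1 = δ ∧
    ∃ l : (Fin δ → ℝ) →L[ℝ] ℝ, l (upVector δ) < 0 ∧ F = l.toExposed (cyclicPolytope δ m t)

/-- The set `e(S)` of the `d`-simplices (recorded as increasing `(d + 1)`-tuples of labels) of
`C(m, 2d)` that are faces of simplices of `S` and do not lie on any lower facet of `C(m, 2d)`. -/
def eSet (d m : ℕ) (t : ℕ → ℝ) (S : Finset (Finset ℕ)) : Set (Fin (d + 1) → ℕ) :=
  {A | StrictMono A ∧ (∀ i, A i ∈ Set.Icc 1 m) ∧ (∃ σ ∈ S, Set.range A ⊆ (σ : Set ℕ)) ∧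
    ∀ F, IsLowerFacet (2 * d) m t F → ¬ labelHull (2 * d) t (Set.range A) ⊆ F}

/-- The set of separated `(d + 1)`-tuples from `{1, …, m}`. -/
def separatedTuples (d m : ℕ) : Set (Fin (d + 1) → ℕ) :=
  {A | (∀ i, A i ∈ Set.Icc 1 m) ∧ ∀ i : Fin d, A i.castSucc + 2 ≤ A i.succ}

/-- `X` intertwines `Y`: `x₀ < y₀ < x₁ < y₁ < ⋯ < x_d < y_d`. -/
def Intertwines {d : ℕ} (X Y : Fin (d + 1) → ℕ) : Prop :=
  (∀ i, X i < Y i) ∧ ∀ i : Fin d, Y i.castSucc < X i.succ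

/-- No two elements of `R` intertwine, in either order. -/
def NonIntertwining {d : ℕ} (R : Set (Fin (d + 1) → ℕ)) : Prop :=
  ∀ X ∈ R, ∀ Y ∈ R, ¬ Intertwines X Y

/-- `A` is a complement for the non-intertwining set `R` of separated tuples: `A` is not in `R`,
and `R ∪ {A}` corresponds to a triangulation of `C(m, 2d)`. -/
def IsComplement (d m : ℕ) (t : ℕ → ℝ) (A : Fin (d + 1) → ℕ)
    (R : Set (Fin (d + 1) → ℕ)) : Prop :=
  A ∈ separatedTuples d m ∧ R ⊆ separatedTuples d m ∧ NonIntertwining R ∧ A ∉ R ∧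
    ∃ S : Finset (Finset ℕ), IsCyclicTriangulation (2 * d) m t S ∧ eSet d m t S = R ∪ {A}

/-- `A` and `B` are distinct complements of a common set. -/
def Exchangeable (d m : ℕ) (t : ℕ → ℝ) (A B : Fin (d + 1) → ℕ) : Prop :=
  A ≠ B ∧ ∃ R, IsComplement d m t A R ∧ IsComplement d m t B R

/-! A weight on the labels whose first `n` moments vanish is an affine dependence of points of the
moment curve in dimension `n - 1`, and it has at least `n` changes of sign (`exists_alternation`).
In dimension `2 * d` every nonzero dependence is therefore positive on one tuple and negative on
another that intertwines with it; conversely, each intertwining pair carries such a dependence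
(`exists_circuit_of_intertwines`).

This turns triangulations into sets `R` of separated tuples. A label set is compatible (`Compat`)
when all gapped tuples in it lie in `R`. If `R` is non-intertwining, compatible simplices meet in
common faces (`eq_of_compat_supports`), so they form a triangulation as soon as they cover the
polytope. Covering amounts to the local condition `FacetExtension`: walking along a generic segment
gives one direction (`FacetExtension.covers`), a perturbation the other
(`WeaklyCovers.facetExtension`).

The heart is `facetExtension_iff_ncard`: for a non-intertwining set of separated tuples, the local
condition holds exactly when the size is `(m - d - 1).choose d`. The induction merges the last label
into the one before it. The size of `R` is the size of the contraction `contr` (same `d`, one label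
fewer) plus that of the link `lnk` (`d` lowered by one, two labels fewer), and the binomials follow
Pascal's rule. So the binomial is always an upper bound, attained exactly when contraction and link
attain theirs. Facet extension passes between `R` and this pair as well; the difficult point is to
lift simplices of the contraction (`Compat.lift_contr`), an intermediate value argument one
dimension higher. Hence the sets `e(S)` are precisely the non-intertwining sets of separated tuples
of maximal size (`exists_eSet_eq_iff`), and `S` is recovered from `e(S)`.

If `A` and `B` complete the same `R`, they intertwine, since otherwise `R` with both would exceed
the bound. Conversely, for an intertwining pair a suitable `placing` triangulation contains every
separated tuple on `A ∪ B` except `B`. A tuple other than `B` that crosses `A` also crosses a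
further tuple on `A ∪ B` (`exists_intertwines_of_intertwines`), so `A` and `B` may be traded; this
also gives sufficiency in the third claim. For necessity and for flips, the simplices through `A`
turn out to be exactly those on `A ∪ B` that omit one entry of `B` (`eq_erase_of_exchange`,
`compat_erase_of_exchange`); they form one of the only two triangulations of the hull of `A ∪ B`. -/

/-! ### Affine dependences on the moment curve and barycentric coordinates -/

section Moments

variable {t : ℕ → ℝ}

/-- A nonzero weight on the moment curve whose first `n` moments vanish has at least `n` changes of
sign; if its `n`-th moment is nonnegative, there are `n` changes of sign ending in a positive
weight. -/
theorem exists_alternation (ht : StrictMono t) (V : Finset ℕ) (n : ℕ) (c : ℕ → ℝ)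
    (hc : ∀ k < n, ∑ x ∈ V, c x * t x ^ k = 0) (hn : 0 ≤ ∑ x ∈ V, c x * t x ^ n)
    (h0 : ∃ x ∈ V, c x ≠ 0) :
    ∃ y : ℕ → ℕ, (∀ j < n, y j < y (j + 1)) ∧
      ∀ j ≤ n, y j ∈ V ∧ 0 < (-1 : ℝ) ^ (n + j) * c (y j) := by
  induction n generalizing c with
  | zero =>
    obtain ⟨x, hx, hcx⟩ : ∃ x ∈ V, 0 < c x := by
      by_contra! h
      obtain ⟨x, hx, hcx⟩ := h0
      have : ∑ x ∈ V, c x < 0 :=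
        Finset.sum_neg' h ⟨x, hx, lt_of_le_of_ne (h x hx) hcx⟩
      simp at hn
      linarith
    refine ⟨fun _ => x, by simp, fun j hj => ⟨hx, ?_⟩⟩
    obtain rfl : j = 0 := by omega
    simpa using hcx
  | succ n ih =>
    have hsum : ∑ x ∈ V, c x = 0 := by simpa using hc 0 (by omega)
    obtain ⟨z0, hz0, hcz0⟩ := Finset.exists_pos_of_sum_zero_of_exists_nonzero c hsum h0
    obtain ⟨z, hz, hzmax⟩ : ∃ z ∈ V.filter (fun x => 0 < c x), ∀ x ∈ V.filter (fun x => 0 < c x),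
        x ≤ z := ⟨_, Finset.max'_mem _ ⟨z0, by simp [hz0, hcz0]⟩, fun x hx => Finset.le_max' _ x hx⟩
    rw [Finset.mem_filter] at hz
    -- Multiplying by `t x - t z`, with `z` the last label of positive weight, shifts the moments:
    -- the new `n`-th moment is the old one of order `n + 1`. Labels after `z` keep a nonpositive
    -- weight, so the alternation found by induction ends before `z`, and `z` is appended to it.
    have key : ∀ k, ∑ x ∈ V, c x * (t x - t z) * t x ^ k =
        ∑ x ∈ V, c x * t x ^ (k + 1) - t z * ∑ x ∈ V, c x * t x ^ k := by
      intro k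
      rw [Finset.mul_sum, ← Finset.sum_sub_distrib]
      exact Finset.sum_congr rfl fun x _ => by ring
    obtain ⟨x, hx, hcx⟩ : ∃ x ∈ V, c x < 0 := by
      by_contra! h
      have : 0 < ∑ x ∈ V, c x := Finset.sum_pos' h ⟨z, hz⟩
      linarith
    obtain ⟨y, hy1, hy2⟩ := ih (fun x => c x * (t x - t z))
      (fun k hk => by rw [key, hc (k + 1) (by omega), hc k (by omega)]; simp)
      (by rw [key, hc n (by omega)]; simpa using hn)
      ⟨x, hx, mul_ne_zero hcx.ne (sub_ne_zero.2 (ht.injective.ne (by rintro rfl; linarith)))⟩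
    have hmono : ∀ j k, j ≤ k → k ≤ n → y j ≤ y k := by
      intro j k hjk
      induction k, hjk using Nat.le_induction with
      | base => simp
      | succ k hk ih => exact fun h => (ih (by omega)).trans (hy1 k (by omega)).le
    have htop : y n < z := by
      have h := (hy2 n le_rfl).2
      rw [Even.neg_one_pow ⟨n, rfl⟩, one_mul] at h
      by_contra! h'
      rcases h'.lt_or_eq with h' | h'
      · have h1 : c (y n) ≤ 0 := by
          by_contra! h2
          have := hzmax (y n) (by simp [(hy2 n le_rfl).1, h2])
          omega
        have h2 : 0 < t (y n) - t z := sub_pos.2 (ht h')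
        nlinarith
      · simp [← h'] at h
    refine ⟨fun j => if j ≤ n then y j else z, fun j hj => ?_, fun j hj => ?_⟩
    · rcases Nat.lt_succ_iff_lt_or_eq.1 hj with h | rfl
      · simpa [h.le, Nat.succ_le_of_lt h] using hy1 j h
      · simpa using htop
    · by_cases h : j ≤ n
      · simp only [h, if_true]
        refine ⟨(hy2 j h).1, ?_⟩
        have h1 := (hy2 j h).2
        have h2 : 0 < t z - t (y j) := sub_pos.2 (ht ((hmono j n h le_rfl).trans_lt htop))
        have h3 : 0 < ((-1 : ℝ) ^ (n + 1 + j) * c (y j)) * (t z - t (y j)) := by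
          calc (0 : ℝ) < _ := h1
            _ = _ := by ring
        exact pos_of_mul_pos_left h3 h2.le
      · obtain rfl : j = n + 1 := by omega
        simp only [h, if_false]
        refine ⟨hz.1, ?_⟩
        rw [Even.neg_one_pow ⟨n + 1, rfl⟩, one_mul]
        exact hz.2

theorem sum_mul_eval_eq_zero (V : Finset ℕ) (n : ℕ) (c : ℕ → ℝ)
    (hc : ∀ k < n, ∑ x ∈ V, c x * t x ^ k = 0) (p : Polynomial ℝ) (hp : p.natDegree < n) :
    ∑ x ∈ V, c x * p.eval (t x) = 0 := by
  simp_rw [Polynomial.eval_eq_sum_range, Finset.mul_sum]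
  rw [Finset.sum_comm]
  refine Finset.sum_eq_zero fun k hk => ?_
  rw [Finset.mem_range] at hk
  calc _ = p.coeff k * ∑ x ∈ V, c x * t x ^ k := by
        rw [Finset.mul_sum]; exact Finset.sum_congr rfl fun x _ => by ring
    _ = 0 := by rw [hc k (by omega), mul_zero]

theorem sum_mul_eval_of_monic (V : Finset ℕ) (n : ℕ) (c : ℕ → ℝ)
    (hc : ∀ k < n, ∑ x ∈ V, c x * t x ^ k = 0) (p : Polynomial ℝ) (hp : p.natDegree = n)
    (hm : p.Monic) :
    ∑ x ∈ V, c x * p.eval (t x) = ∑ x ∈ V, c x * t x ^ n := by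
  simp_rw [Polynomial.eval_eq_sum_range, Finset.mul_sum]
  rw [Finset.sum_comm, hp, Finset.sum_range_succ]
  rw [Finset.sum_eq_zero, zero_add]
  · refine Finset.sum_congr rfl fun x _ => ?_
    rw [← hp, hm.coeff_natDegree, one_mul]
  · intro k hk
    rw [Finset.mem_range] at hk
    calc _ = p.coeff k * ∑ x ∈ V, c x * t x ^ k := by
          rw [Finset.mul_sum]; exact Finset.sum_congr rfl fun x _ => by ring
      _ = 0 := by rw [hc k hk, mul_zero]

/-- The value at `t x` of the monic polynomial with roots at the parameters of `F`. Its sign says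
on which side of the hyperplane spanned by `F` the point with label `x` lies. -/
def side (t : ℕ → ℝ) (F : Finset ℕ) (x : ℕ) : ℝ := ∏ f ∈ F, (t x - t f)

/-- The monic polynomial with roots at the parameters of `F`. -/
noncomputable def sidePoly (t : ℕ → ℝ) (F : Finset ℕ) : Polynomial ℝ :=
  ∏ f ∈ F, (Polynomial.X - Polynomial.C (t f))

theorem eval_sidePoly (F : Finset ℕ) (x : ℕ) : (sidePoly t F).eval (t x) = side t F x := by
  simp [sidePoly, side, Polynomial.eval_prod]

theorem sidePoly_monic (F : Finset ℕ) : (sidePoly t F).Monic :=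
  Polynomial.monic_prod_of_monic _ _ fun _ _ => Polynomial.monic_X_sub_C _

theorem natDegree_sidePoly (F : Finset ℕ) : (sidePoly t F).natDegree = F.card := by
  rw [sidePoly, Polynomial.natDegree_prod_of_monic _ _ fun _ _ => Polynomial.monic_X_sub_C _]
  simp

theorem side_eq_zero_iff (ht : StrictMono t) {F : Finset ℕ} {x : ℕ} : side t F x = 0 ↔ x ∈ F := by
  simp [side, Finset.prod_eq_zero_iff, sub_eq_zero, ht.injective.eq_iff]

theorem side_insert {F : Finset ℕ} {y : ℕ} (hy : y ∉ F) (x : ℕ) :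
    side t (insert y F) x = (t x - t y) * side t F x := by
  simp [side, Finset.prod_insert hy]

theorem side_pos_of_forall_lt (ht : StrictMono t) {F : Finset ℕ} {x : ℕ} (h : ∀ f ∈ F, f < x) :
    0 < side t F x :=
  Finset.prod_pos fun f hf => sub_pos.2 (ht (h f hf))

theorem sum_mul_side_eq_zero (V : Finset ℕ) (n : ℕ) (c : ℕ → ℝ)
    (hc : ∀ k < n, ∑ x ∈ V, c x * t x ^ k = 0) (F : Finset ℕ) (hF : F.card < n) :
    ∑ x ∈ V, c x * side t F x = 0 := by
  simp_rw [← eval_sidePoly]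
  exact sum_mul_eval_eq_zero V n c hc _ (by rwa [natDegree_sidePoly])

theorem sum_mul_side_eq_sum_mul_pow (V : Finset ℕ) (n : ℕ) (c : ℕ → ℝ)
    (hc : ∀ k < n, ∑ x ∈ V, c x * t x ^ k = 0) (F : Finset ℕ) (hF : F.card = n) :
    ∑ x ∈ V, c x * side t F x = ∑ x ∈ V, c x * t x ^ n := by
  simp_rw [← eval_sidePoly]
  exact sum_mul_eval_of_monic V n c hc _ (by rwa [natDegree_sidePoly]) (sidePoly_monic F)

/-- The barycentric coordinate at `i` with respect to the simplex `σ` of the weighted sum of points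
of the moment curve given by the weight `μ` on `V`. -/
noncomputable def coord (t : ℕ → ℝ) (V σ : Finset ℕ) (μ : ℕ → ℝ) (i : ℕ) : ℝ :=
  ∑ x ∈ V, μ x * (Lagrange.basis σ t i).eval (t x)

theorem sum_basis_mul_pow (ht : StrictMono t) (σ : Finset ℕ) (x k : ℕ) (hk : k < σ.card) :
    ∑ i ∈ σ, (Lagrange.basis σ t i).eval (t x) * t i ^ k = t x ^ k := by
  have h := Lagrange.eq_interpolate_of_eval_eq (s := σ) (v := t) (f := Polynomial.X ^ k)
    (fun i => t i ^ k) ht.injective.injOn (by simpa using hk) (by simp)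
  have h2 := congrArg (Polynomial.eval (t x)) h
  rw [Lagrange.interpolate_apply, Polynomial.eval_finsetSum] at h2
  simp only [Polynomial.eval_pow, Polynomial.eval_X, Polynomial.eval_mul, Polynomial.eval_C] at h2
  rw [h2]
  exact Finset.sum_congr rfl fun i _ => by ring

theorem sum_coord_mul_pow (ht : StrictMono t) (V σ : Finset ℕ) (μ : ℕ → ℝ) (k : ℕ)
    (hk : k < σ.card) :
    ∑ i ∈ σ, coord t V σ μ i * t i ^ k = ∑ x ∈ V, μ x * t x ^ k := by
  simp_rw [coord, Finset.sum_mul]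
  rw [Finset.sum_comm]
  refine Finset.sum_congr rfl fun x _ => ?_
  rw [← sum_basis_mul_pow ht σ x k hk, Finset.mul_sum]
  exact Finset.sum_congr rfl fun i _ => by ring

theorem eval_basis_self_of_mem (ht : StrictMono t) {σ : Finset ℕ} {i : ℕ} (hi : i ∈ σ) :
    (Lagrange.basis σ t i).eval (t i) = 1 :=
  Lagrange.eval_basis_self ht.injective.injOn hi

/-- The Lagrange basis polynomial of `i` has degree below `σ.card`, so it pairs to zero with the
difference of the two weights, and on `σ` it is the indicator of `i`. Thus barycentric coordinates
depend on the moments only. -/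
theorem coord_eq_of_moments (ht : StrictMono t) {V σ : Finset ℕ} (hσ : σ ⊆ V) {μ v : ℕ → ℝ}
    (hv : ∀ i ∉ σ, v i = 0)
    (h : ∀ k < σ.card, ∑ x ∈ V, v x * t x ^ k = ∑ x ∈ V, μ x * t x ^ k) {i : ℕ} (hi : i ∈ σ) :
    coord t V σ μ i = v i := by
  have h1 := sum_mul_eval_eq_zero V σ.card (fun x => v x - μ x)
    (fun k hk => by simp_rw [sub_mul]; rw [Finset.sum_sub_distrib, h k hk, sub_self])
    (Lagrange.basis σ t i) (by
      rw [Lagrange.natDegree_basis ht.injective.injOn hi]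
      have := Finset.card_pos.2 ⟨i, hi⟩
      omega)
  simp_rw [sub_mul] at h1
  rw [Finset.sum_sub_distrib, sub_eq_zero] at h1
  rw [coord, ← h1, Finset.sum_eq_single i, eval_basis_self_of_mem ht hi, mul_one]
  · intro j _ hji
    by_cases hj : j ∈ σ
    · rw [Lagrange.eval_basis_of_ne hji.symm hj, mul_zero]
    · rw [hv j hj, zero_mul]
  · exact fun h => absurd (hσ hi) h

/-- The Lagrange basis polynomial of the apex `y` is `sidePoly t F` divided by its value at `y`. So
the sign of the apex coordinate says whether the point and `y` are on the same side of `F`, which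
controls the crossing of facets. -/
theorem coord_insert (V F : Finset ℕ) {y : ℕ} (hy : y ∉ F) (μ : ℕ → ℝ) :
    coord t V (insert y F) μ y = (∑ x ∈ V, μ x * side t F x) / side t F y := by
  rw [coord, Finset.sum_div]
  refine Finset.sum_congr rfl fun x _ => ?_
  rw [mul_div_assoc]
  congr 1
  simp [Lagrange.basis, Finset.erase_insert hy, Polynomial.eval_prod, Lagrange.basisDivisor, side,
    Finset.prod_mul_distrib, Finset.prod_inv_distrib, div_eq_inv_mul]

theorem coord_add_smul (V σ : Finset ℕ) (μ ν : ℕ → ℝ) (a b : ℝ) (i : ℕ) :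
    coord t V σ (fun x => a * μ x + b * ν x) i = a * coord t V σ μ i + b * coord t V σ ν i := by
  simp_rw [coord, Finset.mul_sum]
  rw [← Finset.sum_add_distrib]
  exact Finset.sum_congr rfl fun x _ => by ring

/-- The affine dependence of `n + 1` points of the moment curve in dimension `n - 1`. -/
theorem exists_circuit (ht : StrictMono t) (n : ℕ) (x : ℕ → ℕ) (hx : ∀ j < n, x j < x (j + 1)) :
    ∃ c : ℕ → ℝ, (∀ i, (∀ j ≤ n, i ≠ x j) → c i = 0) ∧ (∀ j ≤ n, 0 < (-1 : ℝ) ^ (n + j) * c (x j)) ∧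
      ∀ V : Finset ℕ, (∀ j ≤ n, x j ∈ V) → (∀ k < n, ∑ i ∈ V, c i * t i ^ k = 0) ∧
        0 < ∑ i ∈ V, c i * t i ^ n := by
  have hmono : StrictMono (fun j : Fin (n + 1) => x j) :=
    Fin.strictMono_iff_lt_succ.2 fun i => by simpa using hx i i.2
  set Z : Finset ℕ := Finset.univ.image (fun j : Fin (n + 1) => x j) with hZ
  have hmem : ∀ j ≤ n, x j ∈ Z := fun j hj => by
    rw [hZ, Finset.mem_image]
    exact ⟨⟨j, by omega⟩, Finset.mem_univ _, rfl⟩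
  have hmem' : ∀ i ∈ Z, ∃ j ≤ n, x j = i := fun i hi => by
    rw [hZ, Finset.mem_image] at hi
    obtain ⟨j, _, rfl⟩ := hi
    exact ⟨j, by omega, rfl⟩
  have hcard : Z.card = n + 1 := by
    rw [hZ, Finset.card_image_of_injective _ hmono.injective, Finset.card_univ, Fintype.card_fin]
  have hz : x 0 ∈ Z := hmem 0 (by omega)
  have hcard' : (Z.erase (x 0)).card = n := by rw [Finset.card_erase_of_mem hz, hcard]; simp
  -- The dependence expresses the point of `x 0` by the other `n` points through Lagrange
  -- interpolation. Its moment of order `n` is the value at `x 0` of the monic polynomial vanishing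
  -- at the others, hence nonzero; a global sign `e` makes it positive.
  let μ : ℕ → ℝ := fun i => if i = x 0 then 1 else 0
  let c : ℕ → ℝ := fun i => μ i - if i ∈ Z.erase (x 0) then coord t Z (Z.erase (x 0)) μ i else 0
  have hc0 : c (x 0) = 1 := by simp [c, μ]
  have hcsupp : ∀ i ∉ Z, c i = 0 := fun i hi => by
    have h1 : i ≠ x 0 := fun h => hi (h ▸ hz)
    simp [c, μ, hi, h1]
  have hcm : ∀ k < n, ∑ i ∈ Z, c i * t i ^ k = 0 := by
    intro k hk
    have h := sum_coord_mul_pow ht Z (Z.erase (x 0)) μ k (by omega)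
    simp only [c, sub_mul, Finset.sum_sub_distrib, ite_mul, zero_mul]
    rw [Finset.sum_ite_mem, Finset.inter_eq_right.2 (Finset.erase_subset _ _), h, sub_self]
  have hcn : ∑ i ∈ Z, c i * t i ^ n ≠ 0 := by
    rw [← sum_mul_side_eq_sum_mul_pow Z n c hcm _ hcard']
    rw [Finset.sum_eq_single (x 0), hc0, one_mul]
    · rw [Ne, side_eq_zero_iff ht]; simp
    · intro b hb hne
      rw [(side_eq_zero_iff ht).2 (Finset.mem_erase.2 ⟨hne, hb⟩), mul_zero]
    · exact fun h => absurd hz h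
  obtain ⟨e, he, hepos⟩ : ∃ e : ℝ, e ≠ 0 ∧ 0 < e * ∑ i ∈ Z, c i * t i ^ n := by
    rcases hcn.lt_or_gt with h | h
    · exact ⟨-1, by norm_num, by linarith⟩
    · exact ⟨1, by norm_num, by linarith⟩
  have hs : ∀ k, ∑ i ∈ Z, e * c i * t i ^ k = e * ∑ i ∈ Z, c i * t i ^ k := fun k => by
    rw [Finset.mul_sum]; exact Finset.sum_congr rfl fun x _ => by ring
  have hV : ∀ V : Finset ℕ, (∀ j ≤ n, x j ∈ V) → ∀ k,
      ∑ i ∈ V, e * c i * t i ^ k = ∑ i ∈ Z, e * c i * t i ^ k := by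
    intro V hV k
    symm
    refine Finset.sum_subset (fun i hi => ?_) (fun i _ hi => by simp [hcsupp i hi])
    obtain ⟨j, hj, rfl⟩ := hmem' i hi
    exact hV j hj
  obtain ⟨y, hy1, hy2⟩ := exists_alternation ht Z n (fun i => e * c i)
    (fun k hk => by rw [hs, hcm k hk, mul_zero]) (by rw [hs]; exact hepos.le)
    ⟨x 0, hz, by simp [hc0, he]⟩
  have hymono : StrictMono (fun j : Fin (n + 1) => y j) :=
    Fin.strictMono_iff_lt_succ.2 fun i => by simpa using hy1 i i.2
  -- The alternation has `n + 1` labels in the `(n + 1)`-element set `Z`, so it is `x` itself, which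
  -- fixes every sign.
  have hxy : (fun j : Fin (n + 1) => y j) = fun j : Fin (n + 1) => x j := by
    refine (hymono.range_inj hmono).1 ?_
    have h1 : Finset.univ.image (fun j : Fin (n + 1) => y j) = Z := by
      refine Finset.eq_of_subset_of_card_le ?_ ?_
      · intro i hi
        rw [Finset.mem_image] at hi
        obtain ⟨j, _, rfl⟩ := hi
        exact (hy2 j (by omega)).1
      · rw [hcard, Finset.card_image_of_injective _ hymono.injective, Finset.card_univ,
          Fintype.card_fin]
    have h2 := congrArg (fun s : Finset ℕ => (s : Set ℕ)) (h1.trans hZ)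
    simpa [Finset.coe_image] using h2
  refine ⟨fun i => e * c i, fun i hi => ?_, fun j hj => ?_, fun V hV' => ⟨fun k hk => ?_, ?_⟩⟩
  · simp only
    rw [hcsupp i fun h => ?_, mul_zero]
    obtain ⟨j, hj, rfl⟩ := hmem' i h
    exact hi j hj rfl
  · have h := congrFun hxy ⟨j, by omega⟩
    simp only at h
    rw [← h]
    exact (hy2 j hj).2
  · rw [hV V hV', hs, hcm k hk, mul_zero]
  · rw [hV V hV', hs]; exact hepos

end Moments

/-! ### Intertwining pairs, compatible label sets and sides of facets -/

section Combinatorics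

variable {d : ℕ}

/-- Consecutive entries of the tuple differ by at least two. -/
def Gapped (C : Fin (d + 1) → ℕ) : Prop := ∀ i : Fin d, C i.castSucc + 2 ≤ C i.succ

/-- Every gapped tuple with entries in `F` belongs to `R`. -/
def Compat (R : Set (Fin (d + 1) → ℕ)) (F : Finset ℕ) : Prop :=
  ∀ C : Fin (d + 1) → ℕ, Gapped C → (∀ i, C i ∈ F) → C ∈ R

/-- Every compatible set of `2 d` labels extends to a compatible set of `2 d + 1` labels on each
side on which there are labels at all. -/
def FacetExtension (t : ℕ → ℝ) (m : ℕ) (R : Set (Fin (d + 1) → ℕ)) : Prop :=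
  ∀ F ⊆ Finset.Icc 1 m, F.card = 2 * d → Compat R F → ∀ x ∈ Finset.Icc 1 m, x ∉ F →
    ∃ y ∈ Finset.Icc 1 m, 0 < side t F x * side t F y ∧ Compat R (insert y F)

theorem mem_separatedTuples {m : ℕ} {A : Fin (d + 1) → ℕ} :
    A ∈ separatedTuples d m ↔ (∀ i, A i ∈ Finset.Icc 1 m) ∧ Gapped A := by
  simp [separatedTuples, Gapped]

theorem Compat.mono {R : Set (Fin (d + 1) → ℕ)} {F G : Finset ℕ} (h : Compat R F) (hGF : G ⊆ F) :
    Compat R G :=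
  fun C hC hCG => h C hC fun i => hGF (hCG i)

theorem Intertwines.gapped_left {X Y : Fin (d + 1) → ℕ} (h : Intertwines X Y) : Gapped X :=
  fun i => by have := h.1 i.castSucc; have := h.2 i; omega

theorem Intertwines.gapped_right {X Y : Fin (d + 1) → ℕ} (h : Intertwines X Y) : Gapped Y :=
  fun i => by have := h.1 i.succ; have := h.2 i; omega

theorem Gapped.strictMono {X : Fin (d + 1) → ℕ} (h : Gapped X) : StrictMono X :=
  Fin.strictMono_iff_lt_succ.2 fun i => by have := h i; omega

theorem intertwines_of_seq (y : ℕ → ℕ) (hy : ∀ j < 2 * d + 1, y j < y (j + 1)) :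
    Intertwines (fun i : Fin (d + 1) => y (2 * i)) (fun i : Fin (d + 1) => y (2 * i + 1)) := by
  refine ⟨fun i => hy _ (by omega), fun i => ?_⟩
  have := hy (2 * i + 1) (by omega)
  simpa [mul_add] using this

/-- An affine dependence of points of the moment curve in dimension `2 d`, with nonnegative moment
of order `2 d + 1`, contains an intertwining pair of tuples with negative and positive weights. -/
theorem exists_intertwines_of_moments_of_nonneg {t : ℕ → ℝ} (ht : StrictMono t) (V : Finset ℕ)
    (c : ℕ → ℝ) (hc : ∀ k < 2 * d + 1, ∑ x ∈ V, c x * t x ^ k = 0)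
    (hn : 0 ≤ ∑ x ∈ V, c x * t x ^ (2 * d + 1)) (h0 : ∃ x ∈ V, c x ≠ 0) :
    ∃ P N : Fin (d + 1) → ℕ, (∀ i, P i ∈ V ∧ 0 < c (P i)) ∧ (∀ i, N i ∈ V ∧ c (N i) < 0) ∧
      Intertwines N P := by
  obtain ⟨y, hy1, hy2⟩ := exists_alternation ht V (2 * d + 1) c hc hn h0
  refine ⟨_, _, fun i => ?_, fun i => ?_, intertwines_of_seq y hy1⟩
  · have h := hy2 (2 * i + 1) (by omega)
    rw [Even.neg_one_pow ⟨d + i + 1, by ring⟩, one_mul] at h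
    exact h
  · have h := hy2 (2 * i) (by omega)
    rw [Odd.neg_one_pow ⟨d + i, by ring⟩] at h
    exact ⟨h.1, by linarith [h.2]⟩

/-- An affine dependence of points of the moment curve in dimension `2 d` contains an intertwining
pair of tuples with positive and negative weights. -/
theorem exists_intertwines_of_moments {t : ℕ → ℝ} (ht : StrictMono t) (V : Finset ℕ) (c : ℕ → ℝ)
    (hc : ∀ k < 2 * d + 1, ∑ x ∈ V, c x * t x ^ k = 0) (h0 : ∃ x ∈ V, c x ≠ 0) :
    ∃ P N : Fin (d + 1) → ℕ, (∀ i, P i ∈ V ∧ 0 < c (P i)) ∧ (∀ i, N i ∈ V ∧ c (N i) < 0) ∧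
      (Intertwines P N ∨ Intertwines N P) := by
  rcases le_total 0 (∑ x ∈ V, c x * t x ^ (2 * d + 1)) with h | h
  · obtain ⟨P, N, h1, h2, h3⟩ := exists_intertwines_of_moments_of_nonneg ht V c hc h h0
    exact ⟨P, N, h1, h2, Or.inr h3⟩
  · obtain ⟨P, N, h1, h2, h3⟩ := exists_intertwines_of_moments_of_nonneg ht V (fun x => -c x)
      (fun k hk => by simp [Finset.sum_neg_distrib, hc k hk])
      (by simpa [Finset.sum_neg_distrib] using h) (by simpa using h0)
    exact ⟨N, P, fun i => ⟨(h2 i).1, by linarith [(h2 i).2]⟩,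
      fun i => ⟨(h1 i).1, by linarith [(h1 i).2]⟩, Or.inl h3⟩

/-- A point has at most one representation as a nonnegative combination of points with labels in a
compatible set. -/
theorem eq_of_compat_supports {t : ℕ → ℝ} (ht : StrictMono t) {R : Set (Fin (d + 1) → ℕ)}
    (hR : NonIntertwining R) (V F G : Finset ℕ) (hF : Compat R F) (hG : Compat R G) {u v : ℕ → ℝ}
    (hu : ∀ x, 0 ≤ u x) (hv : ∀ x, 0 ≤ v x) (huF : ∀ x ∉ F, u x = 0) (hvG : ∀ x ∉ G, v x = 0)
    (h : ∀ k < 2 * d + 1, ∑ x ∈ V, u x * t x ^ k = ∑ x ∈ V, v x * t x ^ k) :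
    ∀ x ∈ V, u x = v x := by
  by_contra! h0
  obtain ⟨P, N, hP, hN, hPN⟩ := exists_intertwines_of_moments (d := d) ht V (fun x => u x - v x)
    (fun k hk => by simp_rw [sub_mul]; rw [Finset.sum_sub_distrib, h k hk, sub_self])
    (by obtain ⟨x, hx, hne⟩ := h0; exact ⟨x, hx, sub_ne_zero.2 hne⟩)
  have hPF : ∀ i, P i ∈ F := fun i => by
    by_contra hi
    have := (hP i).2
    have := hv (P i)
    rw [huF _ hi] at *
    linarith
  have hNG : ∀ i, N i ∈ G := fun i => by
    by_contra hi
    have := (hN i).2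
    have := hu (N i)
    rw [hvG _ hi] at *
    linarith
  rcases hPN with h | h
  · exact hR P (hF P h.gapped_left hPF) N (hG N h.gapped_right hNG) h
  · exact hR N (hG N h.gapped_left hNG) P (hF P h.gapped_right hPF) h

/-- A compatible set of labels has at most `2 d + 1` elements. -/
theorem Compat.card_le {R : Set (Fin (d + 1) → ℕ)} (hR : NonIntertwining R) {F : Finset ℕ}
    (hF : Compat R F) : F.card ≤ 2 * d + 1 := by
  by_contra! h
  let y : ℕ → ℕ := fun j => if h' : j < F.card then F.orderEmbOfFin rfl ⟨j, h'⟩ else 0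
  have hy1 : ∀ j < 2 * d + 1, y j < y (j + 1) := fun j hj => by
    simp only [y, show j < F.card by omega, show j + 1 < F.card by omega, dif_pos]
    exact (F.orderEmbOfFin rfl).strictMono (by simp [Fin.lt_def])
  have hy2 : ∀ j < 2 * d + 2, y j ∈ F := fun j hj => by
    simp only [y, show j < F.card by omega, dif_pos]
    exact F.orderEmbOfFin_mem rfl _
  have h3 := intertwines_of_seq y hy1
  exact hR _ (hF _ h3.gapped_left fun i => hy2 _ (by omega)) _
    (hF _ h3.gapped_right fun i => hy2 _ (by omega)) h3

/-- A circuit on `2 d + 2` labels splits them into an intertwining pair. -/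
theorem exists_intertwines_of_card {t : ℕ → ℝ} (ht : StrictMono t) (Z : Finset ℕ)
    (hZ : Z.card = 2 * d + 2) :
    ∃ c : ℕ → ℝ, ∃ P N : Fin (d + 1) → ℕ, (∀ k < 2 * d + 1, ∑ x ∈ Z, c x * t x ^ k = 0) ∧
      (∀ i, 0 < c (P i)) ∧ (∀ i, c (N i) < 0) ∧
      (∀ z, z ∈ Z ↔ (∃ i, z = P i) ∨ ∃ i, z = N i) ∧ (∀ z ∉ Z, c z = 0) ∧ Intertwines N P := by
  let y : ℕ → ℕ := fun j => if h' : j < Z.card then Z.orderEmbOfFin rfl ⟨j, h'⟩ else 0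
  have hy1 : ∀ j < 2 * d + 1, y j < y (j + 1) := fun j hj => by
    simp only [y, show j < Z.card by omega, show j + 1 < Z.card by omega, dif_pos]
    exact (Z.orderEmbOfFin rfl).strictMono (by simp [Fin.lt_def])
  have hy2 : ∀ j < 2 * d + 2, y j ∈ Z := fun j hj => by
    simp only [y, show j < Z.card by omega, dif_pos]
    exact Z.orderEmbOfFin_mem rfl _
  have hy3 : ∀ z ∈ Z, ∃ j < 2 * d + 2, z = y j := fun z hz => by
    have : z ∈ Set.range (Z.orderEmbOfFin rfl) := by rw [Finset.range_orderEmbOfFin]; exact hz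
    obtain ⟨j, rfl⟩ := this
    exact ⟨j, by omega, by simp [y]⟩
  obtain ⟨c, hc1, hc2, hc3⟩ := exists_circuit ht (2 * d + 1) y hy1
  refine ⟨c, fun i => y (2 * i + 1), fun i => y (2 * i),
    (hc3 Z fun j hj => hy2 j (by omega)).1, fun i => ?_, fun i => ?_, fun z => ⟨fun hz => ?_, ?_⟩,
    fun z hz => ?_, intertwines_of_seq y hy1⟩
  · have h := hc2 (2 * i + 1) (by omega)
    rwa [Even.neg_one_pow ⟨d + i + 1, by ring⟩, one_mul] at h
  · have h := hc2 (2 * i) (by omega)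
    rw [Odd.neg_one_pow ⟨d + i, by ring⟩] at h
    linarith
  · obtain ⟨j, hj, rfl⟩ := hy3 z hz
    rcases Nat.even_or_odd' j with ⟨k, rfl | rfl⟩
    · exact Or.inr ⟨⟨k, by omega⟩, rfl⟩
    · exact Or.inl ⟨⟨k, by omega⟩, rfl⟩
  · rintro (⟨i, rfl⟩ | ⟨i, rfl⟩)
    · exact hy2 _ (by omega)
    · exact hy2 _ (by omega)
  · exact hc1 z fun j hj h => hz (h ▸ hy2 j (by omega))

/-- Two compatible simplices on the same side of a common facet coincide. -/
theorem eq_of_compat_insert {t : ℕ → ℝ} (ht : StrictMono t) {R : Set (Fin (d + 1) → ℕ)}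
    (hR : NonIntertwining R) {F : Finset ℕ} (hF : F.card = 2 * d) {x y : ℕ}
    (hxy : 0 < side t F x * side t F y) (hx : Compat R (insert x F))
    (hy : Compat R (insert y F)) : x = y := by
  by_contra hne
  have hxF : x ∉ F := fun h => by simp [(side_eq_zero_iff ht).2 h] at hxy
  have hyF : y ∉ F := fun h => by simp [(side_eq_zero_iff ht).2 h] at hxy
  have hyF' : y ∉ insert x F := by simp [hyF, Ne.symm hne]
  obtain ⟨c, P, N, hc, hP, hN, hZ, -, hNP⟩ := exists_intertwines_of_card (d := d) ht
    (insert y (insert x F)) (by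
      rw [Finset.card_insert_of_notMem hyF', Finset.card_insert_of_notMem hxF, hF])
  have hside := sum_mul_side_eq_zero _ _ c hc F (by omega)
  rw [Finset.sum_insert hyF', Finset.sum_insert hxF, Finset.sum_eq_zero (s := F) (fun f hf => by
    rw [(side_eq_zero_iff ht).2 hf, mul_zero]), add_zero] at hside
  -- Paired with the polynomial of `F`, the dependence retains only `x` and `y`; being on the same
  -- side, they carry opposite signs. So each tuple of the circuit avoids `x` or `y` and lies in a
  -- compatible simplex.
  have h1 : c x * c y ≤ 0 := by
    by_contra! h
    have h2 : c y * side t F y = -(c x * side t F x) := by linarith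
    have h3 : (c x * c y) * (side t F x * side t F y) = -(c x * side t F x) ^ 2 := by
      calc _ = (c x * side t F x) * (c y * side t F y) := by ring
        _ = _ := by rw [h2]; ring
    nlinarith [mul_pos h hxy, sq_nonneg (c x * side t F x)]
  have hPZ : ∀ i, P i ∈ insert y (insert x F) := fun i => (hZ _).2 (Or.inl ⟨i, rfl⟩)
  have hNZ : ∀ i, N i ∈ insert y (insert x F) := fun i => (hZ _).2 (Or.inr ⟨i, rfl⟩)
  have hne0 : ∀ z ∈ insert y (insert x F), c z ≠ 0 := fun z hz => by
    rcases (hZ z).1 hz with ⟨i, rfl⟩ | ⟨i, rfl⟩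
    · exact (hP i).ne'
    · exact (hN i).ne
  have h2 : c x * c y < 0 := lt_of_le_of_ne h1
    (mul_ne_zero (hne0 x (by simp)) (hne0 y (by simp)))
  have hmem : ∀ z, z ∈ insert y (insert x F) → (z ≠ y → z ∈ insert x F) ∧
      (z ≠ x → z ∈ insert y F) := by
    intro z hz
    simp only [Finset.mem_insert] at hz ⊢
    tauto
  rcases mul_neg_iff.1 h2 with ⟨hcx, hcy⟩ | ⟨hcx, hcy⟩
  · refine hR N (hy N hNP.gapped_left fun i => (hmem _ (hNZ i)).2 ?_)
      P (hx P hNP.gapped_right fun i => (hmem _ (hPZ i)).1 ?_) hNP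
    · intro h; have := hN i; rw [h] at this; linarith
    · intro h; have := hP i; rw [h] at this; linarith
  · refine hR N (hx N hNP.gapped_left fun i => (hmem _ (hNZ i)).1 ?_)
      P (hy P hNP.gapped_right fun i => (hmem _ (hPZ i)).2 ?_) hNP
    · intro h; have := hN i; rw [h] at this; linarith
    · intro h; have := hP i; rw [h] at this; linarith

/-- The circuit on the `x j` pairs with the monic polynomial of `F` to its positive moment of order
`n`, so some term is positive; the alternating signs of the circuit turn this into a sign of `side`.
-/
theorem exists_side_mul_pos {t : ℕ → ℝ} (ht : StrictMono t) {F : Finset ℕ} {n : ℕ}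
    (hF : F.card = n) (x : ℕ → ℕ) (hx : ∀ j < n, x j < x (j + 1)) :
    ∃ j ≤ n, 0 < (-1 : ℝ) ^ (n + j) * side t F (x j) := by
  obtain ⟨c, hc1, hc2, hc3⟩ := exists_circuit ht n x hx
  set Z : Finset ℕ := (Finset.range (n + 1)).image x
  obtain ⟨hc4, hc5⟩ := hc3 Z fun j hj => Finset.mem_image_of_mem _ (Finset.mem_range.2 (by omega))
  rw [← sum_mul_side_eq_sum_mul_pow Z n c hc4 F hF] at hc5
  obtain ⟨z, hz, hpos⟩ := Finset.exists_lt_of_sum_lt (s := Z) (f := fun _ => (0 : ℝ))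
    (g := fun z => c z * side t F z) (by simpa using hc5)
  obtain ⟨j, hj, rfl⟩ := Finset.mem_image.1 hz
  rw [Finset.mem_range] at hj
  refine ⟨j, by omega, ?_⟩
  have h1 := hc2 j (by omega)
  have h2 : 0 < ((-1 : ℝ) ^ (n + j) * c (x j)) * ((-1 : ℝ) ^ (n + j) * side t F (x j)) := by
    have h3 : (-1 : ℝ) ^ (n + j) * (-1 : ℝ) ^ (n + j) = 1 := by
      rw [← pow_add]; exact Even.neg_one_pow ⟨_, rfl⟩
    calc (0 : ℝ) < ((-1 : ℝ) ^ (n + j) * (-1 : ℝ) ^ (n + j)) * (c (x j) * side t F (x j)) := by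
          rw [h3, one_mul]; exact hpos
      _ = _ := by ring
  exact pos_of_mul_pos_right h2 h1.le

/-- Between the entries of a gapped tuple in `F` there are labels below the hyperplane of `F`. -/
theorem exists_side_neg {t : ℕ → ℝ} (ht : StrictMono t) {F : Finset ℕ} (hF : F.card = 2 * d)
    {X : Fin (d + 1) → ℕ} (hX : Gapped X) (hXF : ∀ i, X i ∈ F) :
    ∃ i : Fin d, side t F (X i.castSucc + 1) < 0 := by
  -- The test points are `X 0, X 0 + 1, X 1, X 1 + 1, …, X d`. The entries of `X` are roots, so the
  -- nonzero value occurs at some `X i + 1`, in an odd position, where the sign is negative.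
  let x : ℕ → ℕ := fun j => if h : j / 2 < d + 1 then X ⟨j / 2, h⟩ + j % 2 else 0
  have hxe : ∀ i (hi : i < d + 1), x (2 * i) = X ⟨i, hi⟩ := fun i hi => by
    simp [x, show i ≤ d by omega]
  have hxo : ∀ i (hi : i < d + 1), x (2 * i + 1) = X ⟨i, hi⟩ + 1 := fun i hi => by
    have h1 : (2 * i + 1) / 2 = i := by omega
    have h2 : (2 * i + 1) % 2 = 1 := by omega
    simp only [x, h1, hi, h2, dif_pos]
  obtain ⟨j, hj, hpos⟩ := exists_side_mul_pos ht hF x (fun j hj => by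
    rcases Nat.even_or_odd' j with ⟨k, rfl | rfl⟩
    · rw [hxe k (by omega), hxo k (by omega)]; omega
    · rw [show 2 * k + 1 + 1 = 2 * (k + 1) by ring, hxe (k + 1) (by omega), hxo k (by omega)]
      have := hX ⟨k, by omega⟩
      simp only [Fin.castSucc_mk, Fin.succ_mk] at this
      omega)
  rcases Nat.even_or_odd' j with ⟨k, rfl | rfl⟩
  · rw [hxe k (by omega), (side_eq_zero_iff ht).2 (hXF _)] at hpos
    simp at hpos
  · refine ⟨⟨k, by omega⟩, ?_⟩
    rw [hxo k (by omega), Odd.neg_one_pow ⟨d + k, by ring⟩] at hpos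
    simp only [Fin.castSucc_mk]
    linarith

/-- Before the first entry of a gapped tuple in `F`, or between entries, there are labels above the
hyperplane of `F`. -/
theorem exists_side_pos {t : ℕ → ℝ} (ht : StrictMono t) {F : Finset ℕ} (hF : F.card = 2 * d)
    {X : Fin (d + 1) → ℕ} (hX : Gapped X) (hXF : ∀ i, X i ∈ F) (h0 : 1 < X 0) :
    0 < side t F (X 0 - 1) ∨ ∃ i : Fin d, 0 < side t F (X i.castSucc + 1) := by
  -- Now the sequence starts one label earlier: `X 0 - 1, X 0, X 0 + 1, X 1, …`. The entries of `X`
  -- occupy the odd positions, and the even ones left over give a positive sign.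
  let x : ℕ → ℕ := fun j => if j = 0 then X 0 - 1 else
    if h : (j - 1) / 2 < d + 1 then X ⟨(j - 1) / 2, h⟩ + (j - 1) % 2 else 0
  have hx0 : x 0 = X 0 - 1 := by simp [x]
  have hxe : ∀ i (hi : i < d + 1), x (2 * i + 1) = X ⟨i, hi⟩ := fun i hi => by
    simp [x, show i ≤ d by omega]
  have hxo : ∀ i (hi : i < d + 1), x (2 * i + 2) = X ⟨i, hi⟩ + 1 := fun i hi => by
    have h1 : (2 * i + 2 - 1) / 2 = i := by omega
    have h2 : (2 * i + 2 - 1) % 2 = 1 := by omega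
    simp only [x, h1, hi, h2, dif_pos]
    simp
  obtain ⟨j, hj, hpos⟩ := exists_side_mul_pos ht hF x (fun j hj => by
    rcases Nat.eq_zero_or_pos j with rfl | hj0
    · rw [hx0, show 0 + 1 = 2 * 0 + 1 by rfl, hxe 0 (by omega)]
      simp only [Fin.mk_zero]; omega
    rcases Nat.even_or_odd' j with ⟨k, rfl | rfl⟩
    · obtain ⟨k, rfl⟩ : ∃ l, k = l + 1 := ⟨k - 1, by omega⟩
      rw [show 2 * (k + 1) = 2 * k + 2 by ring, hxo k (by omega),
        show 2 * k + 2 + 1 = 2 * (k + 1) + 1 by ring, hxe (k + 1) (by omega)]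
      have := hX ⟨k, by omega⟩
      simp only [Fin.castSucc_mk, Fin.succ_mk] at this
      omega
    · rw [show 2 * k + 1 + 1 = 2 * k + 2 by ring, hxe k (by omega), hxo k (by omega)]; omega)
  rcases Nat.even_or_odd' j with ⟨k, rfl | rfl⟩
  · rw [Even.neg_one_pow ⟨d + k, by ring⟩, one_mul] at hpos
    rcases Nat.eq_zero_or_pos k with rfl | hk
    · left; simpa [hx0] using hpos
    · obtain ⟨k, rfl⟩ : ∃ l, k = l + 1 := ⟨k - 1, by omega⟩
      rw [show 2 * (k + 1) = 2 * k + 2 by ring, hxo k (by omega)] at hpos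
      exact Or.inr ⟨⟨k, by omega⟩, by simpa using hpos⟩
  · rw [hxe k (by omega), (side_eq_zero_iff ht).2 (hXF _)] at hpos
    simp at hpos

end Combinatorics

/-! ### Covering the polytope by compatible simplices -/

section Covering

open Filter Topology

variable {d : ℕ} {t : ℕ → ℝ}

theorem sum_coord_mul_eval (ht : StrictMono t) (V σ : Finset ℕ) (μ : ℕ → ℝ) (p : Polynomial ℝ)
    (hp : p.natDegree < σ.card) :
    ∑ i ∈ σ, coord t V σ μ i * p.eval (t i) = ∑ x ∈ V, μ x * p.eval (t x) := by
  simp_rw [Polynomial.eval_eq_sum_range, Finset.mul_sum]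
  rw [Finset.sum_comm, Finset.sum_comm (s := V)]
  refine Finset.sum_congr rfl fun k hk => ?_
  rw [Finset.mem_range] at hk
  have h := sum_coord_mul_pow ht V σ μ k (by omega)
  calc _ = p.coeff k * ∑ i ∈ σ, coord t V σ μ i * t i ^ k := by
        rw [Finset.mul_sum]; exact Finset.sum_congr rfl fun x _ => by ring
    _ = _ := by rw [h, Finset.mul_sum]; exact Finset.sum_congr rfl fun x _ => by ring

/-- Positive weights on `s` avoiding finitely many linear conditions. -/
theorem exists_generic_weight {ι : Type*} (s : Finset ℕ) (J : Finset ι) (f : ι → ℕ → ℝ)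
    (hf : ∀ j ∈ J, ∃ i ∈ s, f j i ≠ 0) :
    ∃ l : ℕ → ℝ, (∀ i, 0 ≤ l i) ∧ (∀ i ∈ s, 0 < l i) ∧ (∀ i ∉ s, l i = 0) ∧
      ∀ j ∈ J, ∑ i ∈ s, l i * f j i ≠ 0 := by
  classical
  -- The weights are powers `ε ^ i`: each condition becomes a nonzero polynomial in `ε`, and some `ε
  -- > 0` avoids all the roots.
  let Q : ι → Polynomial ℝ := fun j => ∑ i ∈ s, Polynomial.C (f j i) * Polynomial.X ^ i
  have hQ : ∏ j ∈ J, Q j ≠ 0 := by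
    rw [Finset.prod_ne_zero_iff]
    intro j hj h0
    obtain ⟨i, hi, hne⟩ := hf j hj
    have := congrArg (fun p => Polynomial.coeff p i) h0
    simp [Q, Polynomial.finsetSum_coeff, Polynomial.coeff_X_pow, hi] at this
    exact hne this
  obtain ⟨ε, hε, hroot⟩ :=
    (Set.Ioi_infinite (0 : ℝ)).exists_notMem_finset (∏ j ∈ J, Q j).roots.toFinset
  have hε : 0 < ε := hε
  have hev : (∏ j ∈ J, Q j).eval ε ≠ 0 := by
    intro h
    exact hroot (by simp only [Multiset.mem_toFinset]; rw [Polynomial.mem_roots hQ]; exact h)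
  rw [Polynomial.eval_prod, Finset.prod_ne_zero_iff] at hev
  refine ⟨fun i => if i ∈ s then ε ^ i else 0, fun i => ?_, fun i hi => ?_, fun i hi => ?_,
    fun j hj h => hev j hj ?_⟩
  · simp only; split_ifs <;> positivity
  · simp only [hi, if_true]; positivity
  · simp [hi]
  · rw [← h]
    simp only [Q, Polynomial.eval_finsetSum]
    refine Finset.sum_congr rfl fun i hi => ?_
    simp only [hi, if_true, Polynomial.eval_mul, Polynomial.eval_C, Polynomial.eval_pow,
      Polynomial.eval_X]
    exact mul_comm _ _

theorem Gapped.add_le {C : Fin (d + 1) → ℕ} (h : Gapped C) (i : Fin (d + 1)) :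
    C 0 + 2 * i ≤ C i := by
  induction i using Fin.induction with
  | zero => simp
  | succ i ih => have := h i; simp at ih ⊢; omega

theorem Gapped.le_sub {C : Fin (d + 1) → ℕ} (h : Gapped C) (i : Fin (d + 1)) :
    C i + 2 * (d - i) ≤ C (Fin.last d) := by
  induction i using Fin.reverseInduction with
  | last => simp
  | cast i ih => have := h i; simp at ih ⊢; omega

/-- The ends of a gapped tuple differ by at least `2 d`, so `1, …, 2 d` contain none and are
vacuously compatible; extending them gives a first simplex. -/
theorem FacetExtension.exists_simplex {m : ℕ} (hm : 2 * d + 1 ≤ m) {R : Set (Fin (d + 1) → ℕ)}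
    (hP : FacetExtension t m R) :
    ∃ y ∈ Finset.Icc 1 m, y ∉ Finset.Icc 1 (2 * d) ∧ Compat R (insert y (Finset.Icc 1 (2 * d))) := by
  obtain ⟨y, hy, hs, hc⟩ := hP (Finset.Icc 1 (2 * d)) (Finset.Icc_subset_Icc_right (by omega))
    (by simp) (fun C hC hCF => by
      have h1 := hC.add_le (Fin.last d)
      have h2 := Finset.mem_Icc.1 (hCF 0)
      have h3 := Finset.mem_Icc.1 (hCF (Fin.last d))
      simp at h1
      omega) (2 * d + 1) (by simp; omega) (by simp)
  refine ⟨y, hy, fun h => ?_, hc⟩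
  have : side t (Finset.Icc 1 (2 * d)) y = 0 := Finset.prod_eq_zero h (sub_self _)
  simp [this] at hs

/-- The compatible simplices cover the cyclic polytope: every weighted sum of its vertices is a
nonnegative combination of the vertices of such a simplex. -/
def Covers (t : ℕ → ℝ) (m : ℕ) (R : Set (Fin (d + 1) → ℕ)) : Prop :=
  ∀ μ : ℕ → ℝ, (∀ i, 0 ≤ μ i) → ∃ σ ⊆ Finset.Icc 1 m, σ.card = 2 * d + 1 ∧ Compat R σ ∧
    ∀ i ∈ σ, 0 ≤ coord t (Finset.Icc 1 m) σ μ i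

/-- Every weighted sum of vertices of the cyclic polytope is a nonnegative combination of vertices
with labels in a compatible set. -/
def WeaklyCovers (t : ℕ → ℝ) (m : ℕ) (R : Set (Fin (d + 1) → ℕ)) : Prop :=
  ∀ μ : ℕ → ℝ, (∀ i, 0 ≤ μ i) → ∃ σ ⊆ Finset.Icc 1 m, σ.card = 2 * d + 1 ∧
    (∀ i ∈ σ, 0 ≤ coord t (Finset.Icc 1 m) σ μ i) ∧
    Compat R (σ.filter fun i => coord t (Finset.Icc 1 m) σ μ i ≠ 0)

theorem Covers.weaklyCovers {m : ℕ} {R : Set (Fin (d + 1) → ℕ)} (h : Covers t m R) :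
    WeaklyCovers t m R := fun μ hμ => by
  obtain ⟨σ, h1, h2, h3, h4⟩ := h μ hμ
  exact ⟨σ, h1, h2, h4, h3.mono (Finset.filter_subset _ _)⟩

/-- When `G` has two vertices fewer than a simplex, this is a hyperplane through the points of `G`
and the point of `μ`. A segment to `μ` that starts off all these hyperplanes misses the faces of
codimension two, except possibly at its end. -/
theorem exists_linear_annihilator (V G : Finset ℕ) (μ : ℕ → ℝ) :
    ∃ a b : ℝ, (a ≠ 0 ∨ b ≠ 0) ∧ ∑ x ∈ V, μ x * (side t G x * (a + b * t x)) = 0 := by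
  by_cases h : ∑ x ∈ V, μ x * side t G x = 0
  · exact ⟨1, 0, Or.inl one_ne_zero, by simpa using h⟩
  · refine ⟨-∑ x ∈ V, μ x * side t G x * t x, ∑ x ∈ V, μ x * side t G x, Or.inr h, ?_⟩
    calc _ = (-∑ x ∈ V, μ x * side t G x * t x) * ∑ x ∈ V, μ x * side t G x +
          (∑ x ∈ V, μ x * side t G x) * ∑ x ∈ V, μ x * side t G x * t x := by
          rw [Finset.mul_sum, Finset.mul_sum, ← Finset.sum_add_distrib]
          rw [Finset.sum_congr rfl]
          intro x _
          ring_nf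
      _ = 0 := by ring

/-- A segment leaves a union of simplices that extends over its facets only at its end. -/
theorem FacetExtension.covers (ht : StrictMono t) {m : ℕ} (hm : 2 * d + 1 ≤ m)
    {R : Set (Fin (d + 1) → ℕ)} (hP : FacetExtension t m R) : Covers t m R := by
  classical
  intro μ hμ
  set V := Finset.Icc 1 m with hV
  obtain ⟨y0, hy0, hy0F, hy0c⟩ := hP.exists_simplex hm
  set σ0 := insert y0 (Finset.Icc 1 (2 * d)) with hσ0
  have hσ0card : σ0.card = 2 * d + 1 := by
    rw [hσ0, Finset.card_insert_of_notMem hy0F]; simp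
  have hσ0V : σ0 ⊆ V := Finset.insert_subset hy0 (Finset.Icc_subset_Icc_right (by omega))
  choose a b hab hann using fun G : Finset ℕ => exists_linear_annihilator (t := t) V G μ
  -- The starting point `l` is interior to `σ0` and off the hyperplane chosen for each `G`. This is
  -- possible since `σ0` has at least two labels outside `G`, and `a G + b G * t x` vanishes at no
  -- more than one of them.
  obtain ⟨l, hl0, hlpos, hlsupp, hlgen⟩ := exists_generic_weight σ0
    (V.powerset.filter fun G => G.card + 2 = 2 * d + 1)
    (fun G x => side t G x * (a G + b G * t x)) (by
      intro G hG
      rw [Finset.mem_filter] at hG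
      have h1 : 1 < (σ0 \ G).card := by
        have := Finset.le_card_sdiff G σ0
        omega
      obtain ⟨i, hi, j, hj, hij⟩ := Finset.one_lt_card.1 h1
      rw [Finset.mem_sdiff] at hi hj
      by_contra! h
      have hi' := (mul_eq_zero.1 (h i hi.1)).resolve_left
        (fun h => hi.2 ((side_eq_zero_iff ht).1 h))
      have hj' := (mul_eq_zero.1 (h j hj.1)).resolve_left
        (fun h => hj.2 ((side_eq_zero_iff ht).1 h))
      have hb : b G * (t i - t j) = 0 := by linarith
      have hb' := (mul_eq_zero.1 hb).resolve_right (sub_ne_zero.2 (ht.injective.ne hij))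
      rw [hb'] at hi'
      rcases hab G with h | h
      · apply h; linarith
      · exact h hb')
  have hlV : ∀ f : ℕ → ℝ, ∑ x ∈ V, l x * f x = ∑ x ∈ σ0, l x * f x := fun f =>
    (Finset.sum_subset hσ0V fun x _ hx => by rw [hlsupp x hx, zero_mul]).symm
  set Sg : Finset (Finset ℕ) :=
    V.powerset.filter fun σ => σ.card = 2 * d + 1 ∧ Compat R σ with hSg
  have hmemSg : ∀ σ, σ ∈ Sg ↔ σ ⊆ V ∧ σ.card = 2 * d + 1 ∧ Compat R σ := fun σ => by
    simp [hSg, Finset.mem_filter, Finset.mem_powerset]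
  -- The times at which the segment from `l` to `μ` is in some compatible simplex. `K` is closed and
  -- contains `0`; its last time in `[0, 1]` will be shown to be `1`.
  let K : Set ℝ := ⋃ σ ∈ Sg, {s : ℝ | ∀ i ∈ σ,
    0 ≤ (1 - s) * coord t V σ l i + s * coord t V σ μ i}
  have hKclosed : IsClosed K := by
    refine Set.Finite.isClosed_biUnion Sg.finite_toSet fun σ _ => ?_
    simp only [Set.ofPred_forall]
    refine isClosed_iInter fun i => isClosed_iInter fun _ => ?_
    exact isClosed_le continuous_const (by fun_prop)
  have hcoordl : ∀ i ∈ σ0, coord t V σ0 l i = l i := fun i hi =>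
    coord_eq_of_moments ht hσ0V hlsupp (fun _ _ => rfl) hi
  have h0K : (0 : ℝ) ∈ K ∩ Set.Icc 0 1 := by
    refine ⟨Set.mem_biUnion (x := σ0) ((hmemSg σ0).2 ⟨hσ0V, hσ0card, hy0c⟩) ?_, by simp⟩
    intro i hi
    simp [hcoordl i hi, hl0 i]
  obtain ⟨s, ⟨hsK, hs01⟩, hsmax⟩ :=
    (isCompact_Icc.inter_left hKclosed).exists_isGreatest ⟨0, h0K⟩
  simp only [K, Set.mem_iUnion, Set.mem_ofPred_eq] at hsK
  obtain ⟨σ, hσ, hsσ⟩ := hsK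
  obtain ⟨hσV, hσcard, hσc⟩ := (hmemSg σ).1 hσ
  rcases hs01.2.eq_or_lt with rfl | hs1
  · exact ⟨σ, hσV, hσcard, hσc, fun i hi => by simpa using hsσ i hi⟩
  exfalso
  set ν : ℕ → ℝ := fun x => (1 - s) * l x + s * μ x with hν
  have hcν : ∀ τ i, coord t V τ ν i = (1 - s) * coord t V τ l i + s * coord t V τ μ i :=
    fun τ i => coord_add_smul V τ l μ _ _ i
  have hw : ∀ i ∈ σ, 0 ≤ coord t V σ ν i := fun i hi => by rw [hcν]; exact hsσ i hi
  -- Two vanishing coordinates would put `ν` on the hyperplane of `G`, which also contains the point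
  -- of `μ`; as `s < 1`, it would then contain `l`.
  have huniq : ∀ i ∈ σ, ∀ j ∈ σ, coord t V σ ν i = 0 → coord t V σ ν j = 0 → i = j := by
    intro i hi j hj hwi hwj
    by_contra hij
    set G := (σ.erase i).erase j with hG
    have hjG : j ∈ σ.erase i := Finset.mem_erase.2 ⟨Ne.symm hij, hj⟩
    have hGcard : G.card + 2 = 2 * d + 1 := by
      have h1 : G.card + 1 = (σ.erase i).card := Finset.card_erase_add_one hjG
      have h2 := Finset.card_erase_add_one hi
      omega
    have hGV : G ⊆ V := ((Finset.erase_subset _ _).trans (Finset.erase_subset _ _)).trans hσV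
    have h1 := sum_coord_mul_eval ht V σ ν
      (sidePoly t G * (Polynomial.C (a G) + Polynomial.C (b G) * Polynomial.X)) (by
        refine Polynomial.natDegree_mul_le.trans_lt ?_
        rw [natDegree_sidePoly]
        have : (Polynomial.C (a G) + Polynomial.C (b G) * Polynomial.X).natDegree ≤ 1 := by
          compute_degree
        omega)
    simp only [Polynomial.eval_mul, eval_sidePoly (t := t), Polynomial.eval_add, Polynomial.eval_C,
      Polynomial.eval_X] at h1
    rw [Finset.sum_eq_zero] at h1
    · have h2 : ∑ x ∈ V, ν x * (side t G x * (a G + b G * t x)) =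
          (1 - s) * ∑ x ∈ σ0, l x * (side t G x * (a G + b G * t x)) +
            s * ∑ x ∈ V, μ x * (side t G x * (a G + b G * t x)) := by
        rw [← hlV, Finset.mul_sum, Finset.mul_sum, ← Finset.sum_add_distrib]
        exact Finset.sum_congr rfl fun x _ => by simp only [hν]; ring
      rw [← h1, hann, mul_zero, add_zero] at h2
      rcases mul_eq_zero.1 h2.symm with h3 | h3
      · linarith
      · exact hlgen G (Finset.mem_filter.2 ⟨Finset.mem_powerset.2 hGV, hGcard⟩) h3
    · intro x hx
      by_cases hxi : x = i
      · rw [hxi, hwi, zero_mul]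
      by_cases hxj : x = j
      · rw [hxj, hwj, zero_mul]
      · rw [(side_eq_zero_iff ht).2 (by simp [hG, hxi, hxj, hx]), zero_mul, mul_zero]
  -- A simplex into which the segment continues: `σ` itself if `ν` is interior to it or if `μ` is
  -- weakly on the inner side of the one facet `F` through `ν`; otherwise the neighbour across `F`.
  obtain ⟨τ, hτ, hτpos⟩ : ∃ τ ∈ Sg, ∀ i ∈ τ, 0 < coord t V τ ν i ∨
      (0 ≤ coord t V τ ν i ∧ 0 ≤ coord t V τ μ i) := by
    by_cases hall : ∀ i ∈ σ, coord t V σ ν i ≠ 0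
    · exact ⟨σ, hσ, fun i hi => Or.inl (lt_of_le_of_ne (hw i hi) (hall i hi).symm)⟩
    push Not at hall
    obtain ⟨e, heσ, he0⟩ := hall
    set F := σ.erase e with hF
    have heF : e ∉ F := by simp [hF]
    have hFcard : F.card = 2 * d := by
      have : F.card + 1 = σ.card := Finset.card_erase_add_one heσ
      omega
    have hFV : F ⊆ V := (Finset.erase_subset _ _).trans hσV
    have hFe : insert e F = σ := Finset.insert_erase heσ
    obtain ⟨y, hyV, hyF, hyc, hysign⟩ : ∃ y ∈ V, y ∉ F ∧ Compat R (insert y F) ∧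
        0 ≤ (∑ x ∈ V, μ x * side t F x) / side t F y := by
      by_cases hM : 0 ≤ (∑ x ∈ V, μ x * side t F x) / side t F e
      · exact ⟨e, hσV heσ, heF, by rwa [hFe], hM⟩
      set M := ∑ x ∈ V, μ x * side t F x with hMdef
      have hM0 : M ≠ 0 := fun h => hM (by simp [h])
      have hMM : 0 < M * M := mul_self_pos.2 hM0
      have hMs : ∑ x ∈ V, (0 : ℝ) < ∑ x ∈ V, M * (μ x * side t F x) := by
        rw [← Finset.mul_sum, Finset.sum_const_zero]; exact hMM
      obtain ⟨x, hxV, hx⟩ := Finset.exists_lt_of_sum_lt hMs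
      have hxs : 0 < M * side t F x := by
        have : 0 < μ x * (M * side t F x) := by linarith
        exact pos_of_mul_pos_right this (hμ x)
      have hxF : x ∉ F := fun h => by simp [(side_eq_zero_iff ht).2 h] at hxs
      obtain ⟨y, hyV, hy, hyc⟩ := hP F hFV hFcard (hσc.mono (Finset.erase_subset _ _)) x hxV hxF
      have hyF : y ∉ F := fun h => by simp [(side_eq_zero_iff ht).2 h] at hy
      refine ⟨y, hyV, hyF, hyc, ?_⟩
      have h1 : 0 < (M / side t F y) * (side t F x * side t F y) ^ 2 := by
        have h2 : side t F y ≠ 0 := fun h => by simp [h] at hy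
        calc (0 : ℝ) < (M * side t F x) * (side t F x * side t F y) := mul_pos hxs hy
          _ = _ := by field_simp
      exact (pos_of_mul_pos_left h1 (sq_nonneg _)).le
    refine ⟨insert y F, (hmemSg _).2 ⟨Finset.insert_subset hyV hFV,
      by rw [Finset.card_insert_of_notMem hyF, hFcard], hyc⟩, ?_⟩
    have hv : ∀ i ∈ insert y F, coord t V (insert y F) ν i =
        if i ∈ F then coord t V σ ν i else 0 := by
      intro i hi
      refine coord_eq_of_moments ht (v := fun i => if i ∈ F then coord t V σ ν i else 0)
        (Finset.insert_subset hyV hFV) (fun i hi => ?_) (fun k hk => ?_) hi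
      · rw [if_neg fun h => hi (Finset.mem_insert_of_mem h)]
      · rw [Finset.card_insert_of_notMem hyF] at hk
        rw [← sum_coord_mul_pow ht V σ ν k (by omega), ← hFe, Finset.sum_insert heF, hFe, he0,
          zero_mul, zero_add]
        simp only [ite_mul, zero_mul]
        rw [Finset.sum_ite_mem, Finset.inter_eq_right.2 hFV]
    intro i hi
    rw [hv i hi]
    rcases Finset.mem_insert.1 hi with rfl | hiF
    · rw [if_neg hyF, coord_insert V F hyF]
      exact Or.inr ⟨le_rfl, hysign⟩
    · rw [if_pos hiF]
      have hiσ : i ∈ σ := Finset.mem_of_mem_erase hiF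
      refine Or.inl (lt_of_le_of_ne (hw i hiσ) fun h => ?_)
      exact heF (huniq i hiσ e heσ h.symm he0 ▸ hiF)
  have hev : ∀ᶠ η in 𝓝[>] (0 : ℝ), ∀ i ∈ τ,
      0 ≤ (1 - η) * coord t V τ ν i + η * coord t V τ μ i := by
    rw [eventually_all_finset]
    intro i hi
    rcases hτpos i hi with h | h
    · have hc : Tendsto (fun η : ℝ => (1 - η) * coord t V τ ν i + η * coord t V τ μ i) (𝓝 0)
          (𝓝 ((1 - 0) * coord t V τ ν i + 0 * coord t V τ μ i)) :=
        Continuous.tendsto (by fun_prop) 0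
      have := (hc.mono_left (nhdsWithin_le_nhds (s := Set.Ioi 0))).eventually (lt_mem_nhds (a := 0) (by simpa using h))
      exact this.mono fun _ h => h.le
    · filter_upwards [Ioo_mem_nhdsGT (show (0 : ℝ) < 1 by norm_num)] with η hη
      exact add_nonneg (mul_nonneg (by linarith [hη.2]) h.1) (mul_nonneg hη.1.le h.2)
  obtain ⟨η, hη1, hη2⟩ := (hev.and (Ioo_mem_nhdsGT (show (0 : ℝ) < 1 by norm_num))).exists
  have hmem : s + η * (1 - s) ∈ K ∩ Set.Icc 0 1 := by
    refine ⟨Set.mem_biUnion (x := τ) hτ fun i hi => ?_, ?_, ?_⟩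
    · calc (0 : ℝ) ≤ _ := hη1 i hi
        _ = _ := by rw [hcν]; ring
    · have := hs01.1
      have := mul_pos hη2.1 (sub_pos.2 hs1)
      linarith
    · nlinarith [hη2.2]
  have := hsmax hmem
  have := mul_pos hη2.1 (sub_pos.2 hs1)
  linarith

/-- Move the barycentre of `F` slightly towards `x`. The simplex covering the perturbed point also
represents the barycentre, so by uniqueness it contains `F`. The coordinate at its remaining vertex
`y` is `ε * side t F x / side t F y`, and its positivity puts `y` on the side of `x`. -/
theorem WeaklyCovers.facetExtension (ht : StrictMono t) {m : ℕ} {R : Set (Fin (d + 1) → ℕ)}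
    (hR : NonIntertwining R) (h : WeaklyCovers t m R) : FacetExtension t m R := by
  classical
  intro F hFV hFcard hFc x hxV hxF
  set V := Finset.Icc 1 m with hV
  set u : ℕ → ℝ := fun i => if i ∈ F then 1 else 0 with hu
  set w : ℕ → ℝ := fun i => if i = x then 1 else 0 with hw
  have hu0 : ∀ i, 0 ≤ u i := fun i => by simp only [hu]; split_ifs <;> simp
  have hsx : side t F x ≠ 0 := fun h => hxF ((side_eq_zero_iff ht).1 h)
  -- For small `ε`, simultaneously for all `σ`, a nonnegative or zero perturbed coordinate comes
  -- from a nonnegative or zero original one.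
  have hev : ∀ᶠ ε in 𝓝[>] (0 : ℝ), ∀ σ ∈ V.powerset, ∀ i ∈ σ,
      (0 ≤ coord t V σ u i + ε * coord t V σ w i → 0 ≤ coord t V σ u i) ∧
      (coord t V σ u i + ε * coord t V σ w i = 0 → coord t V σ u i = 0) := by
    rw [eventually_all_finset]
    intro σ _
    rw [eventually_all_finset]
    intro i _
    have hc : Tendsto (fun ε : ℝ => coord t V σ u i + ε * coord t V σ w i) (𝓝[>] 0)
        (𝓝 (coord t V σ u i)) := by
      have : Tendsto (fun ε : ℝ => coord t V σ u i + ε * coord t V σ w i) (𝓝 0)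
        (𝓝 (coord t V σ u i + 0 * coord t V σ w i)) := Continuous.tendsto (by fun_prop) 0
      rw [zero_mul, add_zero] at this
      exact this.mono_left nhdsWithin_le_nhds
    rcases lt_trichotomy (coord t V σ u i) 0 with h | h | h
    · filter_upwards [hc.eventually (gt_mem_nhds h)] with ε hε
      exact ⟨fun h => by linarith, fun h => by linarith⟩
    · exact Eventually.of_forall fun ε => ⟨fun _ => h.ge, fun _ => h⟩
    · filter_upwards [hc.eventually (lt_mem_nhds h)] with ε hε
      exact ⟨fun _ => h.le, fun h => by linarith⟩
  obtain ⟨ε, hε1, hε⟩ := (hev.and self_mem_nhdsWithin).exists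
  have hε : 0 < ε := hε
  obtain ⟨σ, hσV, hσcard, hσpos, hσc⟩ := h (fun i => 1 * u i + ε * w i) (fun i => by
    simp only [hu, hw]; split_ifs <;> simp <;> linarith)
  have hco : ∀ i, coord t V σ (fun i => 1 * u i + ε * w i) i =
      coord t V σ u i + ε * coord t V σ w i := fun i => by rw [coord_add_smul, one_mul]
  have hε2 := hε1 σ (Finset.mem_powerset.2 hσV)
  simp only [← hV, hco] at hσV hσpos hσc
  have hFu := eq_of_compat_supports ht hR V F _ hFc hσc (u := u)
    (v := fun i => if i ∈ σ then coord t V σ u i else 0)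
    hu0
    (fun i => by
      split_ifs with hi
      · exact (hε2 i hi).1 (hσpos i hi)
      · exact le_rfl)
    (fun i hi => by simp [hu, hi])
    (fun i hi => by
      split_ifs with hiσ
      · refine (hε2 i hiσ).2 ?_
        by_contra hne
        exact hi (Finset.mem_filter.2 ⟨hiσ, hne⟩)
      · rfl)
    (fun k hk => by
      simp only [ite_mul, zero_mul]
      rw [Finset.sum_ite_mem, Finset.inter_eq_right.2 hσV, sum_coord_mul_pow ht V σ u k (by omega)])
  have hFσ' : ∀ f ∈ F, f ∈ σ ∧ coord t V σ u f = 1 := fun f hf => by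
    have := hFu f (hFV hf)
    simp only [hu, hf, if_true] at this
    split_ifs at this with h1
    · exact ⟨h1, this.symm⟩
    · simp at this
  have hFσ : F ⊆ σ := fun f hf => (hFσ' f hf).1
  obtain ⟨y, hy⟩ : ∃ y, σ \ F = {y} := by
    rw [← Finset.card_eq_one, Finset.card_sdiff_of_subset hFσ]
    omega
  have hyσ : y ∈ σ \ F := by simp [hy]
  rw [Finset.mem_sdiff] at hyσ
  have hσ : σ = insert y F := by
    rw [Finset.insert_eq, ← hy, Finset.sdiff_union_of_subset hFσ]
  have hcy : coord t V σ u y + ε * coord t V σ w y = ε * side t F x / side t F y := by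
    rw [← hco, hσ, coord_insert V F hyσ.2]
    congr 1
    rw [Finset.sum_eq_single x]
    · simp [hu, hw, hxF]
    · intro z _ hzx
      by_cases hz : z ∈ F
      · simp [(side_eq_zero_iff ht).2 hz]
      · simp [hu, hw, hz, hzx]
    · exact fun h => absurd hxV h
  have hsy : side t F y ≠ 0 := fun h => hyσ.2 ((side_eq_zero_iff ht).1 h)
  have hpos : 0 < ε * side t F x / side t F y := by
    refine lt_of_le_of_ne (hcy ▸ hσpos y hyσ.1) (Ne.symm ?_)
    exact div_ne_zero (mul_ne_zero hε.ne' hsx) hsy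
  refine ⟨y, hσV hyσ.1, ?_, hσc.mono fun i hi => ?_⟩
  · have h1 : 0 < ε * (side t F x * side t F y) := by
      calc (0 : ℝ) < ε * side t F x / side t F y * (side t F y) ^ 2 :=
            mul_pos hpos (by positivity)
        _ = _ := by field_simp
    exact pos_of_mul_pos_right h1 hε.le
  · rcases Finset.mem_insert.1 hi with rfl | hiF
    · exact Finset.mem_filter.2 ⟨hyσ.1, by rw [hcy]; exact hpos.ne'⟩
    · refine Finset.mem_filter.2 ⟨hFσ hiF, fun h => ?_⟩
      have h1 := (hε2 i (hFσ hiF)).2 h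
      rw [(hFσ' i hiF).2] at h1
      exact one_ne_zero h1

/-- Compatible sets of labels are faces of compatible simplices. -/
theorem Covers.exists_superset (ht : StrictMono t) {m : ℕ} {R : Set (Fin (d + 1) → ℕ)}
    (h : Covers t m R) {R' : Set (Fin (d + 1) → ℕ)} (hRR' : R ⊆ R')
    (hR' : NonIntertwining R') {F : Finset ℕ}
    (hFV : F ⊆ Finset.Icc 1 m) (hF : Compat R' F) :
    ∃ σ ⊆ Finset.Icc 1 m, σ.card = 2 * d + 1 ∧ Compat R σ ∧ F ⊆ σ := by
  classical
  set V := Finset.Icc 1 m with hV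
  set u : ℕ → ℝ := fun i => if i ∈ F then 1 else 0 with hu
  have hu0 : ∀ i, 0 ≤ u i := fun i => by simp only [hu]; split_ifs <;> simp
  obtain ⟨σ, hσV, hσcard, hσc, hσ⟩ := h u hu0
  refine ⟨σ, hσV, hσcard, hσc, fun f hf => ?_⟩
  have := eq_of_compat_supports ht hR' V F σ hF (fun C h1 h2 => hRR' (hσc C h1 h2)) (u := u)
    (v := fun i => if i ∈ σ then coord t V σ u i else 0) hu0
    (fun i => by
      split_ifs with hi
      · exact hσ i hi
      · exact le_rfl)
    (fun i hi => by simp [hu, hi]) (fun i hi => by simp [hi])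
    (fun k hk => by
      simp only [ite_mul, zero_mul]
      rw [Finset.sum_ite_mem, Finset.inter_eq_right.2 hσV, sum_coord_mul_pow ht V σ u k (by omega)])
    f (hFV hf)
  by_contra hfσ
  simp [hu, hf, hfσ] at this

end Covering

/-! ### Contraction and link of the last label, and the size bound -/

section Contraction

variable {d : ℕ}

/-- The tuple `A` followed by the entry `x`. -/
def extend (A : Fin (d + 1) → ℕ) (x : ℕ) : Fin (d + 1 + 1) → ℕ := Fin.snoc (α := fun _ => ℕ) A x

@[simp] theorem extend_castSucc (A : Fin (d + 1) → ℕ) (x : ℕ) (i : Fin (d + 1)) :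
    extend A x i.castSucc = A i := by simp [extend]

@[simp] theorem extend_last (A : Fin (d + 1) → ℕ) (x : ℕ) :
    extend A x (Fin.last (d + 1)) = x := by simp [extend]

theorem exists_eq_extend (C : Fin (d + 1 + 1) → ℕ) :
    ∃ A, C = extend A (C (Fin.last (d + 1))) :=
  ⟨fun i => C i.castSucc, (Fin.snoc_init_self C).symm⟩

theorem extend_left_injective (x : ℕ) :
    Function.Injective fun A : Fin (d + 1) → ℕ => extend A x := fun A B h => by
  ext i
  have := congrFun h i.castSucc
  simpa using this

theorem forall_extend {A : Fin (d + 1) → ℕ} {x : ℕ} {p : ℕ → Prop} :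
    (∀ i, p (extend A x i)) ↔ (∀ i, p (A i)) ∧ p x := by
  rw [Fin.forall_fin_succ']
  simp

theorem gapped_extend {A : Fin (d + 1) → ℕ} {x : ℕ} :
    Gapped (extend A x) ↔ Gapped A ∧ A (Fin.last d) + 2 ≤ x := by
  rw [Gapped, Fin.forall_fin_succ']
  simp only [Fin.succ_last, extend_castSucc, extend_last, Fin.succ_castSucc, Gapped]

theorem intertwines_extend {A B : Fin (d + 1) → ℕ} {x y : ℕ} :
    Intertwines (extend A x) (extend B y) ↔ Intertwines A B ∧ B (Fin.last d) < x ∧ x < y := by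
  rw [Intertwines, Fin.forall_fin_succ' (P := fun i => extend A x i < extend B y i),
    Fin.forall_fin_succ' (P := fun i : Fin (d + 1) => extend B y i.castSucc < extend A x i.succ)]
  simp only [Fin.succ_last, extend_castSucc, extend_last, Fin.succ_castSucc, Intertwines]
  tauto

theorem Gapped.le_last {A : Fin (d + 1) → ℕ} (hA : Gapped A) (i : Fin (d + 1)) :
    A i ≤ A (Fin.last d) :=
  hA.strictMono.monotone (Fin.le_last i)

theorem finite_separatedTuples (d m : ℕ) : (separatedTuples d m).Finite :=
  (Set.finite_Icc (fun _ => 1) (fun _ => m)).subset fun A hA => by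
    simp only [separatedTuples, Set.mem_ofPred_eq, Set.mem_Icc] at hA
    exact ⟨fun i => (hA.1 i).1, fun i => (hA.1 i).2⟩

theorem extend_mem_separatedTuples {A : Fin (d + 1) → ℕ} {x m : ℕ} :
    extend A x ∈ separatedTuples (d + 1) m ↔
      A ∈ separatedTuples d m ∧ A (Fin.last d) + 2 ≤ x ∧ x ≤ m := by
  rw [mem_separatedTuples, forall_extend (p := fun y => y ∈ Finset.Icc 1 m), gapped_extend,
    mem_separatedTuples, Finset.mem_Icc]
  constructor
  · tauto
  · rintro ⟨⟨h1, h2⟩, h3, h4⟩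
    exact ⟨⟨h1, by omega, h4⟩, h2, h3⟩

theorem mem_separatedTuples_of_last_le {A : Fin (d + 1) → ℕ} {m n : ℕ}
    (hA : A ∈ separatedTuples d m) (h : A (Fin.last d) ≤ n) : A ∈ separatedTuples d n := by
  rw [mem_separatedTuples] at hA ⊢
  refine ⟨fun i => ?_, hA.2⟩
  have h1 := Finset.mem_Icc.1 (hA.1 i)
  exact Finset.mem_Icc.2 ⟨h1.1, (hA.2.le_last i).trans h⟩

/-- The tuples obtained by replacing the entry `n + 2` by `n + 1`. -/
def contr (n : ℕ) (R : Set (Fin (d + 1 + 1) → ℕ)) : Set (Fin (d + 1 + 1) → ℕ) :=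
  {C | C ∈ separatedTuples (d + 1) (n + 1) ∧
    (C ∈ R ∨ ∃ A, C = extend A (n + 1) ∧ extend A (n + 2) ∈ R)}

/-- The tuples whose extensions by `n + 1` (where separated) and by `n + 2` belong to `R`. -/
def lnk (n : ℕ) (R : Set (Fin (d + 1 + 1) → ℕ)) : Set (Fin (d + 1) → ℕ) :=
  {A | extend A (n + 2) ∈ R ∧ (A (Fin.last d) = n ∨ extend A (n + 1) ∈ R)}

theorem contr_subset (n : ℕ) (R : Set (Fin (d + 1 + 1) → ℕ)) :
    contr n R ⊆ separatedTuples (d + 1) (n + 1) := fun _ h => h.1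

theorem lnk_subset {n : ℕ} {R : Set (Fin (d + 1 + 1) → ℕ)}
    (hR : R ⊆ separatedTuples (d + 1) (n + 2)) : lnk n R ⊆ separatedTuples d n := fun A h => by
  have h1 := extend_mem_separatedTuples.1 (hR h.1)
  exact mem_separatedTuples_of_last_le h1.1 (by omega)

theorem mem_contr_of_last_le {n : ℕ} {R : Set (Fin (d + 1 + 1) → ℕ)}
    (hR : R ⊆ separatedTuples (d + 1) (n + 2)) {C : Fin (d + 1 + 1) → ℕ} (hC : C ∈ R)
    (h : C (Fin.last (d + 1)) ≤ n + 1) : C ∈ contr n R :=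
  ⟨mem_separatedTuples_of_last_le (hR hC) h, Or.inl hC⟩

theorem mem_of_mem_contr {n : ℕ} {R : Set (Fin (d + 1 + 1) → ℕ)} {C : Fin (d + 1 + 1) → ℕ}
    (hC : C ∈ contr n R) (h : C (Fin.last (d + 1)) ≠ n + 1) : C ∈ R := by
  rcases hC.2 with h1 | ⟨A, rfl, -⟩
  · exact h1
  · simp at h

theorem extend_mem_of_mem_contr {n : ℕ} {R : Set (Fin (d + 1 + 1) → ℕ)} {A : Fin (d + 1) → ℕ}
    (hC : extend A (n + 1) ∈ contr n R) : extend A (n + 1) ∈ R ∨ extend A (n + 2) ∈ R := by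
  rcases hC.2 with h1 | ⟨B, h1, h2⟩
  · exact Or.inl h1
  · rw [extend_left_injective _ h1]; exact Or.inr h2

/-- In an intertwining pair `X`, `Y` the last entry of `X` is below `n + 1`, so only `Y` can come
from a tuple ending in `n + 2`, and restoring that entry keeps the pair intertwining. -/
theorem contr_nonIntertwining {n : ℕ} {R : Set (Fin (d + 1 + 1) → ℕ)} (hR : NonIntertwining R) :
    NonIntertwining (contr n R) := by
  intro X hX Y hY h
  have h1 := h.1 (Fin.last (d + 1))
  have h2 := (Finset.mem_Icc.1 ((mem_separatedTuples.1 hY.1).1 (Fin.last (d + 1)))).2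
  have hXR := mem_of_mem_contr hX (by omega)
  rcases hY.2 with hYR | ⟨B, rfl, hB⟩
  · exact hR X hXR Y hYR h
  · refine hR X hXR _ hB ?_
    obtain ⟨A, hA⟩ := exists_eq_extend X
    rw [hA, intertwines_extend] at h ⊢
    exact ⟨h.1, h.2.1, by omega⟩

/-- If `A` intertwines `B`, the last entry of `A` is below `n`. Then `A` extended by `n + 1` and `B`
extended by `n + 2` are intertwining elements of `R`. -/
theorem lnk_nonIntertwining {n : ℕ} {R : Set (Fin (d + 1 + 1) → ℕ)}
    (hRs : R ⊆ separatedTuples (d + 1) (n + 2)) (hR : NonIntertwining R) :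
    NonIntertwining (lnk n R) := by
  intro A hA B hB h
  have h1 := h.1 (Fin.last d)
  have h2 := (Finset.mem_Icc.1 ((mem_separatedTuples.1 (lnk_subset hRs hB)).1 (Fin.last d))).2
  rcases hA.2 with h3 | h3
  · omega
  · exact hR _ h3 _ hB.1 (intertwines_extend.2 ⟨h, by omega, by omega⟩)

/-- Let `T` be the tuples whose extension by `n + 2` is in `R`. The contraction loses those of `T`
ending in `n`, whose extension by `n + 1` is not gapped, and merges two elements of `R` for each
tuple of `T` that extends both ways. These two kinds make up `lnk n R`. -/
theorem ncard_eq_contr_add_lnk {n : ℕ} {R : Set (Fin (d + 1 + 1) → ℕ)}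
    (hR : R ⊆ separatedTuples (d + 1) (n + 2)) :
    R.ncard = (contr n R).ncard + (lnk n R).ncard := by
  have hRf : R.Finite := (finite_separatedTuples _ _).subset hR
  set T : Set (Fin (d + 1) → ℕ) := {A | extend A (n + 2) ∈ R} with hT
  set R1 : Set (Fin (d + 1 + 1) → ℕ) := {C ∈ R | C (Fin.last (d + 1)) ≤ n + 1} with hR1
  set X : Set (Fin (d + 1) → ℕ) := {A ∈ T | A (Fin.last d) < n} with hX
  have hTsep : ∀ A ∈ T, A ∈ separatedTuples d n := fun A hA => by
    have h1 := extend_mem_separatedTuples.1 (hR hA)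
    exact mem_separatedTuples_of_last_le h1.1 (by omega)
  have hTlast : ∀ A ∈ T, A (Fin.last d) ≤ n := fun A hA =>
    (Finset.mem_Icc.1 ((mem_separatedTuples.1 (hTsep A hA)).1 _)).2
  have hTf : T.Finite := (finite_separatedTuples d n).subset hTsep
  have hR1f : R1.Finite := hRf.subset fun C hC => hC.1
  have hXf : X.Finite := hTf.subset fun C hC => hC.1
  have e1 : R = R1 ∪ (fun A => extend A (n + 2)) '' T := by
    ext C
    constructor
    · intro hC
      by_cases h : C (Fin.last (d + 1)) ≤ n + 1
      · exact Or.inl ⟨hC, h⟩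
      · have h1 := (Finset.mem_Icc.1 ((mem_separatedTuples.1 (hR hC)).1 (Fin.last (d + 1)))).2
        obtain ⟨A, hA⟩ := exists_eq_extend C
        rw [show C (Fin.last (d + 1)) = n + 2 by omega] at hA
        exact Or.inr ⟨A, by rw [hT, Set.mem_ofPred_eq, ← hA]; exact hC, hA.symm⟩
    · rintro (h | ⟨A, hA, rfl⟩)
      · exact h.1
      · exact hA
  have d1 : Disjoint R1 ((fun A => extend A (n + 2)) '' T) := by
    rw [Set.disjoint_left]
    rintro C hC ⟨A, hA, rfl⟩
    have := hC.2
    simp at this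
  have c1 : R.ncard = R1.ncard + T.ncard := by
    conv_lhs => rw [e1]
    rw [Set.ncard_union_eq d1 hR1f (hTf.image _),
      Set.ncard_image_of_injective _ (extend_left_injective _)]
  have e2 : contr n R = R1 ∪ (fun A => extend A (n + 1)) '' X := by
    ext C
    constructor
    · rintro ⟨h1, h2 | ⟨A, rfl, hA⟩⟩
      · exact Or.inl ⟨h2, (Finset.mem_Icc.1 ((mem_separatedTuples.1 h1).1 _)).2⟩
      · have := extend_mem_separatedTuples.1 h1
        exact Or.inr ⟨A, ⟨hA, by omega⟩, rfl⟩
    · rintro (h | ⟨A, hA, rfl⟩)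
      · exact mem_contr_of_last_le hR h.1 h.2
      · have h1 := hTsep A hA.1
        have h2 : A (Fin.last d) < n := hA.2
        exact ⟨extend_mem_separatedTuples.2
          ⟨mem_separatedTuples_of_last_le h1 (by omega), by omega, le_rfl⟩, Or.inr ⟨A, rfl, hA.1⟩⟩
  set X1 : Set (Fin (d + 1) → ℕ) := {A ∈ X | extend A (n + 1) ∈ R} with hX1
  have e3 : R1 ∩ (fun A => extend A (n + 1)) '' X = (fun A => extend A (n + 1)) '' X1 := by
    ext C
    constructor
    · rintro ⟨h1, A, hA, rfl⟩
      exact ⟨A, ⟨hA, h1.1⟩, rfl⟩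
    · rintro ⟨A, hA, rfl⟩
      exact ⟨⟨hA.2, by simp⟩, A, hA.1, rfl⟩
  have c2 : (contr n R).ncard + X1.ncard = R1.ncard + X.ncard := by
    have := Set.ncard_union_add_ncard_inter R1 ((fun A => extend A (n + 1)) '' X) hR1f
      (hXf.image _)
    rwa [← e2, e3, Set.ncard_image_of_injective _ (extend_left_injective _),
      Set.ncard_image_of_injective _ (extend_left_injective _)] at this
  have e4 : lnk n R = (T \ X) ∪ X1 := by
    ext A
    constructor
    · rintro ⟨h1, h2⟩
      by_cases h3 : A (Fin.last d) < n
      · exact Or.inr ⟨⟨h1, h3⟩, h2.resolve_left h3.ne⟩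
      · exact Or.inl ⟨h1, fun h => h3 h.2⟩
    · rintro (h | h)
      · refine ⟨h.1, Or.inl ?_⟩
        have h1 := hTlast A h.1
        have h2 : ¬ A (Fin.last d) < n := fun h' => h.2 ⟨h.1, h'⟩
        omega
      · exact ⟨h.1.1, Or.inr h.2⟩
  have hX1X : X1 ⊆ X := fun A h => h.1
  have hXT : X ⊆ T := fun A h => h.1
  have d4 : Disjoint (T \ X) X1 := Set.disjoint_left.2 fun A h h' => h.2 (hX1X h')
  have c4 : (lnk n R).ncard = (T \ X).ncard + X1.ncard := by
    rw [e4, Set.ncard_union_eq d4 (hTf.subset Set.sdiff_subset) (hXf.subset hX1X)]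
  have c5 : (T \ X).ncard + X.ncard = T.ncard := Set.ncard_sdiff_add_ncard_of_subset hXT hTf
  omega

theorem le_of_mem_separatedTuples {A : Fin (d + 1) → ℕ} {m : ℕ} (hA : A ∈ separatedTuples d m) :
    2 * d + 1 ≤ m := by
  rw [mem_separatedTuples] at hA
  have h1 := hA.2.add_le (Fin.last d)
  have h2 := Finset.mem_Icc.1 (hA.1 0)
  have h3 := Finset.mem_Icc.1 (hA.1 (Fin.last d))
  simp at h1
  omega

/-- Pascal's rule, arranged so that the first summand is the bound for the contraction and the
second the bound for the link. -/
theorem choose_step (n d : ℕ) (h : d + 1 ≤ n) :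
    (n + 2 - (d + 1) - 1).choose (d + 1) =
      (n + 1 - (d + 1) - 1).choose (d + 1) + (n - d - 1).choose d := by
  obtain ⟨k, rfl⟩ := Nat.exists_eq_add_of_le h
  rw [show d + 1 + k + 2 - (d + 1) - 1 = k + 1 by omega,
    show d + 1 + k + 1 - (d + 1) - 1 = k by omega, show d + 1 + k - d - 1 = k by omega,
    Nat.choose_succ_succ, add_comm]

/-- The size of a non-intertwining set of separated tuples is bounded by the number of internal
`d`-simplices of a triangulation. -/
theorem NonIntertwining.ncard_le (d m : ℕ) {R : Set (Fin (d + 1) → ℕ)}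
    (hRs : R ⊆ separatedTuples d m) (hR : NonIntertwining R) :
    R.ncard ≤ (m - d - 1).choose d := by
  induction d generalizing m with
  | zero =>
    simp only [Nat.choose_zero_right]
    rw [Set.ncard_le_one_iff ((finite_separatedTuples _ _).subset hRs)]
    intro A B hA hB
    ext i
    obtain rfl : i = 0 := Subsingleton.elim (α := Fin 1) _ _
    by_contra h
    rcases Nat.lt_or_gt_of_ne h with h | h
    · exact hR A hA B hB ⟨fun i => by rwa [Subsingleton.elim (α := Fin 1) i 0], fun i => i.elim0⟩
    · exact hR B hB A hA ⟨fun i => by rwa [Subsingleton.elim (α := Fin 1) i 0], fun i => i.elim0⟩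
  | succ d ihd =>
    induction m generalizing R with
    | zero =>
      have h0 : R = ∅ := Set.eq_empty_of_forall_notMem fun A hA => by
        have := le_of_mem_separatedTuples (hRs hA); omega
      rw [h0]
      simp
    | succ m ihm =>
      by_cases hm : 2 * (d + 1) + 1 ≤ m + 1
      · obtain ⟨n, rfl⟩ : ∃ n, m = n + 1 := ⟨m - 1, by omega⟩
        rw [ncard_eq_contr_add_lnk hRs, choose_step n d (by omega)]
        exact Nat.add_le_add (ihm (contr_subset n R) (contr_nonIntertwining hR))
          (ihd n (lnk_subset hRs) (lnk_nonIntertwining hRs hR))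
      · have h0 : R = ∅ := Set.eq_empty_of_forall_notMem fun A hA => by
          have := le_of_mem_separatedTuples (hRs hA); omega
        rw [h0]
        simp

end Contraction

/-! ### Passing compatible sets between a set of tuples, its link and its contraction -/

section Lifting

open Filter Topology

variable {d : ℕ} {t : ℕ → ℝ}

/-- Every separated tuple that intertwines no element of `R` belongs to `R`. -/
def Saturated (m : ℕ) (R : Set (Fin (d + 1) → ℕ)) : Prop :=
  ∀ A ∈ separatedTuples d m, (∀ C ∈ R, ¬ Intertwines A C ∧ ¬ Intertwines C A) → A ∈ R

theorem eq_of_forall_mem_range {P A : Fin (d + 1) → ℕ} (hP : StrictMono P) (hA : StrictMono A)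
    (h : ∀ i, ∃ j, A j = P i) : P = A := by
  refine (hP.range_inj hA).1 (Set.eq_of_subset_of_ncard_le ?_ ?_ (Set.finite_range _))
  · rintro _ ⟨i, rfl⟩
    exact h i
  · rw [Set.ncard_range_of_injective hP.injective, Set.ncard_range_of_injective hA.injective]

/-- The labels `n + 1` and `n + 2` are adjacent, so a gapped tuple cannot use both. -/
theorem mem_of_gapped {n : ℕ} {G : Finset ℕ} {X : Fin (d + 1) → ℕ} (hX : Gapped X) (h : ∀ i, X i ∈ insert (n + 2) (insert (n + 1) G)) :
    (∀ i, X i ∈ insert (n + 1) G) ∨ ∀ i, X i ∈ insert (n + 2) G := by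
  by_cases h0 : ∃ i, X i = n + 1
  · left
    obtain ⟨i, hi⟩ := h0
    intro j
    refine (Finset.mem_insert.1 (h j)).resolve_left fun hj => ?_
    have hij : i < j := hX.strictMono.lt_iff_lt.1 (by omega)
    obtain ⟨k, rfl⟩ : ∃ k : Fin d, k.castSucc = i :=
      ⟨⟨i, by omega⟩, rfl⟩
    have h1 := hX k
    have h2 : X k.succ ≤ X j := hX.strictMono.monotone (by
      rw [Fin.le_def]; rw [Fin.lt_def] at hij; simp at hij ⊢; omega)
    omega
  · right
    push Not at h0
    intro j
    have := h j
    simp only [Finset.mem_insert] at this ⊢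
    have := h0 j
    tauto

theorem Compat.union {n : ℕ} {R : Set (Fin (d + 1) → ℕ)} {G : Finset ℕ}
    (h1 : Compat R (insert (n + 1) G)) (h2 : Compat R (insert (n + 2) G)) :
    Compat R (insert (n + 2) (insert (n + 1) G)) := fun X hX hXG =>
  (mem_of_gapped hX hXG).elim (h1 X hX) (h2 X hX)

theorem eq_extend_of_exists {n : ℕ} {G : Finset ℕ} (hG : G ⊆ Finset.Icc 1 n) {k : ℕ} (hk : n < k)
    {X : Fin (d + 1 + 1) → ℕ} (hX : Gapped X) (h : ∀ i, X i ∈ insert k G) (hXG : ¬ ∀ i, X i ∈ G) :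
    ∃ A, X = extend A k ∧ Gapped A ∧ A (Fin.last d) + 2 ≤ k ∧ ∀ i, A i ∈ G := by
  have hlast : X (Fin.last (d + 1)) = k := by
    by_contra hne
    refine hXG fun i => (Finset.mem_insert.1 (h i)).resolve_left fun hi => ?_
    have h1 := hX.le_last i
    have h2 := (Finset.mem_insert.1 (h (Fin.last (d + 1)))).resolve_left hne
    have := (Finset.mem_Icc.1 (hG h2)).2
    omega
  obtain ⟨A, hA⟩ := exists_eq_extend X
  rw [hlast] at hA
  subst hA
  obtain ⟨h1, h2⟩ := gapped_extend.1 hX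
  refine ⟨A, rfl, h1, h2, fun i => ?_⟩
  have h3 := h i.castSucc
  rw [extend_castSucc] at h3
  refine (Finset.mem_insert.1 h3).resolve_left fun hi => ?_
  have := h1.le_last i
  omega

section

variable {n : ℕ} {R : Set (Fin (d + 1 + 1) → ℕ)}

/-- By saturation it is enough that `D` crosses no `E ∈ R`. The first `d + 1` entries of `D` and the
last `d + 1` both form tuples of the link; one of their extensions by `n + 1` or `n + 2`, which lie
in `R`, would cross `E` too. -/
theorem mem_of_compat_lnk (hRs : R ⊆ separatedTuples (d + 1) (n + 2)) (hR : NonIntertwining R)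
    (hmax : Saturated (n + 2) R) {G : Finset ℕ} (hG : G ⊆ Finset.Icc 1 n)
    (hc : Compat (lnk n R) G) {D : Fin (d + 1 + 1) → ℕ} (hD : Gapped D) (hDG : ∀ i, D i ∈ G) :
    D ∈ R := by
  have hDn : ∀ i, 1 ≤ D i ∧ D i ≤ n := fun i => Finset.mem_Icc.1 (hG (hDG i))
  obtain ⟨A, hA⟩ := exists_eq_extend D
  have hAD : ∀ i, A i = D i.castSucc := fun i => by rw [hA, extend_castSucc]
  have hgap := hD
  rw [hA, gapped_extend] at hgap
  have hAl : A ∈ lnk n R := hc A hgap.1 fun i => by rw [hAD]; exact hDG _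
  have hAl2 : extend A (n + 1) ∈ R := hAl.2.resolve_left (by
    have := (hDn (Fin.last (d + 1))).2
    omega)
  have htail : (fun i : Fin (d + 1) => D i.succ) ∈ lnk n R := hc _
    (fun i => by have := hD i.succ; simpa using this) fun i => hDG _
  refine hmax D (mem_separatedTuples.2 ⟨fun i => Finset.mem_Icc.2 ⟨(hDn i).1, ?_⟩, hD⟩)
    fun E hE => ⟨fun h => ?_, fun h => ?_⟩
  · have := (hDn i).2; omega
  · have hEn := (Finset.mem_Icc.1 ((mem_separatedTuples.1 (hRs hE)).1 (Fin.last (d + 1)))).2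
    rcases hEn.lt_or_eq with hlt | heq
    · refine hR E hE _ htail.1 ⟨fun i => ?_, fun i => ?_⟩
      · refine Fin.lastCases ?_ (fun j => ?_) i
        · rw [extend_last]; exact hlt
        · rw [extend_castSucc]; exact h.2 j
      · rw [extend_castSucc]; exact h.1 i.succ
    · obtain ⟨B, hB⟩ := exists_eq_extend E
      have h1 := h.2 (Fin.last d)
      have h2 := (hDn (Fin.last d).succ).2
      rw [hA, hB, intertwines_extend] at h
      have h3 : B (Fin.last d) = E (Fin.last d).castSucc := by rw [hB, extend_castSucc]
      refine hR _ hAl2 E hE ?_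
      rw [hB, intertwines_extend]
      exact ⟨h.1, by omega, by omega⟩
  · obtain ⟨B, hB⟩ := exists_eq_extend E
    have h2 := (hDn (Fin.last (d + 1))).2
    rw [hA, hB, intertwines_extend] at h
    refine hR E hE _ hAl.1 ?_
    rw [hB, intertwines_extend]
    exact ⟨h.1, h.2.1, by omega⟩

/-- Tuples ending in `n + 1` or `n + 2` are in `R` by the definition of the link; those inside `G`
need saturation. So simplices of the link become simplices of `R` when joined with the edge `{n + 1,
n + 2}`. -/
theorem Compat.of_lnk (hRs : R ⊆ separatedTuples (d + 1) (n + 2)) (hR : NonIntertwining R)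
    (hmax : Saturated (n + 2) R) {G : Finset ℕ} (hG : G ⊆ Finset.Icc 1 n)
    (hc : Compat (lnk n R) G) : Compat R (insert (n + 2) (insert (n + 1) G)) := by
  have key : ∀ D : Fin (d + 1 + 1) → ℕ, Gapped D → (∀ i, D i ∈ G) → D ∈ R := fun D hD hDG =>
    mem_of_compat_lnk hRs hR hmax hG hc hD hDG
  refine Compat.union (fun X hX hXG => ?_) fun X hX hXG => ?_
  all_goals
    by_cases h : ∀ i, X i ∈ G
    · exact key X hX h
    obtain ⟨A, rfl, hA1, hA2, hA3⟩ := eq_extend_of_exists hG (by omega) hX hXG h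
    have hA := hc A hA1 hA3
  · exact hA.2.resolve_left (by omega)
  · exact hA.1

theorem Compat.lnk {G : Finset ℕ} (hG : G ⊆ Finset.Icc 1 n)
    (hc : Compat R (insert (n + 2) (insert (n + 1) G))) : Compat (lnk n R) G := by
  intro A hA hAG
  have hAn := (Finset.mem_Icc.1 (hG (hAG (Fin.last d)))).2
  refine ⟨hc _ (gapped_extend.2 ⟨hA, by omega⟩) ?_, ?_⟩
  · rw [forall_extend (p := fun y => y ∈ insert (n + 2) (insert (n + 1) G))]
    exact ⟨fun i => by simp [hAG i], by simp⟩
  · by_cases h : A (Fin.last d) = n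
    · exact Or.inl h
    · refine Or.inr (hc _ (gapped_extend.2 ⟨hA, by omega⟩) ?_)
      rw [forall_extend (p := fun y => y ∈ insert (n + 2) (insert (n + 1) G))]
      exact ⟨fun i => by simp [hAG i], by simp⟩

theorem Compat.contr (hRs : R ⊆ separatedTuples (d + 1) (n + 2)) {F : Finset ℕ}
    (hF : F ⊆ Finset.Icc 1 (n + 1)) (hc : Compat R F) : Compat (contr n R) F := fun X hX hXF =>
  mem_contr_of_last_le hRs (hc X hX hXF) (Finset.mem_Icc.1 (hF (hXF _))).2

theorem Compat.contr' (hRs : R ⊆ separatedTuples (d + 1) (n + 2)) {G : Finset ℕ}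
    (hG : G ⊆ Finset.Icc 1 n) (hc : Compat R (insert (n + 2) G)) :
    Compat (_root_.contr n R) (insert (n + 1) G) := by
  intro X hX hXF
  by_cases h : ∀ i, X i ∈ G
  · exact mem_contr_of_last_le hRs (hc X hX fun i => Finset.mem_insert_of_mem (h i))
      (by have := (Finset.mem_Icc.1 (hG (h (Fin.last (d + 1))))).2; omega)
  obtain ⟨A, rfl, hA1, hA2, hA3⟩ := eq_extend_of_exists hG (by omega) hX hXF h
  have h1 : extend A (n + 2) ∈ R := hc _ (gapped_extend.2 ⟨hA1, by omega⟩) (by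
    rw [forall_extend (p := fun y => y ∈ insert (n + 2) G)]
    exact ⟨fun i => by simp [hA3 i], by simp⟩)
  have h2 := extend_mem_separatedTuples.1 (hRs h1)
  exact ⟨extend_mem_separatedTuples.2 ⟨mem_separatedTuples_of_last_le h2.1 (by omega), hA2, le_rfl⟩,
    Or.inr ⟨A, rfl, h1⟩⟩

theorem Compat.of_contr {F : Finset ℕ} (hF : F ⊆ Finset.Icc 1 n)
    (hc : Compat (_root_.contr n R) F) : Compat R F := fun X hX hXF =>
  mem_of_mem_contr (hc X hX hXF) (by
    have := (Finset.mem_Icc.1 (hF (hXF (Fin.last (d + 1))))).2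
    omega)

/-- A simplex of the contraction with vertex `n + 1` lifts to one with vertex `n + 1` or `n + 2`. -/
theorem Compat.lift_contr (ht : StrictMono t) (hRs : R ⊆ separatedTuples (d + 1) (n + 2))
    (hR : NonIntertwining R) (hmax : Saturated (n + 2) R) (hcov : Covers t n (_root_.lnk n R))
    {ρ : Finset ℕ} (hρ : ρ ⊆ Finset.Icc 1 n) (h : Compat (_root_.contr n R) (insert (n + 1) ρ)) :
    Compat R (insert (n + 1) ρ) ∨ Compat R (insert (n + 2) ρ) := by
  classical
  by_contra hcon
  rw [not_or] at hcon
  simp only [Compat, not_forall] at hcon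
  obtain ⟨⟨X, hX, hXρ, hXR⟩, Y, hY, hYρ, hYR⟩ := hcon
  have hL := lnk_nonIntertwining hRs hR
  have hin : ∀ A : Fin (d + 1) → ℕ, Gapped A → (∀ i, A i ∈ ρ) → A (Fin.last d) < n →
      extend A (n + 1) ∈ R ∨ extend A (n + 2) ∈ R := fun A h1 h2 h3 =>
    extend_mem_of_mem_contr (h _ (gapped_extend.2 ⟨h1, by omega⟩) (by
      rw [forall_extend (p := fun y => y ∈ insert (n + 1) ρ)]
      exact ⟨fun i => by simp [h2 i], by simp⟩))
  have hlow : ∀ X : Fin (d + 1 + 1) → ℕ, Gapped X → (∀ i, X i ∈ ρ) → X ∈ R := fun X h1 h2 =>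
    Compat.of_contr hρ (h.mono (Finset.subset_insert _ _)) X h1 h2
  -- The obstructions are `B` extended by `n + 1` and `A` extended by `n + 2`; the other extension
  -- of each, where gapped, is in `R`. Hence neither tuple is in the link, `A` intertwines no
  -- element of the link, and no element of the link intertwines `B`.
  obtain ⟨B, rfl, hB1, hB2, hB3⟩ :=
    eq_extend_of_exists hρ (by omega) hX hXρ fun h' => hXR (hlow X hX h')
  obtain ⟨A, rfl, hA1, hA2, hA3⟩ :=
    eq_extend_of_exists hρ (by omega) hY hYρ fun h' => hYR (hlow Y hY h')
  have hBR := (hin B hB1 hB3 (by omega)).resolve_left hXR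
  have hAL : A ∉ _root_.lnk n R := fun h' => hYR h'.1
  have hBL : B ∉ _root_.lnk n R := fun h' => hXR (h'.2.resolve_left (by omega))
  have hlast : ∀ D ∈ _root_.lnk n R, D (Fin.last d) ≤ n := fun D hD =>
    (Finset.mem_Icc.1 ((mem_separatedTuples.1 (lnk_subset hRs hD)).1 (Fin.last d))).2
  have hAD : ∀ D ∈ _root_.lnk n R, ¬ Intertwines A D := fun D hD hi => by
    have h1 := hi.1 (Fin.last d)
    have h2 := hlast D hD
    exact hR _ ((hin A hA1 hA3 (by omega)).resolve_right hYR) _ hD.1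
      (intertwines_extend.2 ⟨hi, by omega, by omega⟩)
  have hDB : ∀ D ∈ _root_.lnk n R, ¬ Intertwines D B := fun D hD hi => by
    have h1 := hi.1 (Fin.last d)
    exact hR _ (hD.2.resolve_left (by omega)) _ hBR
      (intertwines_extend.2 ⟨hi, by omega, by omega⟩)
  set V := Finset.Icc 1 n with hV
  set u : ℕ → ℝ := fun x => if ∃ i, A i = x then 1 else 0 with hu
  set w : ℕ → ℝ := fun x => if ∃ i, B i = x then 1 else 0 with hw
  have hu0 : ∀ x, 0 ≤ u x := fun x => by simp only [hu]; split_ifs <;> simp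
  have hw0 : ∀ x, 0 ≤ w x := fun x => by simp only [hw]; split_ifs <;> simp
  set l : ℝ → ℕ → ℝ := fun s x => (1 - s) * u x + s * w x with hl
  set Sg : Finset (Finset ℕ) :=
    V.powerset.filter fun σ => σ.card = 2 * d + 1 ∧ Compat (_root_.lnk n R) σ with hSg
  have hmemSg : ∀ σ, σ ∈ Sg ↔ σ ⊆ V ∧ σ.card = 2 * d + 1 ∧ Compat (_root_.lnk n R) σ := fun σ => by
    simp [hSg, Finset.mem_filter, Finset.mem_powerset]
  -- The weight `l s` runs along the segment from `A` to `B`. `c σ s` subtracts its representation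
  -- in the simplex `σ` of the link, and `M σ s` is the resulting difference of heights one
  -- dimension higher, where the segment is compared with the section formed by the link.
  let c : Finset ℕ → ℝ → ℕ → ℝ := fun σ s x => l s x - if x ∈ σ then coord t V σ (l s) x else 0
  let M : Finset ℕ → ℝ → ℝ := fun σ s => ∑ x ∈ V, c σ s x * t x ^ (2 * d + 1)
  have hcoordcont : ∀ σ i, Continuous fun s => coord t V σ (l s) i := fun σ i => by
    simp only [hl, coord_add_smul]; fun_prop
  have hccont : ∀ σ x, Continuous fun s => c σ s x := fun σ x => by
    simp only [c, hl]
    have := hcoordcont σ x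
    split_ifs <;> fun_prop
  have hMcont : ∀ σ, Continuous (M σ) := fun σ => by
    refine continuous_finsetSum _ fun x _ => ?_
    exact (hccont σ x).mul continuous_const
  have hcm : ∀ σ ∈ Sg, ∀ s, ∀ k < 2 * d + 1, ∑ x ∈ V, c σ s x * t x ^ k = 0 := by
    intro σ hσ s k hk
    obtain ⟨h1, h2, h3⟩ := (hmemSg σ).1 hσ
    simp only [c, sub_mul, Finset.sum_sub_distrib, ite_mul, zero_mul]
    rw [Finset.sum_ite_mem, Finset.inter_eq_right.2 h1, sum_coord_mul_pow ht V σ _ k (by omega),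
      sub_self]
  have hl0 : ∀ s ∈ Set.Icc (0 : ℝ) 1, ∀ x, 0 ≤ l s x := fun s hs x =>
    add_nonneg (mul_nonneg (by linarith [hs.2]) (hu0 x)) (mul_nonneg hs.1 (hw0 x))
  let Pos : Set ℝ := ⋃ σ ∈ Sg, {s : ℝ | (∀ i ∈ σ, 0 ≤ coord t V σ (l s) i) ∧ 0 ≤ M σ s}
  let Neg : Set ℝ := ⋃ σ ∈ Sg, {s : ℝ | (∀ i ∈ σ, 0 ≤ coord t V σ (l s) i) ∧ M σ s ≤ 0}
  have hclosed : ∀ σ, IsClosed {s : ℝ | ∀ i ∈ σ, 0 ≤ coord t V σ (l s) i} := fun σ => by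
    simp only [Set.ofPred_forall]
    exact isClosed_iInter fun i => isClosed_iInter fun _ =>
      isClosed_le continuous_const (hcoordcont σ i)
  have hPosc : IsClosed Pos := Set.Finite.isClosed_biUnion Sg.finite_toSet fun σ _ =>
    (hclosed σ).inter (isClosed_le continuous_const (hMcont σ))
  have hNegc : IsClosed Neg := Set.Finite.isClosed_biUnion Sg.finite_toSet fun σ _ =>
    (hclosed σ).inter (isClosed_le (hMcont σ) continuous_const)
  have hcover : ∀ s ∈ Set.Icc (0 : ℝ) 1, ∃ σ ∈ Sg, ∀ i ∈ σ, 0 ≤ coord t V σ (l s) i := by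
    intro s hs
    obtain ⟨σ, h1, h2, h3, h4⟩ := hcov (l s) (hl0 s hs)
    exact ⟨σ, (hmemSg σ).2 ⟨h1, h2, h3⟩, h4⟩
  have hsub : Set.Icc (0 : ℝ) 1 ⊆ Pos ∪ Neg := by
    intro s hs
    obtain ⟨σ, hσ, h1⟩ := hcover s hs
    rcases le_total 0 (M σ s) with h2 | h2
    · exact Or.inl (Set.mem_biUnion (x := σ) hσ ⟨h1, h2⟩)
    · exact Or.inr (Set.mem_biUnion (x := σ) hσ ⟨h1, h2⟩)
  -- the only way for the weight to be supported on a compatible simplex is `A` or `B` in the link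
  have hne : ∀ s ∈ Set.Icc (0 : ℝ) 1, ∀ σ ∈ Sg, ∃ x ∈ V, c σ s x ≠ 0 := by
    intro s hs σ hσ
    obtain ⟨h1, h2, h3⟩ := (hmemSg σ).1 hσ
    by_contra! hall
    have hsupp : ∀ x ∈ V, l s x ≠ 0 → x ∈ σ := fun x hx hne => by
      by_contra hxσ
      have := hall x hx
      simp only [c, hxσ, if_false, sub_zero] at this
      exact hne this
    rcases hs.2.lt_or_eq with hs1 | rfl
    · refine hAL (h3 A hA1 fun i => hsupp _ (hρ (hA3 i)) (ne_of_gt ?_))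
      refine add_pos_of_pos_of_nonneg (mul_pos (by linarith) ?_) (mul_nonneg hs.1 (hw0 _))
      simp [hu]
    · refine hBL (h3 B hB1 fun i => hsupp _ (hρ (hB3 i)) ?_)
      simp [hl, hw]
  have hneg : ∀ σ s x, (∀ i ∈ σ, 0 ≤ coord t V σ (l s) i) → 0 < c σ s x → 0 < l s x := by
    intro σ s x h1 h2
    simp only [c] at h2
    split_ifs at h2 with hx
    · linarith [h1 x hx]
    · linarith
  have hpos : ∀ σ, ∀ s ∈ Set.Icc (0 : ℝ) 1, ∀ x, c σ s x < 0 → x ∈ σ := by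
    intro σ s hs x h2
    by_contra hx
    simp only [c, hx, if_false, sub_zero] at h2
    linarith [hl0 s hs x]
  -- If the segment were below the section at `s = 0`, the dependence would produce a tuple of the
  -- link intertwined by `A`. The end `s = 1` is symmetric, with `B`.
  have h0Pos : (0 : ℝ) ∈ Pos := by
    obtain ⟨σ, hσ, h1⟩ := hcover 0 (by simp)
    refine Set.mem_biUnion (x := σ) hσ ⟨h1, ?_⟩
    by_contra! hM
    obtain ⟨x, hx, hcx⟩ := hne 0 (by simp) σ hσ
    obtain ⟨P, N, hP, hN, hNP⟩ := exists_intertwines_of_moments_of_nonneg (d := d) ht V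
      (fun x => -c σ 0 x) (fun k hk => by simp [Finset.sum_neg_distrib, hcm σ hσ 0 k hk])
      (by simpa [Finset.sum_neg_distrib] using hM.le) ⟨x, hx, by simpa using hcx⟩
    have hPL : P ∈ _root_.lnk n R := ((hmemSg σ).1 hσ).2.2 P hNP.gapped_right fun i =>
      hpos σ 0 (by simp) _ (by linarith [(hP i).2])
    have hNA : N = A := eq_of_forall_mem_range hNP.gapped_left.strictMono hA1.strictMono fun i => by
      have := hneg σ 0 (N i) h1 (by linarith [(hN i).2])
      by_contra hi
      simp [hl, hu, hi] at this
    exact hAD P hPL (hNA ▸ hNP)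
  have h1Neg : (1 : ℝ) ∈ Neg := by
    obtain ⟨σ, hσ, h1⟩ := hcover 1 (by simp)
    refine Set.mem_biUnion (x := σ) hσ ⟨h1, ?_⟩
    by_contra! hM
    obtain ⟨P, N, hP, hN, hNP⟩ := exists_intertwines_of_moments_of_nonneg (d := d) ht V
      (c σ 1) (hcm σ hσ 1) hM.le (hne 1 (by simp) σ hσ)
    have hNL : N ∈ _root_.lnk n R := ((hmemSg σ).1 hσ).2.2 N hNP.gapped_left fun i =>
      hpos σ 1 (by simp) _ (hN i).2
    have hPB : P = B := eq_of_forall_mem_range hNP.gapped_right.strictMono hB1.strictMono fun i => by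
      have := hneg σ 1 (P i) h1 (hP i).2
      by_contra hi
      simp [hl, hw, hi] at this
    exact hDB N hNL (hPB ▸ hNP)
  -- By connectedness the segment meets the section: both signs occur at some `s`, and since the two
  -- simplices give the same representation, the height difference is zero. The dependence then has
  -- `2 d + 3` alternating labels, alternately in `ρ` and `σ`, and in either order they give two
  -- intertwining elements of `R`.
  obtain ⟨s, hs, hsPos, hsNeg⟩ := isPreconnected_closed_iff.1
    (isPreconnected_Icc (a := (0 : ℝ)) (b := 1)) Pos Neg hPosc hNegc hsub
    ⟨0, by simp, h0Pos⟩ ⟨1, by simp, h1Neg⟩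
  simp only [Pos, Neg, Set.mem_iUnion, Set.mem_ofPred_eq] at hsPos hsNeg
  obtain ⟨σ, hσ, hσs, hMσ⟩ := hsPos
  obtain ⟨τ, hτ, hτs, hMτ⟩ := hsNeg
  obtain ⟨hσV, hσcard, hσc⟩ := (hmemSg σ).1 hσ
  obtain ⟨hτV, hτcard, hτc⟩ := (hmemSg τ).1 hτ
  have hcc : ∀ x ∈ V, c σ s x = c τ s x := by
    intro x hx
    have h1 := eq_of_compat_supports ht hL V σ τ hσc hτc
      (u := fun x => if x ∈ σ then coord t V σ (l s) x else 0)
      (v := fun x => if x ∈ τ then coord t V τ (l s) x else 0)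
      (fun i => by split_ifs with hi; exacts [hσs i hi, le_rfl])
      (fun i => by split_ifs with hi; exacts [hτs i hi, le_rfl])
      (fun i hi => by simp [hi]) (fun i hi => by simp [hi])
      (fun k hk => by
        simp only [ite_mul, zero_mul]
        rw [Finset.sum_ite_mem, Finset.inter_eq_right.2 hσV, Finset.sum_ite_mem,
          Finset.inter_eq_right.2 hτV, sum_coord_mul_pow ht V σ _ k (by omega),
          sum_coord_mul_pow ht V τ _ k (by omega)]) x hx
    simp only [c]
    rw [h1]
  have hM0 : M σ s = 0 := by
    have : M σ s = M τ s := Finset.sum_congr rfl fun x hx => by rw [hcc x hx]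
    linarith
  have hcm' : ∀ k < 2 * d + 2, ∑ x ∈ V, c σ s x * t x ^ k = 0 := fun k hk => by
    rcases Nat.lt_succ_iff_lt_or_eq.1 hk with h1 | rfl
    · exact hcm σ hσ s k h1
    · exact hM0
  have hlρ : ∀ x, 0 < l s x → x ∈ ρ := fun x hx => by
    by_contra hxρ
    have h1 : ¬ ∃ i, A i = x := fun ⟨i, hi⟩ => hxρ (hi ▸ hA3 i)
    have h2 : ¬ ∃ i, B i = x := fun ⟨i, hi⟩ => hxρ (hi ▸ hB3 i)
    simp [hl, hu, hw, h1, h2] at hx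
  rcases le_total 0 (∑ x ∈ V, c σ s x * t x ^ (2 * d + 2)) with hsgn | hsgn
  · obtain ⟨y, hy1, hy2⟩ := exists_alternation ht V (2 * d + 2) _ hcm' hsgn (hne s hs σ hσ)
    have he : ∀ i < d + 2, y (2 * i) ∈ ρ := fun i hi => by
      have h1 := (hy2 (2 * i) (by omega)).2
      rw [Even.neg_one_pow ⟨d + 1 + i, by ring⟩, one_mul] at h1
      exact hlρ _ (hneg σ s _ hσs h1)
    have ho : ∀ i < d + 1, y (2 * i + 1) ∈ σ := fun i hi => by
      have h1 := (hy2 (2 * i + 1) (by omega)).2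
      rw [Odd.neg_one_pow ⟨d + 1 + i, by ring⟩] at h1
      exact hpos σ s hs _ (by linarith)
    have hI : Intertwines (fun i : Fin (d + 1 + 1) => y (2 * i))
        (extend (fun i : Fin (d + 1) => y (2 * i + 1)) (n + 2)) := by
      refine ⟨fun i => ?_, fun i => ?_⟩
      · refine Fin.lastCases ?_ (fun j => ?_) i
        · rw [extend_last]
          have := (Finset.mem_Icc.1 (hρ (he (d + 1) (by omega)))).2
          simp only [Fin.val_last]; omega
        · rw [extend_castSucc]; exact hy1 _ (by simp; omega)
      · rw [extend_castSucc]
        have := hy1 (2 * i + 1) (by omega)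
        simpa [mul_add] using this
    have hDL := hσc (fun i : Fin (d + 1) => y (2 * i + 1)) (gapped_extend.1 hI.gapped_right).1
      fun i => ho _ (by omega)
    exact hR _ (hlow _ hI.gapped_left fun i => he _ (by omega)) _ hDL.1 hI
  · obtain ⟨x, hx, hcx⟩ := hne s hs σ hσ
    obtain ⟨y, hy1, hy2⟩ := exists_alternation ht V (2 * d + 2) (fun x => -c σ s x)
      (fun k hk => by simp [Finset.sum_neg_distrib, hcm' k hk])
      (by simpa [Finset.sum_neg_distrib] using hsgn) ⟨x, hx, by simpa using hcx⟩
    have he : ∀ i < d + 2, y (2 * i) ∈ σ := fun i hi => by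
      have h1 := (hy2 (2 * i) (by omega)).2
      rw [Even.neg_one_pow ⟨d + 1 + i, by ring⟩, one_mul] at h1
      exact hpos σ s hs _ (by linarith)
    have ho : ∀ i < d + 1, y (2 * i + 1) ∈ ρ := fun i hi => by
      have h1 := (hy2 (2 * i + 1) (by omega)).2
      rw [Odd.neg_one_pow ⟨d + 1 + i, by ring⟩] at h1
      exact hlρ _ (hneg σ s _ hσs (by linarith))
    have hI : ∀ k > n, Intertwines (fun i : Fin (d + 1 + 1) => y (2 * i))
        (extend (fun i : Fin (d + 1) => y (2 * i + 1)) k) := by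
      intro k hk
      refine ⟨fun i => ?_, fun i => ?_⟩
      · refine Fin.lastCases ?_ (fun j => ?_) i
        · rw [extend_last]
          have := (Finset.mem_Icc.1 (hσV (he (d + 1) (by omega)))).2
          simp only [Fin.val_last]; omega
        · rw [extend_castSucc]; exact hy1 _ (by simp; omega)
      · rw [extend_castSucc]
        have := hy1 (2 * i + 1) (by omega)
        simpa [mul_add] using this
    have hD := mem_of_compat_lnk hRs hR hmax hσV hσc (hI (n + 1) (by omega)).gapped_left
      fun i => he _ (by omega)
    have hlt : y (2 * d + 1) < n := by
      have h1 := hy1 (2 * d + 1) (by omega)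
      have h2 := (Finset.mem_Icc.1 (hσV (he (d + 1) (by omega)))).2
      rw [show 2 * (d + 1) = 2 * d + 1 + 1 by ring] at h2
      omega
    rcases hin _ (gapped_extend.1 (hI (n + 1) (by omega)).gapped_right).1
      (fun i => ho _ (by omega)) (by simpa using hlt) with h1 | h1
    · exact hR _ hD _ h1 (hI _ (by omega))
    · exact hR _ hD _ h1 (hI _ (by omega))

end

end Lifting

/-! ### Facet extension under contraction and link -/

section Step

variable {d : ℕ} {t : ℕ → ℝ}

theorem side_insert_mul_pos (ht : StrictMono t) {G : Finset ℕ} {x y z : ℕ} (hz : z ∉ G)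
    (hx : x < z) (hy : y < z) :
    0 < side t (insert z G) x * side t (insert z G) y ↔ 0 < side t G x * side t G y := by
  rw [side_insert hz, side_insert hz, show (t x - t z) * side t G x * ((t y - t z) * side t G y) =
    ((t x - t z) * (t y - t z)) * (side t G x * side t G y) by ring]
  exact mul_pos_iff_of_pos_left
    (mul_pos_of_neg_of_neg (sub_neg.2 (ht hx)) (sub_neg.2 (ht hy)))

theorem side_insert_neg (ht : StrictMono t) {G : Finset ℕ} {x z : ℕ} (hz : z ∉ G) (hx : x < z) :
    side t (insert z G) x < 0 ↔ 0 < side t G x := by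
  rw [side_insert hz]
  have := sub_neg.2 (ht hx)
  constructor
  · intro h
    exact pos_of_mul_neg_right h this.le
  · intro h
    exact mul_neg_of_neg_of_pos this h

theorem side_insert_pos (ht : StrictMono t) {G : Finset ℕ} {x z : ℕ} (hz : z ∉ G) (hx : x < z) :
    0 < side t (insert z G) x ↔ side t G x < 0 := by
  rw [side_insert hz]
  have := sub_neg.2 (ht hx)
  constructor
  · intro h
    exact neg_of_mul_pos_right h this.le
  · intro h
    exact mul_pos_of_neg_of_neg this h

theorem exists_decomposition {n : ℕ} {F : Finset ℕ} (hF : F ⊆ Finset.Icc 1 (n + 2)) :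
    ∃ G ⊆ Finset.Icc 1 n, F = G ∨ F = insert (n + 1) G ∨ F = insert (n + 2) G ∨
      F = insert (n + 2) (insert (n + 1) G) := by
  refine ⟨F ∩ Finset.Icc 1 n, Finset.inter_subset_right, ?_⟩
  have hmem : ∀ x ∈ F, x ∈ F ∩ Finset.Icc 1 n ∨ x = n + 1 ∨ x = n + 2 := fun x hx => by
    have := Finset.mem_Icc.1 (hF hx)
    simp only [Finset.mem_inter, Finset.mem_Icc, hx, true_and]
    omega
  have hsub : F ∩ Finset.Icc 1 n ⊆ F := Finset.inter_subset_left
  by_cases h1 : n + 1 ∈ F <;> by_cases h2 : n + 2 ∈ F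
  · refine Or.inr (Or.inr (Or.inr ?_))
    refine Finset.Subset.antisymm (fun x hx => ?_)
      (Finset.insert_subset h2 (Finset.insert_subset h1 hsub))
    have := hmem x hx
    rw [Finset.mem_insert, Finset.mem_insert]
    tauto
  · refine Or.inr (Or.inl ?_)
    refine Finset.Subset.antisymm (fun x hx => ?_) (Finset.insert_subset h1 hsub)
    rw [Finset.mem_insert]
    rcases hmem x hx with h | h | rfl
    · exact Or.inr h
    · exact Or.inl h
    · exact absurd hx h2
  · refine Or.inr (Or.inr (Or.inl ?_))
    refine Finset.Subset.antisymm (fun x hx => ?_) (Finset.insert_subset h2 hsub)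
    rw [Finset.mem_insert]
    rcases hmem x hx with h | rfl | h
    · exact Or.inr h
    · exact absurd hx h1
    · exact Or.inl h
  · refine Or.inl (Finset.Subset.antisymm (fun x hx => ?_) hsub)
    rcases hmem x hx with h | rfl | rfl
    · exact h
    · exact absurd hx h1
    · exact absurd hx h2

theorem notMem_of_subset_Icc {n k : ℕ} {G : Finset ℕ} (hG : G ⊆ Finset.Icc 1 n) (hk : n < k) :
    k ∉ G := fun h => by
  have := (Finset.mem_Icc.1 (hG h)).2
  omega

variable {n : ℕ} {R : Set (Fin (d + 1 + 1) → ℕ)}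

/-- Crossing `G` in the link is crossing `G ∪ {n + 1, n + 2}` in `R`. For labels up to `n` the two
extra factors of `side` are negative, so relative sides agree. -/
theorem FacetExtension.lnk (ht : StrictMono t) (hRs : R ⊆ separatedTuples (d + 1) (n + 2))
    (hR : NonIntertwining R) (hmax : Saturated (n + 2) R) (hP : FacetExtension t (n + 2) R) :
    FacetExtension t n (_root_.lnk n R) := by
  intro G hG hGcard hGc x hx hxG
  have h1 : n + 1 ∉ G := notMem_of_subset_Icc hG (by omega)
  have h2 : n + 2 ∉ insert (n + 1) G := by
    simp [notMem_of_subset_Icc hG (show n < n + 2 by omega)]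
  have hxn := Finset.mem_Icc.1 hx
  obtain ⟨y, hy, hxy, hyc⟩ := hP (insert (n + 2) (insert (n + 1) G))
    (by
      refine Finset.insert_subset (by simp) (Finset.insert_subset (by simp) ?_)
      exact hG.trans (Finset.Icc_subset_Icc_right (by omega)))
    (by rw [Finset.card_insert_of_notMem h2, Finset.card_insert_of_notMem h1, hGcard]; ring)
    (Compat.of_lnk hRs hR hmax hG hGc) x (by simp; omega)
    (by simp only [Finset.mem_insert, hxG, or_false]; omega)
  have hyF : y ∉ insert (n + 2) (insert (n + 1) G) := fun h => by
    simp [(side_eq_zero_iff ht).2 h] at hxy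
  simp only [Finset.mem_insert, not_or] at hyF
  have hy' := Finset.mem_Icc.1 hy
  have hyn : y ∈ Finset.Icc 1 n := Finset.mem_Icc.2 ⟨hy'.1, by omega⟩
  refine ⟨y, hyn, ?_, Compat.lnk (Finset.insert_subset hyn hG) ?_⟩
  · rwa [side_insert_mul_pos ht h2 (by omega) (by omega),
      side_insert_mul_pos ht h1 (by omega) (by omega)] at hxy
  · rwa [Finset.insert_comm (n + 1) y, Finset.insert_comm (n + 2) y]

/-- A facet without `n + 1` is crossed in `R`, renaming `n + 2` to `n + 1`. A facet `G ∪ {n + 1}` is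
first lifted; if the neighbour is `G ∪ {n + 1, n + 2}`, which collapses, the other lift is crossed
next. The collapsing simplex cannot recur: `x` has the same sign for both lifts, whereas `n + 2` is
above one and `n + 1` below the other. -/
theorem FacetExtension.contr (ht : StrictMono t) (hRs : R ⊆ separatedTuples (d + 1) (n + 2))
    (hlift : ∀ ρ ⊆ Finset.Icc 1 n, Compat (_root_.contr n R) (insert (n + 1) ρ) →
      Compat R (insert (n + 1) ρ) ∨ Compat R (insert (n + 2) ρ))
    (hP : FacetExtension t (n + 2) R) : FacetExtension t (n + 1) (_root_.contr n R) := by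
  intro F hF hFcard hFc x hx hxF
  obtain ⟨G, hG, hFG⟩ := exists_decomposition (n := n) (hF.trans (Finset.Icc_subset_Icc_right (by omega)))
  have h1 : n + 1 ∉ G := notMem_of_subset_Icc hG (by omega)
  have h2 : n + 2 ∉ G := notMem_of_subset_Icc hG (by omega)
  have h2F : n + 2 ∉ F := notMem_of_subset_Icc hF (by omega)
  have hG2 : G ⊆ Finset.Icc 1 (n + 2) := hG.trans (Finset.Icc_subset_Icc_right (by omega))
  have hG1 : G ⊆ Finset.Icc 1 (n + 1) := hG.trans (Finset.Icc_subset_Icc_right (by omega))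
  have hxn := Finset.mem_Icc.1 hx
  rcases hFG with rfl | rfl | rfl | rfl
  · obtain ⟨y, hy, hxy, hyc⟩ := hP F hG2 hFcard (hFc.of_contr hG) x (by simp; omega) hxF
    have hyn := Finset.mem_Icc.1 hy
    by_cases hy2 : y ≤ n + 1
    · have hy1 : y ∈ Finset.Icc 1 (n + 1) := Finset.mem_Icc.2 ⟨hyn.1, hy2⟩
      exact ⟨y, hy1, hxy, hyc.contr hRs (Finset.insert_subset hy1 hF)⟩
    · obtain rfl : y = n + 2 := by omega
      refine ⟨n + 1, by simp, ?_, hyc.contr' hRs hG⟩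
      have hp1 : 0 < side t F (n + 1) := side_pos_of_forall_lt ht fun f hf => by
        have := (Finset.mem_Icc.1 (hG hf)).2; omega
      have hp2 : 0 < side t F (n + 2) := side_pos_of_forall_lt ht fun f hf => by
        have := (Finset.mem_Icc.1 (hG hf)).2; omega
      exact mul_pos (pos_of_mul_pos_left hxy hp2.le) hp1
  · have hxG : x ∉ G := fun h => hxF (Finset.mem_insert_of_mem h)
    have hx1 : x ≠ n + 1 := fun h => hxF (h ▸ Finset.mem_insert_self _ _)
    have hxn' : x ∈ Finset.Icc 1 n := Finset.mem_Icc.2 ⟨hxn.1, by omega⟩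
    have hcard : G.card + 1 = 2 * (d + 1) := by rw [← hFcard, Finset.card_insert_of_notMem h1]
    have hF1 : insert (n + 1) G ⊆ Finset.Icc 1 (n + 2) := Finset.insert_subset (by simp) hG2
    have hF2 : insert (n + 2) G ⊆ Finset.Icc 1 (n + 2) := Finset.insert_subset (by simp) hG2
    have hside : ∀ y ∈ Finset.Icc 1 n, (0 < side t (insert (n + 1) G) x * side t (insert (n + 1) G) y ↔
        0 < side t (insert (n + 2) G) x * side t (insert (n + 2) G) y) := fun y hy => by
      have := (Finset.mem_Icc.1 hy).2
      rw [side_insert_mul_pos ht h1 (by omega) (by omega),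
        side_insert_mul_pos ht h2 (by omega) (by omega)]
    have hs12 : 0 < side t (insert (n + 1) G) (n + 2) := side_pos_of_forall_lt ht fun f hf => by
      rcases Finset.mem_insert.1 hf with rfl | hf
      · omega
      · have := (Finset.mem_Icc.1 (hG hf)).2; omega
    have hs21 : side t (insert (n + 2) G) (n + 1) < 0 := by
      rw [side_insert_neg ht h2 (by omega)]
      exact side_pos_of_forall_lt ht fun f hf => by
        have := (Finset.mem_Icc.1 (hG hf)).2; omega
    have hsx : side t (insert (n + 1) G) x < 0 ↔ side t (insert (n + 2) G) x < 0 := by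
      rw [side_insert_neg ht h1 (by omega), side_insert_neg ht h2 (by omega)]
    have hx2 : x ∈ Finset.Icc 1 (n + 2) := by simp; omega
    have hxF2 : x ∉ insert (n + 2) G := by
      simp only [Finset.mem_insert, hxG, or_false]; omega
    have ex1 : ∀ y ∈ Finset.Icc 1 n, 0 < side t (insert (n + 1) G) x * side t (insert (n + 1) G) y →
        Compat R (insert y (insert (n + 1) G)) →
        ∃ y ∈ Finset.Icc 1 (n + 1), 0 < side t (insert (n + 1) G) x * side t (insert (n + 1) G) y ∧
          Compat (_root_.contr n R) (insert y (insert (n + 1) G)) := fun y hy hxy hyc => by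
      have hy1 : y ∈ Finset.Icc 1 (n + 1) := Finset.Icc_subset_Icc_right (by omega) hy
      exact ⟨y, hy1, hxy, hyc.contr hRs (Finset.insert_subset hy1 hF)⟩
    have ex2 : ∀ y ∈ Finset.Icc 1 n, 0 < side t (insert (n + 2) G) x * side t (insert (n + 2) G) y →
        Compat R (insert y (insert (n + 2) G)) →
        ∃ y ∈ Finset.Icc 1 (n + 1), 0 < side t (insert (n + 1) G) x * side t (insert (n + 1) G) y ∧
          Compat (_root_.contr n R) (insert y (insert (n + 1) G)) := fun y hy hxy hyc => by
      refine ⟨y, Finset.Icc_subset_Icc_right (by omega) hy, (hside y hy).2 hxy, ?_⟩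
      rw [Finset.insert_comm] at hyc ⊢
      exact hyc.contr' hRs (Finset.insert_subset hy hG)
    have hmem1 : ∀ y ∈ Finset.Icc 1 (n + 2), 0 < side t (insert (n + 1) G) x *
        side t (insert (n + 1) G) y → y ∈ Finset.Icc 1 n ∨ y = n + 2 := fun y hy hxy => by
      have hy1 : y ≠ n + 1 := by
        rintro rfl
        simp [(side_eq_zero_iff ht).2 (Finset.mem_insert_self (n + 1) G)] at hxy
      rw [Finset.mem_Icc] at hy ⊢
      omega
    have hmem2 : ∀ y ∈ Finset.Icc 1 (n + 2), 0 < side t (insert (n + 2) G) x *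
        side t (insert (n + 2) G) y → y ∈ Finset.Icc 1 n ∨ y = n + 1 := fun y hy hxy => by
      have hy1 : y ≠ n + 2 := by
        rintro rfl
        simp [(side_eq_zero_iff ht).2 (Finset.mem_insert_self (n + 2) G)] at hxy
      rw [Finset.mem_Icc] at hy ⊢
      omega
    have hc2 := Finset.card_insert_of_notMem h2
    have hx0 : side t (insert (n + 1) G) x ≠ 0 := fun h => hxF ((side_eq_zero_iff ht).1 h)
    rcases hlift G hG hFc with hc | hc
    · obtain ⟨y, hy, hxy, hyc⟩ := hP _ hF1 hFcard hc x hx2 hxF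
      rcases hmem1 y hy hxy with hyn | rfl
      · exact ex1 y hyn hxy hyc
      · have hxpos := pos_of_mul_pos_left hxy hs12.le
        obtain ⟨z, hz, hxz, hzc⟩ := hP _ hF2 (by omega)
          (hyc.mono (Finset.insert_subset_insert _ (Finset.subset_insert _ _))) x hx2 hxF2
        rcases hmem2 z hz hxz with hzn | rfl
        · exact ex2 z hzn hxz hzc
        · have := neg_of_mul_pos_left hxz hs21.le
          rw [← hsx] at this
          linarith
    · obtain ⟨y, hy, hxy, hyc⟩ := hP _ hF2 (by omega) hc x hx2 hxF2
      rcases hmem2 y hy hxy with hyn | rfl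
      · exact ex2 y hyn hxy hyc
      · have hxneg := hsx.2 (neg_of_mul_pos_left hxy hs21.le)
        obtain ⟨z, hz, hxz, hzc⟩ := hP _ hF1 hFcard
          (hyc.mono (Finset.insert_subset_insert _ (Finset.subset_insert _ _))) x hx2 hxF
        rcases hmem1 z hz hxz with hzn | rfl
        · exact ex1 z hzn hxz hzc
        · have := pos_of_mul_pos_left hxz hs12.le
          linarith
  · exact absurd (Finset.mem_insert_self _ _) h2F
  · exact absurd (Finset.mem_insert_self _ _) h2F

/-- A facet with neither of the last two labels is crossed in the contraction and lifted, one with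
both is crossed in the link. With exactly one, the lift from the contraction may contain the other
label; then `G ∪ {n + 1, n + 2}` is compatible and is the neighbour sought, or else
`eq_of_compat_insert` gives a contradiction. What remains are sides containing none of the labels
`1, …, n`. -/
theorem facetExtension_of_contr_of_lnk (ht : StrictMono t)
    (hRs : R ⊆ separatedTuples (d + 1) (n + 2)) (hR : NonIntertwining R)
    (hmax : Saturated (n + 2) R)
    (hlift : ∀ ρ ⊆ Finset.Icc 1 n, Compat (_root_.contr n R) (insert (n + 1) ρ) →
      Compat R (insert (n + 1) ρ) ∨ Compat R (insert (n + 2) ρ))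
    (hC : FacetExtension t (n + 1) (_root_.contr n R))
    (hL : FacetExtension t n (_root_.lnk n R)) : FacetExtension t (n + 2) R := by
  intro F hF hFcard hFc x hx hxF
  obtain ⟨G, hG, hFG⟩ := exists_decomposition hF
  have h1 : n + 1 ∉ G := notMem_of_subset_Icc hG (by omega)
  have h2 : n + 2 ∉ G := notMem_of_subset_Icc hG (by omega)
  have hG1 : G ⊆ Finset.Icc 1 (n + 1) := hG.trans (Finset.Icc_subset_Icc_right (by omega))
  have hF1 : insert (n + 1) G ⊆ Finset.Icc 1 (n + 1) := Finset.insert_subset (by simp) hG1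
  have hGlt : ∀ f ∈ G, f ≤ n := fun f hf => (Finset.mem_Icc.1 (hG hf)).2
  have hIcc : ∀ {y}, y ∈ Finset.Icc 1 n → y ∈ Finset.Icc 1 (n + 2) := fun hy =>
    Finset.Icc_subset_Icc_right (by omega) hy
  have hs12 : 0 < side t (insert (n + 1) G) (n + 2) := side_pos_of_forall_lt ht fun f hf => by
    rcases Finset.mem_insert.1 hf with rfl | hf
    · omega
    · have := hGlt f hf; omega
  have hs21 : side t (insert (n + 2) G) (n + 1) < 0 := by
    rw [side_insert_neg ht h2 (by omega)]
    exact side_pos_of_forall_lt ht fun f hf => by have := hGlt f hf; omega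
  have hside : ∀ x ≤ n, ∀ y ≤ n, (0 < side t (insert (n + 1) G) x * side t (insert (n + 1) G) y ↔
      0 < side t (insert (n + 2) G) x * side t (insert (n + 2) G) y) := fun x hx y hy => by
    rw [side_insert_mul_pos ht h1 (by omega) (by omega),
      side_insert_mul_pos ht h2 (by omega) (by omega)]
  have hneg : ∀ x ≤ n, (side t (insert (n + 1) G) x < 0 ↔ side t (insert (n + 2) G) x < 0) :=
    fun x hx => by rw [side_insert_neg ht h1 (by omega), side_insert_neg ht h2 (by omega)]
  have hpos : ∀ x ≤ n, (0 < side t (insert (n + 1) G) x ↔ 0 < side t (insert (n + 2) G) x) :=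
    fun x hx => by rw [side_insert_pos ht h1 (by omega), side_insert_pos ht h2 (by omega)]
  -- crossing a facet containing just one of the two last labels
  have hcross : G.card + 1 = 2 * (d + 1) → Compat (_root_.contr n R) (insert (n + 1) G) →
      ∀ x ∈ Finset.Icc 1 n, x ∉ G → ∃ y ∈ Finset.Icc 1 n, y ∉ G ∧
        0 < side t (insert (n + 1) G) x * side t (insert (n + 1) G) y ∧
        (Compat R (insert (n + 1) (insert y G)) ∨ Compat R (insert (n + 2) (insert y G))) := by
    intro hcard hc x hx hxG
    have hxn := Finset.mem_Icc.1 hx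
    obtain ⟨y, hy, hxy, hyc⟩ := hC _ hF1 (by rw [Finset.card_insert_of_notMem h1, hcard]) hc x
      (Finset.Icc_subset_Icc_right (by omega) hx)
      (by simp only [Finset.mem_insert, hxG, or_false]; omega)
    have hyF : y ∉ insert (n + 1) G := fun h => by simp [(side_eq_zero_iff ht).2 h] at hxy
    simp only [Finset.mem_insert, not_or] at hyF
    have hy' := Finset.mem_Icc.1 hy
    have hyn : y ∈ Finset.Icc 1 n := Finset.mem_Icc.2 ⟨hy'.1, by omega⟩
    rw [Finset.insert_comm] at hyc
    exact ⟨y, hyn, hyF.2, hxy, hlift _ (Finset.insert_subset hyn hG) hyc⟩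
  rcases hFG with rfl | rfl | rfl | rfl
  · have hp1 : 0 < side t F (n + 1) := side_pos_of_forall_lt ht fun f hf => by
      have := hGlt f hf; omega
    have hp2 : 0 < side t F (n + 2) := side_pos_of_forall_lt ht fun f hf => by
      have := hGlt f hf; omega
    obtain ⟨x', hx', hx'F, hxx'⟩ : ∃ x' ∈ Finset.Icc 1 (n + 1), x' ∉ F ∧
        ∀ y, 0 < side t F x' * side t F y → 0 < side t F x * side t F y := by
      have hxn := Finset.mem_Icc.1 hx
      by_cases h : x ≤ n + 1
      · exact ⟨x, Finset.mem_Icc.2 ⟨hxn.1, h⟩, hxF, fun y h => h⟩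
      · obtain rfl : x = n + 2 := by omega
        exact ⟨n + 1, by simp, h1, fun y h => mul_pos hp2 (pos_of_mul_pos_right h hp1.le)⟩
    obtain ⟨y, hy, hxy, hyc⟩ := hC F hG1 hFcard (hFc.contr hRs hG1) x' hx' hx'F
    have hyn := Finset.mem_Icc.1 hy
    by_cases hy2 : y ≤ n
    · have hy1 : y ∈ Finset.Icc 1 n := Finset.mem_Icc.2 ⟨hyn.1, hy2⟩
      exact ⟨y, hIcc hy1, hxx' y hxy, hyc.of_contr (Finset.insert_subset hy1 hG)⟩
    · obtain rfl : y = n + 1 := by omega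
      rcases hlift F hG hyc with h | h
      · exact ⟨n + 1, by simp, hxx' _ hxy, h⟩
      · refine ⟨n + 2, by simp, hxx' _ ?_, h⟩
        exact mul_pos (pos_of_mul_pos_left hxy hp1.le) hp2
  · have hcard : G.card + 1 = 2 * (d + 1) := by rw [← hFcard, Finset.card_insert_of_notMem h1]
    have hFC := hFc.contr hRs hF1
    have key : ∀ x ∈ Finset.Icc 1 n, x ∉ G → ∃ y ∈ Finset.Icc 1 (n + 2),
        0 < side t (insert (n + 1) G) x * side t (insert (n + 1) G) y ∧
          Compat R (insert y (insert (n + 1) G)) := by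
      intro x hx hxG
      obtain ⟨y, hy, hyG, hxy, h | h⟩ := hcross hcard hFC x hx hxG
      · exact ⟨y, hIcc hy, hxy, by rwa [Finset.insert_comm]⟩
      have hxn := (Finset.mem_Icc.1 hx).2
      have hyn := (Finset.mem_Icc.1 hy).2
      have hx0 : side t (insert (n + 1) G) x ≠ 0 := left_ne_zero_of_mul hxy.ne'
      have hJ := hFc.union (h.mono (Finset.insert_subset_insert _ (Finset.subset_insert _ _)))
      rcases hx0.lt_or_gt with hlt | hgt
      · exfalso
        have hyneg : side t (insert (n + 1) G) y < 0 := neg_of_mul_pos_right hxy hlt.le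
        rw [Finset.insert_comm] at h hJ
        have := eq_of_compat_insert ht hR (F := insert (n + 2) G) (x := y) (y := n + 1)
          (by rw [Finset.card_insert_of_notMem h2, hcard])
          (mul_pos_of_neg_of_neg ((hneg y hyn).1 hyneg) hs21) h hJ
        omega
      · exact ⟨n + 2, by simp, mul_pos hgt hs12, hJ⟩
    have hxn := Finset.mem_Icc.1 hx
    simp only [Finset.mem_insert, not_or] at hxF
    by_cases hxn' : x ≤ n
    · exact key x (Finset.mem_Icc.2 ⟨hxn.1, hxn'⟩) hxF.2
    obtain rfl : x = n + 2 := by omega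
    by_cases hex : ∃ x ∈ Finset.Icc 1 n, x ∉ G ∧ 0 < side t (insert (n + 1) G) x
    · obtain ⟨x, hx, hxG, hxs⟩ := hex
      obtain ⟨y, hy, hxy, hyc⟩ := key x hx hxG
      exact ⟨y, hy, mul_pos hs12 (pos_of_mul_pos_right hxy hxs.le), hyc⟩
    push Not at hex
    -- No label up to `n` is above the facet, so by `exists_side_pos` a gapped tuple using `n + 2`
    -- starts at `1`. A tuple with both extreme labels takes part in no intertwining pair, and
    -- saturation puts it in `R`.
    refine ⟨n + 2, hx, mul_pos hs12 hs12, hFc.union fun X hX hXF => ?_⟩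
    by_cases hXG : ∀ i, X i ∈ G
    · exact hFc X hX fun i => Finset.mem_insert_of_mem (hXG i)
    have hXlt : ∀ i : Fin (d + 1), X i.castSucc + 2 ≤ n + 2 := fun i => by
      have h3 := hX i
      rcases Finset.mem_insert.1 (hXF i.succ) with h4 | h4
      · omega
      · have := hGlt _ h4; omega
    have hno : ∀ z, 1 ≤ z → z ≤ n + 1 → ¬ 0 < side t (insert (n + 2) G) z := by
      intro z hz1 hz2 hz
      have hzn : z ≤ n := by
        by_contra h
        obtain rfl : z = n + 1 := by omega
        linarith
      have hzG : z ∉ G := fun h => by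
        rw [(side_eq_zero_iff ht).2 (Finset.mem_insert_of_mem h)] at hz
        exact lt_irrefl _ hz
      have := hex z (Finset.mem_Icc.2 ⟨hz1, hzn⟩) hzG
      rw [← hpos z hzn] at hz
      linarith
    have hX1 : ∀ i, 1 ≤ X i := fun i => by
      rcases Finset.mem_insert.1 (hXF i) with h4 | h4
      · omega
      · exact (Finset.mem_Icc.1 (hG h4)).1
    have hX0 : X 0 = 1 := by
      by_contra h
      have h0 := hX1 0
      have h00 := hXlt 0
      rcases exists_side_pos ht (by rw [Finset.card_insert_of_notMem h2, hcard]) hX hXF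
        (by omega) with h3 | ⟨i, h3⟩
      · simp only [Fin.castSucc_zero] at h00
        exact hno _ (by omega) (by omega) h3
      · exact hno _ (by omega) (by have := hXlt i; omega) h3
    obtain ⟨A, rfl, hA1, hA2, hA3⟩ := eq_extend_of_exists hG (by omega) hX hXF hXG
    refine hmax _ (mem_separatedTuples.2 ⟨fun i => Finset.mem_Icc.2 ⟨hX1 i, ?_⟩, hX⟩) fun E hE => ?_
    · have := hX.le_last i
      rwa [extend_last] at this
    · have hE' := (mem_separatedTuples.1 (hRs hE)).1
      refine ⟨fun h => ?_, fun h => ?_⟩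
      · have h3 := h.1 (Fin.last (d + 1))
        rw [extend_last] at h3
        have := (Finset.mem_Icc.1 (hE' (Fin.last (d + 1)))).2
        omega
      · have h3 := h.1 0
        have := (Finset.mem_Icc.1 (hE' 0)).1
        omega
  · have hcard : G.card + 1 = 2 * (d + 1) := by rw [← hFcard, Finset.card_insert_of_notMem h2]
    have hFC := hFc.contr' hRs hG
    have key : ∀ x ∈ Finset.Icc 1 n, x ∉ G → ∃ y ∈ Finset.Icc 1 (n + 2),
        0 < side t (insert (n + 2) G) x * side t (insert (n + 2) G) y ∧
          Compat R (insert y (insert (n + 2) G)) := by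
      intro x hx hxG
      obtain ⟨y, hy, hyG, hxy, h | h⟩ := hcross hcard hFC x hx hxG
      · have hxn := (Finset.mem_Icc.1 hx).2
        have hyn := (Finset.mem_Icc.1 hy).2
        have hx0 : side t (insert (n + 1) G) x ≠ 0 := left_ne_zero_of_mul hxy.ne'
        have hJ := Compat.union
          (h.mono (Finset.insert_subset_insert _ (Finset.subset_insert _ _))) hFc
        rcases hx0.lt_or_gt with hlt | hgt
        · refine ⟨n + 1, by simp, mul_pos_of_neg_of_neg ((hneg x hxn).1 hlt) hs21, ?_⟩
          rwa [Finset.insert_comm]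
        · exfalso
          have hypos : 0 < side t (insert (n + 1) G) y := pos_of_mul_pos_right hxy hgt.le
          rw [Finset.insert_comm] at h
          have := eq_of_compat_insert ht hR (F := insert (n + 1) G) (x := y) (y := n + 2)
            (by rw [Finset.card_insert_of_notMem h1, hcard]) (mul_pos hypos hs12) h hJ
          omega
      · refine ⟨y, hIcc hy, ?_, by rwa [Finset.insert_comm]⟩
        exact (hside x (Finset.mem_Icc.1 hx).2 y (Finset.mem_Icc.1 hy).2).1 hxy
    have hxn := Finset.mem_Icc.1 hx
    simp only [Finset.mem_insert, not_or] at hxF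
    by_cases hxn' : x ≤ n
    · exact key x (Finset.mem_Icc.2 ⟨hxn.1, hxn'⟩) hxF.2
    obtain rfl : x = n + 1 := by omega
    by_cases hex : ∃ x ∈ Finset.Icc 1 n, x ∉ G ∧ side t (insert (n + 2) G) x < 0
    · obtain ⟨x, hx, hxG, hxs⟩ := hex
      obtain ⟨y, hy, hxy, hyc⟩ := key x hx hxG
      exact ⟨y, hy, mul_pos_of_neg_of_neg hs21 (neg_of_mul_pos_right hxy hxs.le), hyc⟩
    push Not at hex
    -- No label up to `n` is below the facet, but by `exists_side_neg` a gapped tuple in `G ∪ {n +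
    -- 1}` would force one. So there is no such tuple to check.
    refine ⟨n + 1, hx, mul_pos_of_neg_of_neg hs21 hs21, ?_⟩
    rw [Finset.insert_comm]
    refine Compat.union (fun X hX hXF => ?_) hFc
    exfalso
    obtain ⟨i, hi⟩ := exists_side_neg ht (by rw [Finset.card_insert_of_notMem h1, hcard]) hX hXF
    have h3 := hX i
    have h4 := (Finset.mem_Icc.1 (hF1 (hXF i.succ))).2
    have hzG : X i.castSucc + 1 ∉ G := fun h => by
      rw [(side_eq_zero_iff ht).2 (Finset.mem_insert_of_mem h)] at hi
      exact lt_irrefl _ hi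
    have := hex (X i.castSucc + 1) (Finset.mem_Icc.2 ⟨by omega, by omega⟩) hzG
    rw [hneg _ (by omega)] at hi
    linarith
  · have h2' : n + 2 ∉ insert (n + 1) G := by simp [h2]
    have hGcard : G.card = 2 * d := by
      rw [Finset.card_insert_of_notMem h2', Finset.card_insert_of_notMem h1] at hFcard
      omega
    simp only [Finset.mem_insert, not_or] at hxF
    have hxn := Finset.mem_Icc.1 hx
    obtain ⟨y, hy, hxy, hyc⟩ := hL G hG hGcard (hFc.lnk hG) x
      (Finset.mem_Icc.2 ⟨hxn.1, by omega⟩) hxF.2.2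
    have hyn := (Finset.mem_Icc.1 hy).2
    refine ⟨y, hIcc hy, ?_, ?_⟩
    · rwa [side_insert_mul_pos ht h2' (by omega) (by omega),
        side_insert_mul_pos ht h1 (by omega) (by omega)]
    · rw [Finset.insert_comm y, Finset.insert_comm y]
      exact Compat.of_lnk hRs hR hmax (Finset.insert_subset hy hG) hyc

end Step

/-! ### Maximal size characterises triangulations -/

section Counting

variable {d : ℕ} {t : ℕ → ℝ}

theorem not_intertwines_self (A : Fin (d + 1) → ℕ) : ¬ Intertwines A A := fun h =>
  lt_irrefl _ (h.1 0)

theorem NonIntertwining.insert {R : Set (Fin (d + 1) → ℕ)} (hR : NonIntertwining R)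
    {A : Fin (d + 1) → ℕ} (hA : ∀ C ∈ R, ¬ Intertwines A C ∧ ¬ Intertwines C A) :
    NonIntertwining (insert A R) := by
  rintro X (rfl | hX) Y (rfl | hY)
  · exact not_intertwines_self _
  · exact (hA Y hY).1
  · exact (hA X hX).2
  · exact hR X hX Y hY

theorem NonIntertwining.mono {R R' : Set (Fin (d + 1) → ℕ)} (hR : NonIntertwining R)
    (h : R' ⊆ R) : NonIntertwining R' := fun X hX Y hY => hR X (h hX) Y (h hY)

theorem saturated_of_ncard {m : ℕ} {R : Set (Fin (d + 1) → ℕ)} (hRs : R ⊆ separatedTuples d m)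
    (hR : NonIntertwining R) (hcard : R.ncard = (m - d - 1).choose d) : Saturated m R := by
  intro A hA h
  by_contra hAR
  have h1 := (hR.insert h).ncard_le d m (Set.insert_subset hA hRs)
  rw [Set.ncard_insert_of_notMem hAR ((finite_separatedTuples d m).subset hRs)] at h1
  omega

theorem compat_image_of_mem {R : Set (Fin (d + 1) → ℕ)} {A : Fin (d + 1) → ℕ} (hA : StrictMono A)
    (hAR : A ∈ R) : Compat R (Finset.univ.image A) := by
  intro C hC hCA
  rw [eq_of_forall_mem_range hC.strictMono hA fun i => by simpa using hCA i]
  exact hAR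

/-- A separated tuple crossing nothing in `R` may be added to `R`. Compatibility with the larger set
already makes its labels a face of a covering simplex, and that simplex is compatible with `R`
itself. -/
theorem Covers.saturated (ht : StrictMono t) {m : ℕ} {R : Set (Fin (d + 1) → ℕ)}
    (hR : NonIntertwining R) (hcov : Covers t m R) : Saturated m R := by
  intro A hA h
  rw [mem_separatedTuples] at hA
  obtain ⟨σ, -, -, hσ, hAσ⟩ := hcov.exists_superset ht (Set.subset_insert A R) (hR.insert h)
    (F := Finset.univ.image A) (fun x hx => by
      obtain ⟨i, -, rfl⟩ := Finset.mem_image.1 hx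
      exact hA.1 i) (compat_image_of_mem hA.2.strictMono (Set.mem_insert _ _))
  exact hσ A hA.2 fun i => hAσ (Finset.mem_image_of_mem _ (Finset.mem_univ i))

theorem FacetExtension.nonempty {m : ℕ} (hm : 2 * d + 1 ≤ m) {R : Set (Fin (d + 1) → ℕ)}
    (hP : FacetExtension t m R) : R.Nonempty := by
  obtain ⟨y, hy, hyn, hc⟩ := hP.exists_simplex hm
  rw [Finset.mem_Icc] at hy hyn
  -- The tuple `1, 3, …, 2 d - 1, y` of the first simplex, where `y > 2 d`.
  refine ⟨fun i => if (i : ℕ) < d then 2 * i + 1 else y, hc _ (fun i => ?_) fun i => ?_⟩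
  · simp only [Fin.val_castSucc, i.2, if_true, Fin.val_succ]
    split_ifs <;> omega
  · split_ifs with h
    · exact Finset.mem_insert_of_mem (Finset.mem_Icc.2 ⟨by omega, by omega⟩)
    · exact Finset.mem_insert_self _ _

theorem ncard_eq_one_of_facetExtension {m : ℕ} (hm : 2 * d + 1 ≤ m) {R : Set (Fin (d + 1) → ℕ)}
    (hRs : R ⊆ separatedTuples d m) (hR : NonIntertwining R) (h1 : (m - d - 1).choose d = 1)
    (hP : FacetExtension t m R) : R.ncard = 1 := by
  have h2 := hR.ncard_le d m hRs
  have h3 := (Set.ncard_pos ((finite_separatedTuples d m).subset hRs)).2 (hP.nonempty hm)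
  omega

theorem separatedTuples_subsingleton (d : ℕ) :
    (separatedTuples d (2 * d + 1)).Subsingleton := by
  have key : ∀ X ∈ separatedTuples d (2 * d + 1), ∀ i, X i = 2 * i + 1 := fun X hX i => by
    rw [mem_separatedTuples] at hX
    have h1 := hX.2.add_le i
    have h2 := hX.2.le_sub i
    have h3 := Finset.mem_Icc.1 (hX.1 0)
    have h4 := Finset.mem_Icc.1 (hX.1 (Fin.last d))
    omega
  intro X hX Y hY
  ext i
  rw [key X hX, key Y hY]

/-- A non-intertwining set of separated tuples has the maximal size exactly if its compatible
simplices form a triangulation. -/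
theorem facetExtension_iff_ncard (ht : StrictMono t) (d m : ℕ) (hm : 2 * d + 1 ≤ m)
    {R : Set (Fin (d + 1) → ℕ)} (hRs : R ⊆ separatedTuples d m) (hR : NonIntertwining R) :
    FacetExtension t m R ↔ R.ncard = (m - d - 1).choose d := by
  induction d generalizing m with
  | zero =>
    rw [Nat.choose_zero_right]
    refine ⟨ncard_eq_one_of_facetExtension hm hRs hR (Nat.choose_zero_right _), fun h => ?_⟩
    obtain ⟨A, rfl⟩ := Set.ncard_eq_one.1 h
    have hA := mem_separatedTuples.1 (hRs rfl)
    intro F hF hFcard _ x hx _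
    obtain rfl : F = ∅ := Finset.card_eq_zero.1 (by omega)
    refine ⟨A 0, hA.1 0, by simp [side], fun C _ hC => ?_⟩
    rw [Set.mem_singleton_iff]
    ext i
    rw [Subsingleton.elim (α := Fin 1) i 0]
    simpa using hC 0
  | succ d ihd =>
    induction m, hm using Nat.le_induction generalizing R with
    | base =>
      have h1 : (2 * (d + 1) + 1 - (d + 1) - 1).choose (d + 1) = 1 := by
        rw [show 2 * (d + 1) + 1 - (d + 1) - 1 = d + 1 by omega, Nat.choose_self]
      rw [h1]
      refine ⟨ncard_eq_one_of_facetExtension le_rfl hRs hR h1, fun h => ?_⟩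
      obtain ⟨A, rfl⟩ := Set.ncard_eq_one.1 h
      intro F hF hFcard _ x hx hxF
      have hx0 : side t F x ≠ 0 := fun h => hxF ((side_eq_zero_iff ht).1 h)
      refine ⟨x, hx, mul_self_pos.2 hx0, fun C hC hCF => ?_⟩
      refine separatedTuples_subsingleton _ (mem_separatedTuples.2 ⟨fun i => ?_, hC⟩) (hRs rfl)
      exact Finset.insert_subset hx hF (hCF i)
    | succ m hm ihm =>
      obtain ⟨n, rfl⟩ : ∃ n, m = n + 1 := ⟨m - 1, by omega⟩
      rw [show n + 1 + 1 = n + 2 from rfl]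
      have hCs := contr_subset n R
      have hC := contr_nonIntertwining (n := n) hR
      have hLs := lnk_subset (n := n) hRs
      have hL := lnk_nonIntertwining (n := n) hRs hR
      have bC := hC.ncard_le _ _ hCs
      have bL := hL.ncard_le _ _ hLs
      have hcount := ncard_eq_contr_add_lnk (n := n) hRs
      have hstep := choose_step n d (by omega)
      -- By `hcount` and `hstep` the bounds `bC` and `bL` add up to the bound for `R`, so `R` is of
      -- maximal size exactly when contraction and link both are. Saturation comes from covering in
      -- one direction and from maximality in the other.
      constructor
      · intro hP
        have hmax := (hP.covers ht (by omega)).saturated ht hR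
        have hPL := hP.lnk ht hRs hR hmax
        have hlift : ∀ ρ ⊆ Finset.Icc 1 n, Compat (contr n R) (insert (n + 1) ρ) →
            Compat R (insert (n + 1) ρ) ∨ Compat R (insert (n + 2) ρ) := fun ρ hρ h =>
          h.lift_contr ht hRs hR hmax (hPL.covers ht (by omega)) hρ
        have hPC := hP.contr ht hRs hlift
        have h1 := (ihd n (by omega) hLs hL).1 hPL
        have h2 := (ihm hCs hC).1 hPC
        omega
      · intro hcard
        have hmax := saturated_of_ncard hRs hR hcard
        have hPL := (ihd n (by omega) hLs hL).2 (by omega)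
        have hPC := (ihm hCs hC).2 (by omega)
        exact facetExtension_of_contr_of_lnk ht hRs hR hmax (fun ρ hρ h =>
          h.lift_contr ht hRs hR hmax (hPL.covers ht (by omega)) hρ) hPC hPL

end Counting

/-! ### Placing triangulations and the exchange of an intertwining pair -/

section Exchange

open Filter Topology

variable {d : ℕ} {t : ℕ → ℝ}

/-- The sequence `X 0, Y 0, X 1, Y 1, …`. -/
def interleave (X Y : Fin (d + 1) → ℕ) (j : ℕ) : ℕ :=
  if h : j / 2 < d + 1 then (if j % 2 = 0 then X ⟨j / 2, h⟩ else Y ⟨j / 2, h⟩) else 0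

theorem interleave_even (X Y : Fin (d + 1) → ℕ) (i : Fin (d + 1)) :
    interleave X Y (2 * i) = X i := by
  simp [interleave, show (i : ℕ) ≤ d by omega]

theorem interleave_odd (X Y : Fin (d + 1) → ℕ) (i : Fin (d + 1)) :
    interleave X Y (2 * i + 1) = Y i := by
  have h1 : (2 * (i : ℕ) + 1) / 2 = i := by omega
  have h2 : (2 * (i : ℕ) + 1) % 2 = 1 := by omega
  simp [interleave, h1, h2, show (i : ℕ) ≤ d by omega]

theorem interleave_cases (X Y : Fin (d + 1) → ℕ) {j : ℕ} (hj : j < 2 * d + 2) :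
    (∃ i : Fin (d + 1), j = 2 * i ∧ interleave X Y j = X i) ∨
      ∃ i : Fin (d + 1), j = 2 * i + 1 ∧ interleave X Y j = Y i := by
  rcases Nat.even_or_odd' j with ⟨k, rfl | rfl⟩
  · exact Or.inl ⟨⟨k, by omega⟩, rfl, interleave_even X Y ⟨k, by omega⟩⟩
  · exact Or.inr ⟨⟨k, by omega⟩, rfl, interleave_odd X Y ⟨k, by omega⟩⟩

theorem interleave_lt {X Y : Fin (d + 1) → ℕ} (h : Intertwines X Y) (j : ℕ) (hj : j < 2 * d + 1) :
    interleave X Y j < interleave X Y (j + 1) := by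
  rcases interleave_cases X Y (show j < 2 * d + 2 by omega) with ⟨i, rfl, h1⟩ | ⟨i, rfl, h1⟩
  · rw [h1, interleave_odd]
    exact h.1 i
  · have := interleave_even X Y ⟨i + 1, by omega⟩
    simp only [mul_add, mul_one] at this
    rw [h1, show 2 * (i : ℕ) + 1 + 1 = 2 * i + 2 by ring, this]
    exact h.2 ⟨i, by omega⟩

theorem strictMono_interleave {X Y : Fin (d + 1) → ℕ} (h : Intertwines X Y) :
    StrictMono fun j : Fin (2 * d + 1 + 1) => interleave X Y j :=
  Fin.strictMono_iff_lt_succ.2 fun i => by simpa using interleave_lt h i i.2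

theorem Intertwines.ne {X Y : Fin (d + 1) → ℕ} (h : Intertwines X Y) (i j : Fin (d + 1)) :
    X i ≠ Y j := fun hij => by
  have := (strictMono_interleave h).injective (a₁ := ⟨2 * i, by omega⟩)
    (a₂ := ⟨2 * j + 1, by omega⟩)
    (by simpa only [interleave_even, interleave_odd] using hij)
  simp only [Fin.mk.injEq] at this
  omega

/-- The union of `A` and `B` has `2 d + 2` labels, and an intertwining pair inside it lists all of
them in increasing order. -/
theorem Intertwines.eq_of_subset {X Y A B : Fin (d + 1) → ℕ} (h : Intertwines X Y)
    (hAB : Intertwines A B) (hX : ∀ i, X i ∈ Set.range A ∪ Set.range B)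
    (hY : ∀ i, Y i ∈ Set.range A ∪ Set.range B) : X = A ∧ Y = B := by
  have key : ∀ z ∈ Set.range A ∪ Set.range B,
      ∃ j : Fin (2 * d + 1 + 1), interleave A B j = z := by
    rintro z (⟨i, rfl⟩ | ⟨i, rfl⟩)
    · exact ⟨⟨2 * i, by omega⟩, interleave_even A B i⟩
    · exact ⟨⟨2 * i + 1, by omega⟩, interleave_odd A B i⟩
  have heq := eq_of_forall_mem_range (strictMono_interleave h) (strictMono_interleave hAB)
    fun j => by
      rcases interleave_cases X Y (show (j : ℕ) < 2 * d + 2 by omega) with ⟨i, -, h1⟩ | ⟨i, -, h1⟩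
      · rw [h1]; exact key _ (hX i)
      · rw [h1]; exact key _ (hY i)
  constructor
  · ext i
    have := congrFun heq ⟨2 * i, by omega⟩
    simpa only [interleave_even] using this
  · ext i
    have := congrFun heq ⟨2 * i + 1, by omega⟩
    simpa only [interleave_odd] using this

/-- The affine dependence between two intertwining tuples. -/
theorem exists_circuit_of_intertwines (ht : StrictMono t) {N D : Fin (d + 1) → ℕ}
    (h : Intertwines N D ∨ Intertwines D N) :
    ∃ c : ℕ → ℝ, (∀ i, c (N i) < 0) ∧ (∀ i, 0 < c (D i)) ∧
      (∀ z, (∀ i, z ≠ N i) → (∀ i, z ≠ D i) → c z = 0) ∧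
      ∀ V : Finset ℕ, (∀ i, N i ∈ V) → (∀ i, D i ∈ V) →
        ∀ k < 2 * d + 1, ∑ x ∈ V, c x * t x ^ k = 0 := by
  have key : ∀ {X Y : Fin (d + 1) → ℕ}, Intertwines X Y →
      ∃ c : ℕ → ℝ, (∀ i, c (X i) < 0) ∧ (∀ i, 0 < c (Y i)) ∧
      (∀ z, (∀ i, z ≠ X i) → (∀ i, z ≠ Y i) → c z = 0) ∧
      ∀ V : Finset ℕ, (∀ i, X i ∈ V) → (∀ i, Y i ∈ V) →
        ∀ k < 2 * d + 1, ∑ x ∈ V, c x * t x ^ k = 0 := by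
    intro X Y h
    obtain ⟨c, h1, h2, h3⟩ := exists_circuit ht (2 * d + 1) (interleave X Y) (interleave_lt h)
    refine ⟨c, fun i => ?_, fun i => ?_, fun z hX hY => h1 z fun j hj => ?_, fun V hX hY =>
      (h3 V fun j hj => ?_).1⟩
    · have := h2 (2 * i) (by omega)
      rw [interleave_even, Odd.neg_one_pow ⟨d + i, by ring⟩] at this
      linarith
    · have := h2 (2 * i + 1) (by omega)
      rwa [interleave_odd, Even.neg_one_pow ⟨d + i + 1, by ring⟩, one_mul] at this
    · rcases interleave_cases X Y (show j < 2 * d + 2 by omega) with ⟨i, -, h4⟩ | ⟨i, -, h4⟩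
      · rw [h4]; exact hX i
      · rw [h4]; exact hY i
    · rcases interleave_cases X Y (show j < 2 * d + 2 by omega) with ⟨i, -, h4⟩ | ⟨i, -, h4⟩
      · rw [h4]; exact hX i
      · rw [h4]; exact hY i
  rcases h with h | h
  · exact key h
  · obtain ⟨c, h1, h2, h3, h4⟩ := key h
    refine ⟨fun x => -c x, fun i => by linarith [h2 i], fun i => by linarith [h1 i],
      fun z hN hD => by simp [h3 z hD hN], fun V hN hD k hk => ?_⟩
    simp [Finset.sum_neg_distrib, h4 V hD hN k hk]

/-- For small `ε` the term with the smallest exponent dominates. -/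
theorem eventually_sum_mul_pow_neg (V : Finset ℕ) (c : ℕ → ℝ) (e : ℕ → ℕ) (k : ℕ) (hk : k ∈ V)
    (hck : c k < 0) (h : ∀ x ∈ V, x ≠ k → c x ≠ 0 → e k < e x) :
    ∀ᶠ ε in 𝓝[>] (0 : ℝ), ∑ x ∈ V, c x * ε ^ e x < 0 := by
  have hcont : Continuous fun ε : ℝ => ∑ x ∈ V, c x * ε ^ (e x - e k) := by fun_prop
  have h0 : ∑ x ∈ V, c x * (0 : ℝ) ^ (e x - e k) = c k := by
    rw [Finset.sum_eq_single k]
    · simp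
    · intro x hx hxk
      by_cases hcx : c x = 0
      · simp [hcx]
      · have := h x hx hxk hcx
        rw [zero_pow (by omega), mul_zero]
    · exact fun h => absurd hk h
  have ht := (hcont.tendsto 0).eventually (gt_mem_nhds (a := 0) (by rw [h0]; exact hck))
  filter_upwards [nhdsWithin_le_nhds ht, self_mem_nhdsWithin] with ε h1 h2
  have h2 : 0 < ε := h2
  have : ∑ x ∈ V, c x * ε ^ e x = ε ^ e k * ∑ x ∈ V, c x * ε ^ (e x - e k) := by
    rw [Finset.mul_sum]
    refine Finset.sum_congr rfl fun x hx => ?_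
    by_cases hcx : c x = 0
    · simp [hcx]
    · have hle : e k ≤ e x := by
        by_cases hxk : x = k
        · rw [hxk]
        · exact (h x hx hxk hcx).le
      rw [← Nat.add_sub_cancel' hle, pow_add]
      simp only [Nat.add_sub_cancel' hle]
      ring
  rw [this]
  exact mul_neg_of_pos_of_neg (pow_pos h2 _) h1

/-- The separated tuples that contain no label of lowest rank in a circuit. -/
def placing (m : ℕ) (e : ℕ → ℕ) : Set (Fin (d + 1) → ℕ) :=
  {N | N ∈ separatedTuples d m ∧ ∀ D : Fin (d + 1) → ℕ, (∀ i, D i ∈ Finset.Icc 1 m) →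
    (Intertwines N D ∨ Intertwines D N) → ∃ j, ∀ i, e (D j) < e (N i)}

theorem placing_nonIntertwining (m : ℕ) (e : ℕ → ℕ) :
    NonIntertwining (placing (d := d) m e) := by
  intro X hX Y hY h
  obtain ⟨j, hj⟩ := hX.2 Y (mem_separatedTuples.1 hY.1).1 (Or.inl h)
  obtain ⟨k, hk⟩ := hY.2 X (mem_separatedTuples.1 hX.1).1 (Or.inr h)
  exact lt_asymm (hj k) (hk j)

/-- Placing the vertices in the order of their rank gives a triangulation. -/
theorem weaklyCovers_placing (ht : StrictMono t) {m : ℕ} (hm : 2 * d + 1 ≤ m) (e : ℕ → ℕ)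
    (he : Set.InjOn e (Finset.Icc 1 m)) : WeaklyCovers t m (placing (d := d) m e) := by
  classical
  intro μ hμ
  set V := Finset.Icc 1 m with hV
  have hfin : {p : (Fin (d + 1) → ℕ) × (Fin (d + 1) → ℕ) |
      (∀ i, p.1 i ∈ V) ∧ ∀ i, p.2 i ∈ V}.Finite := by
    refine ((Set.finite_Icc (fun _ : Fin (d + 1) => 1) (fun _ => m)).prod
      (Set.finite_Icc (fun _ : Fin (d + 1) => 1) (fun _ => m))).subset fun p hp => ?_
    have h1 := fun i => Finset.mem_Icc.1 (hp.1 i)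
    have h2 := fun i => Finset.mem_Icc.1 (hp.2 i)
    exact ⟨⟨fun i => (h1 i).1, fun i => (h1 i).2⟩, ⟨fun i => (h2 i).1, fun i => (h2 i).2⟩⟩
  -- One `ε` serves all pairs. Along the circuit that lowers the weights on `N` and raises those on
  -- `D`, the cost with coefficients `ε ^ e x` decreases whenever the label of lowest rank is in
  -- `N`.
  have hev : ∀ᶠ ε in 𝓝[>] (0 : ℝ), ∀ p ∈ {p : (Fin (d + 1) → ℕ) × (Fin (d + 1) → ℕ) |
      (∀ i, p.1 i ∈ V) ∧ ∀ i, p.2 i ∈ V}, (Intertwines p.1 p.2 ∨ Intertwines p.2 p.1) →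
      (¬ ∃ j, ∀ i, e (p.2 j) < e (p.1 i)) → ∃ c : ℕ → ℝ, (∀ x, c x < 0 → ∃ i, x = p.1 i) ∧
        (∀ x ∉ V, c x = 0) ∧
        (∀ k < 2 * d + 1, ∑ x ∈ V, c x * t x ^ k = 0) ∧ ∑ x ∈ V, c x * ε ^ e x < 0 := by
    rw [eventually_all_finite hfin]
    rintro ⟨N, D⟩ ⟨hN, hD⟩
    simp only at hN hD ⊢
    by_cases hcross : Intertwines N D ∨ Intertwines D N
    swap
    · exact Eventually.of_forall fun ε h => absurd h hcross
    by_cases hrank : ∃ j, ∀ i, e (D j) < e (N i)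
    · exact Eventually.of_forall fun ε _ h => absurd hrank h
    obtain ⟨c, hc1, hc2, hc3, hc4⟩ := exists_circuit_of_intertwines ht hcross
    obtain ⟨i0, -, hi0⟩ := Finset.exists_min_image Finset.univ (fun i => e (N i))
      Finset.univ_nonempty
    push Not at hrank
    have hdisj : ∀ i j, N i ≠ D j := fun i j => by
      rcases hcross with h | h
      · exact h.ne i j
      · exact (h.ne j i).symm
    have hlt : ∀ j, e (N i0) < e (D j) := fun j => by
      obtain ⟨i, hi⟩ := hrank j
      refine lt_of_le_of_ne ((hi0 i (Finset.mem_univ _)).trans hi) fun h => hdisj i0 j ?_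
      exact he (hN i0) (hD j) h
    filter_upwards [eventually_sum_mul_pow_neg V c e (N i0) (hN i0) (hc1 i0) fun x hx hne hcx => by
      by_cases h1 : ∃ i, x = N i
      · obtain ⟨i, rfl⟩ := h1
        exact lt_of_le_of_ne (hi0 i (Finset.mem_univ _)) fun h => hne (he (hN i) (hN i0) h.symm)
      by_cases h2 : ∃ i, x = D i
      · obtain ⟨i, rfl⟩ := h2
        exact hlt i
      · exact absurd (hc3 x (not_exists.1 h1) (not_exists.1 h2)) hcx] with ε hε _ _
    refine ⟨c, fun x hx => ?_, fun x hx => hc3 x ?_ ?_, hc4 V hN hD, hε⟩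
    · by_contra h1
      by_cases h2 : ∃ i, x = D i
      · obtain ⟨i, rfl⟩ := h2
        exact lt_asymm hx (hc2 i)
      · rw [hc3 x (not_exists.1 h1) (not_exists.1 h2)] at hx
        exact lt_irrefl _ hx
    · rintro i rfl; exact hx (hN i)
    · rintro i rfl; exact hx (hD i)
  obtain ⟨ε, hε⟩ := hev.exists
  -- The weights representing the same point as `μ`. A cost minimiser on this compact set has
  -- compatible support, since a forbidden tuple in the support could be lowered along its circuit.
  let W : Set (ℕ → ℝ) := {w | (∀ x, 0 ≤ w x) ∧ (∀ x ∉ V, w x = 0) ∧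
    ∀ k < 2 * d + 1, ∑ x ∈ V, w x * t x ^ k = ∑ x ∈ V, μ x * t x ^ k}
  have hWc : IsCompact W := by
    have hbig : IsCompact (Set.univ.pi fun _ : ℕ => Set.Icc (0 : ℝ) (∑ x ∈ V, μ x)) :=
      isCompact_univ_pi fun _ => isCompact_Icc
    refine hbig.of_isClosed_subset ?_ fun w hw x _ => ⟨hw.1 x, ?_⟩
    · have e1 : W = {w | ∀ x, 0 ≤ w x} ∩ ({w | ∀ x, x ∉ V → w x = 0} ∩ {w | ∀ k, k < 2 * d + 1 →
          ∑ x ∈ V, w x * t x ^ k = ∑ x ∈ V, μ x * t x ^ k}) := rfl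
      rw [e1]
      simp only [Set.ofPred_forall]
      refine (isClosed_iInter fun x => isClosed_le continuous_const (continuous_apply x)).inter
        ((isClosed_iInter fun x => isClosed_iInter fun _ => isClosed_eq (continuous_apply x)
          continuous_const).inter (isClosed_iInter fun k => isClosed_iInter fun _ =>
            isClosed_eq (by fun_prop) continuous_const))
    · have h0 : ∑ x ∈ V, w x = ∑ x ∈ V, μ x := by simpa using hw.2.2 0 (by omega)
      rw [← h0]
      by_cases hx : x ∈ V
      · exact Finset.single_le_sum (fun i _ => hw.1 i) hx
      · rw [hw.2.1 x hx]; exact Finset.sum_nonneg fun i _ => hw.1 i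
  have hWn : W.Nonempty := by
    refine ⟨fun x => if x ∈ V then μ x else 0, fun x => ?_, fun x hx => by simp [hx], fun k _ => ?_⟩
    · change 0 ≤ if x ∈ V then μ x else 0
      split_ifs; exacts [hμ x, le_rfl]
    · exact Finset.sum_congr rfl fun x hx => by simp [hx]
  obtain ⟨w, ⟨hw1, hw2, hw3⟩, hwmin⟩ := hWc.exists_isMinOn hWn
    (f := fun w => ∑ x ∈ V, w x * ε ^ e x) (by fun_prop)
  set G := V.filter fun x => w x ≠ 0 with hG
  have hGpos : ∀ x ∈ G, 0 < w x := fun x hx =>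
    lt_of_le_of_ne (hw1 x) (Ne.symm (Finset.mem_filter.1 hx).2)
  have hGV : G ⊆ V := Finset.filter_subset _ _
  have hGc : Compat (placing (d := d) m e) G := by
    intro N hN hNG
    refine ⟨mem_separatedTuples.2 ⟨fun i => hGV (hNG i), hN⟩, fun D hD hcross => ?_⟩
    by_contra hrank
    obtain ⟨c, hc1, hc2, hc3, hc4⟩ := hε (N, D) ⟨fun i => hGV (hNG i), hD⟩ hcross hrank
    have hη : ∀ᶠ η in 𝓝[>] (0 : ℝ), ∀ x ∈ V, 0 ≤ w x + η * c x := by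
      rw [eventually_all_finset]
      intro x hx
      rcases lt_or_ge (c x) 0 with h | h
      · obtain ⟨i, rfl⟩ := hc1 x h
        have hcont : Continuous fun η : ℝ => w (N i) + η * c (N i) := by fun_prop
        have := (hcont.tendsto 0).eventually (lt_mem_nhds (a := 0)
          (by simpa using hGpos _ (hNG i)))
        filter_upwards [nhdsWithin_le_nhds this] with η h
        exact h.le
      · filter_upwards [self_mem_nhdsWithin] with η hη
        have hη : 0 < η := hη
        exact add_nonneg (hw1 x) (mul_nonneg hη.le h)
    obtain ⟨η, hη1, hη2⟩ := (hη.and self_mem_nhdsWithin).exists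
    have hη2 : 0 < η := hη2
    have hmem : (fun x => w x + η * c x) ∈ W := by
      refine ⟨fun x => ?_, fun x hx => by simp [hw2 x hx, hc2 x hx], fun k hk => ?_⟩
      · by_cases hx : x ∈ V
        · exact hη1 x hx
        · simp [hw2 x hx, hc2 x hx]
      · have : ∑ x ∈ V, (w x + η * c x) * t x ^ k =
            ∑ x ∈ V, w x * t x ^ k + η * ∑ x ∈ V, c x * t x ^ k := by
          rw [Finset.mul_sum, ← Finset.sum_add_distrib]
          exact Finset.sum_congr rfl fun x _ => by ring
        rw [this, hw3 k hk, hc3 k hk, mul_zero, add_zero]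
    have h1 := isMinOn_iff.1 hwmin _ hmem
    have h2 : ∑ x ∈ V, (w x + η * c x) * ε ^ e x =
        ∑ x ∈ V, w x * ε ^ e x + η * ∑ x ∈ V, c x * ε ^ e x := by
      rw [Finset.mul_sum, ← Finset.sum_add_distrib]
      exact Finset.sum_congr rfl fun x _ => by ring
    rw [h2] at h1
    have := mul_neg_of_pos_of_neg hη2 hc4
    linarith
  -- The support may have fewer than `2 d + 1` labels and is then filled up arbitrarily, so only the
  -- weak form of covering results.
  have hGcard := hGc.card_le (placing_nonIntertwining m e)
  obtain ⟨σ, hGσ, hσV, hσcard⟩ := Finset.exists_subsuperset_card_eq hGV hGcard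
    (by rw [hV, Nat.card_Icc]; omega)
  have hco : ∀ i ∈ σ, coord t V σ μ i = w i := fun i hi =>
    coord_eq_of_moments ht hσV (fun x hx => by
      by_cases hxV : x ∈ V
      · by_contra hne
        exact hx (hGσ (Finset.mem_filter.2 ⟨hxV, hne⟩))
      · exact hw2 x hxV) (fun k hk => hw3 k (by omega)) hi
  refine ⟨σ, hσV, hσcard, fun i hi => by rw [hco i hi]; exact hw1 i, hGc.mono fun i hi => ?_⟩
  obtain ⟨h1, h2⟩ := Finset.mem_filter.1 hi
  rw [hco i h1] at h2
  exact Finset.mem_filter.2 ⟨hσV h1, h2⟩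

/-- The triangulation of the polytope of an intertwining pair that contains its first tuple extends
to a triangulation of the cyclic polytope. -/
theorem exists_facetExtension_of_intertwines (ht : StrictMono t) {m : ℕ} (hm : 2 * d + 1 ≤ m)
    {A B : Fin (d + 1) → ℕ} (hAB : Intertwines A B ∨ Intertwines B A) :
    ∃ R ⊆ separatedTuples d m, NonIntertwining R ∧ FacetExtension t m R ∧
      ∀ C ∈ separatedTuples d m, (∀ i, C i ∈ Set.range A ∪ Set.range B) → C ≠ B → C ∈ R := by
  classical
  set Z := Set.range A ∪ Set.range B with hZ
  -- Labels outside `Z` rank below those of `Z`, and `B 0` is lowest within `Z`. A circuit leaving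
  -- `Z` has its lowest label outside, so it excludes no tuple on `Z`; the only circuit inside `Z`
  -- is the pair itself, and it excludes `B`.
  let e : ℕ → ℕ := fun k => if k ∈ Z then (if k = B 0 then m + 1 else m + 2 + k) else k
  have heZ : ∀ k ∈ Z, k ≠ B 0 → e k = m + 2 + k := fun k h1 h2 => by simp [e, h1, h2]
  have heB : e (B 0) = m + 1 := by simp [e, hZ]
  have heZ' : ∀ k ∉ Z, e k = k := fun k h => by simp [e, h]
  have heZ1 : ∀ k ∈ Z, m + 1 ≤ e k := fun k h => by
    by_cases hk : k = B 0
    · rw [hk, heB]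
    · rw [heZ k h hk]; omega
  have he : Set.InjOn e (Finset.Icc 1 m) := by
    intro x hx y hy hxy
    have hx := Finset.mem_Icc.1 hx
    have hy := Finset.mem_Icc.1 hy
    simp only [e] at hxy
    split_ifs at hxy <;> omega
  refine ⟨placing m e, fun C h => h.1, placing_nonIntertwining m e,
    (weaklyCovers_placing ht hm e he).facetExtension ht (placing_nonIntertwining m e), ?_⟩
  intro C hC hCZ hCB
  refine ⟨hC, fun D hD hCD => ?_⟩
  by_cases hDZ : ∀ j, D j ∈ Z
  · have hCD' : C = A ∧ D = B := by
      rcases hCD with h | h <;> rcases hAB with h' | h'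
      · exact h.eq_of_subset h' hCZ hDZ
      · exact absurd (h.eq_of_subset h' (fun i => (hCZ i).symm) fun i => (hDZ i).symm).1 hCB
      · exact absurd (h.eq_of_subset h' hDZ hCZ).2 hCB
      · exact (h.eq_of_subset h' (fun i => (hDZ i).symm) fun i => (hCZ i).symm).symm
    obtain ⟨rfl, rfl⟩ := hCD'
    refine ⟨0, fun i => ?_⟩
    have hne : C i ≠ D 0 := by
      rcases hAB with h' | h'
      · exact h'.ne i 0
      · exact (h'.ne 0 i).symm
    rw [heB, heZ _ (hCZ i) hne]
    omega
  · push Not at hDZ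
    obtain ⟨j, hj⟩ := hDZ
    refine ⟨j, fun i => ?_⟩
    have h1 := heZ1 _ (hCZ i)
    have h2 := (Finset.mem_Icc.1 (hD j)).2
    rw [heZ' _ hj]
    omega

/-- A tuple other than `B` that crosses `A` also crosses a further tuple from `A ∪ B`. -/
theorem exists_intertwines_of_intertwines (hd : 1 ≤ d) {A B C : Fin (d + 1) → ℕ}
    (hAB : Intertwines A B ∨ Intertwines B A) (hCA : Intertwines C A ∨ Intertwines A C)
    (hCB : C ≠ B) :
    ∃ D : Fin (d + 1) → ℕ, (∀ i, D i ∈ Set.range A ∪ Set.range B) ∧ D ≠ A ∧ D ≠ B ∧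
      (Intertwines C D ∨ Intertwines D C) := by
  have hdisj : ∀ i j, A i ≠ B j := fun i j => by
    rcases hAB with h | h
    · exact h.ne i j
    · exact (h.ne j i).symm
  -- Most cases swap one entry of `A` for one of `B`. The result is not `B`, because `d ≥ 1` leaves
  -- it an entry of `A`.
  have hupd : ∀ i j, (∀ k, Function.update A i (B j) k ∈ Set.range A ∪ Set.range B) ∧
      Function.update A i (B j) ≠ A ∧ Function.update A i (B j) ≠ B := by
    intro i j
    refine ⟨fun k => ?_, fun h => ?_, fun h => ?_⟩
    · rw [Function.update_apply]
      split_ifs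
      · exact Or.inr ⟨j, rfl⟩
      · exact Or.inl ⟨k, rfl⟩
    · have := congrFun h i
      rw [Function.update_self] at this
      exact hdisj i j this.symm
    · obtain ⟨k, hk⟩ : ∃ k : Fin (d + 1), k ≠ i :=
        have : Nontrivial (Fin (d + 1)) := Fin.nontrivial_iff_two_le.2 (by omega)
        exists_ne i
      have := congrFun h k
      rw [Function.update_of_ne hk] at this
      exact hdisj k k this
  have hmk : ∀ i j, (Intertwines C (Function.update A i (B j)) ∨
      Intertwines (Function.update A i (B j)) C) → ∃ D : Fin (d + 1) → ℕ,
      (∀ i, D i ∈ Set.range A ∪ Set.range B) ∧ D ≠ A ∧ D ≠ B ∧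
        (Intertwines C D ∨ Intertwines D C) := fun i j h =>
    ⟨_, (hupd i j).1, (hupd i j).2.1, (hupd i j).2.2, h⟩
  obtain ⟨i, hi⟩ : ∃ i, C i ≠ B i := by
    by_contra! h
    exact hCB (funext h)
  rcases hAB with hAB | hAB <;> rcases hCA with hCA | hCA
  · -- `A` before `B`, `C` before `A`
    refine hmk (Fin.last d) (Fin.last d) (Or.inl ⟨fun k => ?_, fun k => ?_⟩)
    · rw [Function.update_apply]
      split_ifs with h
      · have := hCA.1 k; have := hAB.1 k; subst h; omega
      · exact hCA.1 k
    · rw [Function.update_of_ne (Fin.castSucc_ne_last k)]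
      exact hCA.2 k
  · -- `A` before `B`, `A` before `C`
    rcases lt_or_gt_of_ne hi with hlt | hgt
    · rcases Fin.eq_castSucc_or_eq_last i with ⟨j, rfl⟩ | rfl
      · refine hmk j.succ j.castSucc (Or.inr ⟨fun k => ?_, fun k => ?_⟩)
        · rw [Function.update_apply]
          split_ifs with h
          · subst h; have := hCA.1 j.succ; have := hAB.2 j; omega
          · exact hCA.1 k
        · rw [Function.update_apply]
          split_ifs with h
          · have : k = j := Fin.succ_injective _ h
            subst this
            exact hlt
          · exact hCA.2 k
      -- At the last place `A` is shifted instead: its first entry is dropped and the last entry of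
      -- `B` appended, so that `C` comes before `D`.
      · let D : Fin (d + 1) → ℕ := Fin.snoc (α := fun _ => ℕ) (fun k : Fin d => A k.succ)
          (B (Fin.last d))
        have hDl : D (Fin.last d) = B (Fin.last d) := Fin.snoc_last _ _
        have hDc : ∀ k : Fin d, D k.castSucc = A k.succ := fun k => Fin.snoc_castSucc _ _ _
        refine ⟨D, fun k => ?_, fun h => ?_, fun h => ?_, Or.inl ⟨fun k => ?_, fun k => ?_⟩⟩
        · refine Fin.lastCases ?_ (fun j => ?_) k
          · rw [hDl]; exact Or.inr ⟨_, rfl⟩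
          · rw [hDc]; exact Or.inl ⟨_, rfl⟩
        · rw [h] at hDl; exact hdisj _ _ hDl
        · have h1 := hDc ⟨0, by omega⟩
          rw [h] at h1
          exact hdisj _ _ h1.symm
        · refine Fin.lastCases ?_ (fun j => ?_) k
          · rw [hDl]; exact hlt
          · rw [hDc]; exact hCA.2 j
        · rw [hDc]; exact hCA.1 k.succ
    · refine hmk i i (Or.inr ⟨fun k => ?_, fun k => ?_⟩)
      · rw [Function.update_apply]
        split_ifs with h
        · subst h; exact hgt
        · exact hCA.1 k
      · rw [Function.update_apply]
        split_ifs with h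
        · have := hCA.2 k; have := hAB.1 i; rw [h] at *; omega
        · exact hCA.2 k
  · -- `B` before `A`, `C` before `A`
    rcases lt_or_gt_of_ne hi with hlt | hgt
    · refine hmk i i (Or.inl ⟨fun k => ?_, fun k => ?_⟩)
      · rw [Function.update_apply]
        split_ifs with h
        · subst h; exact hlt
        · exact hCA.1 k
      · rw [Function.update_apply]
        split_ifs with h
        · have := hCA.2 k; have := hAB.1 i; rw [h] at *; omega
        · exact hCA.2 k
    · rcases Fin.eq_zero_or_eq_succ i with rfl | ⟨j, rfl⟩
      -- The mirror image: `B 0` is prepended and the last entry of `A` dropped.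
      · let D : Fin (d + 1) → ℕ := Fin.cons (α := fun _ => ℕ) (B 0) (fun k : Fin d => A k.castSucc)
        have hDl : D 0 = B 0 := rfl
        have hDc : ∀ k : Fin d, D k.succ = A k.castSucc := fun k => rfl
        refine ⟨D, fun k => ?_, fun h => ?_, fun h => ?_, Or.inr ⟨fun k => ?_, fun k => ?_⟩⟩
        · refine Fin.cases ?_ (fun j => ?_) k
          · rw [hDl]; exact Or.inr ⟨_, rfl⟩
          · rw [hDc]; exact Or.inl ⟨_, rfl⟩
        · rw [h] at hDl; exact hdisj _ _ hDl
        · have h1 := hDc ⟨0, by omega⟩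
          rw [h] at h1
          exact hdisj _ _ h1.symm
        · refine Fin.cases ?_ (fun j => ?_) k
          · rw [hDl]; exact hgt
          · rw [hDc]; exact hCA.2 j
        · rw [hDc]; exact hCA.1 k.castSucc
      · refine hmk j.castSucc j.succ (Or.inl ⟨fun k => ?_, fun k => ?_⟩)
        · rw [Function.update_apply]
          split_ifs with h
          · subst h; have := hCA.1 j.castSucc; have := hAB.2 j; omega
          · exact hCA.1 k
        · rw [Function.update_apply]
          split_ifs with h
          · have : k = j := Fin.castSucc_injective _ h
            subst this
            exact hgt
          · exact hCA.2 k
  · -- `B` before `A`, `A` before `C`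
    refine hmk 0 0 (Or.inr ⟨fun k => ?_, fun k => ?_⟩)
    · rw [Function.update_apply]
      split_ifs with h
      · subst h; have := hCA.1 0; have := hAB.1 0; omega
      · exact hCA.1 k
    · rw [Function.update_of_ne (Fin.succ_ne_zero k)]
      exact hCA.2 k

/-- The vertex set of an intertwining pair. -/
def pairSupport (A B : Fin (d + 1) → ℕ) : Finset ℕ :=
  Finset.univ.image A ∪ Finset.univ.image B

theorem mem_pairSupport {A B : Fin (d + 1) → ℕ} {z : ℕ} :
    z ∈ pairSupport A B ↔ (∃ i, A i = z) ∨ ∃ i, B i = z := by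
  simp [pairSupport]

theorem pairSupport_comm (A B : Fin (d + 1) → ℕ) : pairSupport A B = pairSupport B A :=
  Finset.union_comm _ _

theorem ne_of_intertwines {A B : Fin (d + 1) → ℕ} (hAB : Intertwines A B ∨ Intertwines B A)
    (i j : Fin (d + 1)) : A i ≠ B j := by
  rcases hAB with h | h
  · exact h.ne i j
  · exact (h.ne j i).symm

theorem card_pairSupport {A B : Fin (d + 1) → ℕ} (hAB : Intertwines A B ∨ Intertwines B A) :
    (pairSupport A B).card = 2 * d + 2 := by
  have hA : Gapped A := hAB.elim Intertwines.gapped_left Intertwines.gapped_right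
  have hB : Gapped B := hAB.elim Intertwines.gapped_right Intertwines.gapped_left
  rw [pairSupport, Finset.card_union_of_disjoint, Finset.card_image_of_injective _
    hA.strictMono.injective, Finset.card_image_of_injective _ hB.strictMono.injective,
    Finset.card_univ, Fintype.card_fin]
  · ring
  · rw [Finset.disjoint_left]
    intro x hx hx'
    obtain ⟨i, -, rfl⟩ := Finset.mem_image.1 hx
    obtain ⟨k, -, hk⟩ := Finset.mem_image.1 hx'
    exact ne_of_intertwines hAB i k hk.symm

theorem card_pairSupport_erase {A B : Fin (d + 1) → ℕ} (hAB : Intertwines A B ∨ Intertwines B A)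
    {z : ℕ} (hz : z ∈ pairSupport A B) : ((pairSupport A B).erase z).card = 2 * d + 1 := by
  rw [Finset.card_erase_of_mem hz, card_pairSupport hAB]; rfl

/-- A compatible simplex that contains one tuple of an exchangeable pair omits exactly one vertex
of the other. -/
theorem eq_erase_of_exchange (ht : StrictMono t) {m : ℕ}
    {R : Set (Fin (d + 1) → ℕ)} {A B : Fin (d + 1) → ℕ} (hA : A ∈ separatedTuples d m)
    (hB : B ∈ separatedTuples d m) (hAB : Intertwines A B ∨ Intertwines B A)
    (hAR : A ∉ R) (hBR : B ∉ R)
    (hRA : NonIntertwining (insert A R)) (hPB : FacetExtension t m (insert B R))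
    {σ : Finset ℕ} (hσV : σ ⊆ Finset.Icc 1 m) (hσcard : σ.card = 2 * d + 1)
    (hσc : Compat (insert A R) σ) (hAσ : ∀ i, A i ∈ σ) :
    ∃ j, σ = (pairSupport A B).erase (B j) := by
  classical
  set V := Finset.Icc 1 m with hV
  rw [mem_separatedTuples] at hA hB
  have hdisj := ne_of_intertwines hAB
  have hne : A ≠ B := fun h => hdisj 0 0 (by rw [h])
  have hBA : B ∉ insert A R := by rw [Set.mem_insert_iff]; exact fun h => h.elim hne.symm hBR
  have hAB' : A ∉ insert B R := by rw [Set.mem_insert_iff]; exact fun h => h.elim hne hAR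
  have hcardE := fun j => card_pairSupport_erase hAB (mem_pairSupport.2 (Or.inr ⟨j, rfl⟩))
  set Z := pairSupport A B with hZ
  have hAZ : ∀ i, A i ∈ Z := fun i => mem_pairSupport.2 (Or.inl ⟨i, rfl⟩)
  have hBZ : ∀ i, B i ∈ Z := fun i => mem_pairSupport.2 (Or.inr ⟨i, rfl⟩)
  have hZmem : ∀ z ∈ Z, (∃ i, A i = z) ∨ ∃ i, B i = z := fun z hz => mem_pairSupport.1 hz
  set F := σ.erase (A 0) with hF
  have haF : A 0 ∉ F := by simp [hF]
  have hFa : insert (A 0) F = σ := Finset.insert_erase (hAσ 0)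
  have hFcard : F.card = 2 * d := by
    rw [hF, Finset.card_erase_of_mem (hAσ 0), hσcard]; rfl
  have hFR : Compat R F := fun C hC hCF => by
    refine (Set.mem_insert_iff.1 (hσc C hC fun i => Finset.mem_of_mem_erase (hCF i))).resolve_left
      ?_
    rintro rfl
    exact haF (hCF 0)
  obtain ⟨y, hy, hxy, hyc⟩ := hPB F ((Finset.erase_subset _ _).trans hσV) hFcard
    (fun C hC hCF => Set.mem_insert_of_mem _ (hFR C hC hCF)) (A 0) (hA.1 0) haF
  -- Were `insert y F` compatible with `insert A R` too, uniqueness would make it `σ`, which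
  -- contains `A`. So it contains a tuple outside `insert A R`, necessarily `B`; since `σ` does not
  -- contain `B`, the new vertex `y` is an entry of `B`.
  have hBF : ∀ i, B i ∈ insert y F := by
    have hnot : ¬ Compat (insert A R) (insert y F) := fun hc => by
      have := eq_of_compat_insert ht hRA hFcard hxy (by rwa [hFa]) hc
      rw [← this, hFa] at hyc
      exact hAB' (hyc A hA.2 hAσ)
    simp only [Compat, not_forall] at hnot
    obtain ⟨C, hC, hCF, hCR⟩ := hnot
    have h1 := hyc C hC hCF
    rw [Set.mem_insert_iff] at h1
    rcases h1 with rfl | h1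
    · exact hCF
    · exact absurd (Set.mem_insert_of_mem _ h1) hCR
  obtain ⟨j, rfl⟩ : ∃ j, B j = y := by
    by_contra! h
    refine hBA (hσc B hB.2 fun i => ?_)
    exact Finset.mem_of_mem_erase ((Finset.mem_insert.1 (hBF i)).resolve_left (h i))
  refine ⟨j, (Finset.eq_of_subset_of_card_le (fun z hz => ?_) ?_).symm⟩
  · obtain ⟨h1, h2⟩ := Finset.mem_erase.1 hz
    rcases hZmem z h2 with ⟨i, rfl⟩ | ⟨i, rfl⟩
    · exact hAσ i
    · exact Finset.mem_of_mem_erase ((Finset.mem_insert.1 (hBF i)).resolve_left h1)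
  · rw [hσcard, hcardE]

/-- The vertices of an exchangeable pair span a flippable subpolytope. -/
theorem compat_erase_of_exchange (ht : StrictMono t) {m : ℕ} (hm : 2 * d + 1 ≤ m)
    {R : Set (Fin (d + 1) → ℕ)} {A B : Fin (d + 1) → ℕ} (hA : A ∈ separatedTuples d m)
    (hB : B ∈ separatedTuples d m) (hAB : Intertwines A B ∨ Intertwines B A)
    (hAR : A ∉ R) (hBR : B ∉ R)
    (hRA : NonIntertwining (insert A R)) (hPA : FacetExtension t m (insert A R))
    (hPB : FacetExtension t m (insert B R)) (j : Fin (d + 1)) :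
    Compat (insert A R) ((pairSupport A B).erase (B j)) := by
  classical
  set V := Finset.Icc 1 m with hV
  have hA' := hA
  have hB' := hB
  rw [mem_separatedTuples] at hA hB
  have hdisj := ne_of_intertwines hAB
  have hne : A ≠ B := fun h => hdisj 0 0 (by rw [h])
  have hBA : B ∉ insert A R := by rw [Set.mem_insert_iff]; exact fun h => h.elim hne.symm hBR
  have hAB' : A ∉ insert B R := by rw [Set.mem_insert_iff]; exact fun h => h.elim hne hAR
  have hcardE := fun j => card_pairSupport_erase hAB (mem_pairSupport.2 (Or.inr ⟨j, rfl⟩))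
  set Z := pairSupport A B with hZ
  have hAZ : ∀ i, A i ∈ Z := fun i => mem_pairSupport.2 (Or.inl ⟨i, rfl⟩)
  have hBZ : ∀ i, B i ∈ Z := fun i => mem_pairSupport.2 (Or.inr ⟨i, rfl⟩)
  have hZmem : ∀ z ∈ Z, (∃ i, A i = z) ∨ ∃ i, B i = z := fun z hz => mem_pairSupport.1 hz
  have hZV : Z ⊆ V := fun z hz => by
    rcases hZmem z hz with ⟨i, rfl⟩ | ⟨i, rfl⟩
    · exact hA.1 i
    · exact hB.1 i
  obtain ⟨σ, hσV, hσcard, hσc, hAσ⟩ := (hPA.covers ht hm).exists_superset ht (subset_refl _) hRA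
    (F := Finset.univ.image A) (fun x hx => by
      obtain ⟨i, -, rfl⟩ := Finset.mem_image.1 hx
      exact hA.1 i) (compat_image_of_mem hA.2.strictMono (Set.mem_insert _ _))
  obtain ⟨k, hk⟩ := eq_erase_of_exchange ht hA' hB' hAB hAR hBR hRA hPB hσV hσcard hσc
    fun i => hAσ (Finset.mem_image_of_mem _ (Finset.mem_univ i))
  rw [hk] at hσc
  by_cases hkj : B k = B j
  · rwa [← hkj]
  -- The simplex omitting `B j` is reached from the one omitting `B k` across the facet omitting
  -- both. The simplex found on the side of `B k` contains `A`, so it omits one entry of `B`, and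
  -- its new vertex is `B j` or `B k`.
  set F := (Z.erase (B k)).erase (B j) with hF
  have hjE : B j ∈ Z.erase (B k) := Finset.mem_erase.2 ⟨Ne.symm hkj, hBZ j⟩
  have hFj : B j ∉ F := by simp [hF]
  have hFk : B k ∉ F := by simp [hF]
  have hFcard : F.card = 2 * d := by
    rw [hF, Finset.card_erase_of_mem hjE, hcardE]; rfl
  have hFZ : F ⊆ Z := (Finset.erase_subset _ _).trans (Finset.erase_subset _ _)
  have hAF : ∀ i, A i ∈ F := fun i => Finset.mem_erase.2 ⟨hdisj i j, Finset.mem_erase.2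
    ⟨hdisj i k, hAZ i⟩⟩
  obtain ⟨y, hy, hxy, hyc⟩ := hPA F (hFZ.trans hZV) hFcard (hσc.mono (Finset.erase_subset _ _))
    (B k) (hB.1 k) hFk
  have hyF : y ∉ F := fun h => by simp [(side_eq_zero_iff ht).2 h] at hxy
  obtain ⟨l, hl⟩ := eq_erase_of_exchange ht hA' hB' hAB hAR hBR hRA hPB (Finset.insert_subset hy (hFZ.trans hZV))
    (by rw [Finset.card_insert_of_notMem hyF, hFcard]) hyc
    fun i => Finset.mem_insert_of_mem (hAF i)
  have hyZ : y ∈ Z := by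
    have : y ∈ Z.erase (B l) := hl ▸ Finset.mem_insert_self y F
    exact Finset.mem_of_mem_erase this
  have hyjk : y = B j ∨ y = B k := by
    by_contra! h
    exact hyF (Finset.mem_erase.2 ⟨h.1, Finset.mem_erase.2 ⟨h.2, hyZ⟩⟩)
  have hZF : insert (B k) F = Z.erase (B j) := by
    rw [hF, Finset.erase_right_comm, Finset.insert_erase]
    exact Finset.mem_erase.2 ⟨hkj, hBZ k⟩
  rcases hyjk with rfl | rfl
  · exfalso
    -- `B j` and `B k` have the same sign in the circuit, so they lie on opposite sides of `F`.
    obtain ⟨c, -, hc2, -, hc4⟩ := exists_circuit_of_intertwines ht hAB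
    have hsum := sum_mul_side_eq_zero Z _ c (hc4 Z hAZ hBZ) F (by omega)
    have hZ' : Z = insert (B k) (insert (B j) F) := by
      rw [hF, Finset.insert_erase hjE, Finset.insert_erase (hBZ k)]
    rw [hZ', Finset.sum_insert (by simp [hFk, hkj]), Finset.sum_insert hFj,
      Finset.sum_eq_zero (s := F) (fun f hf => by rw [(side_eq_zero_iff ht).2 hf, mul_zero]),
      add_zero] at hsum
    have h1 := hc2 k
    have h2 := hc2 j
    rcases pos_and_pos_or_neg_and_neg_of_mul_pos hxy with ⟨h3, h4⟩ | ⟨h3, h4⟩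
    · linarith [mul_pos h1 h3, mul_pos h2 h4]
    · linarith [mul_neg_of_pos_of_neg h1 h3, mul_neg_of_pos_of_neg h2 h4]
  · rwa [hZF] at hyc

end Exchange

/-! ### From geometric triangulations to weights -/

section Geometry

variable {δ : ℕ} {t : ℕ → ℝ}

/-- The homogeneous coordinates of a point, with `1` as coordinate of order `0`. -/
def homog (x : Fin δ → ℝ) : ℕ → ℝ
  | 0 => 1
  | k + 1 => if h : k < δ then x ⟨k, h⟩ else 0

theorem homog_succ (x : Fin δ → ℝ) (j : Fin δ) : homog x (j + 1) = x j := by simp [homog]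

/-- The point with given homogeneous coordinates. -/
theorem exists_homog_eq (a : ℕ → ℝ) (h : a 0 = 1) :
    ∃ x : Fin δ → ℝ, ∀ k < δ + 1, homog x k = a k :=
  ⟨fun j => a (j + 1), fun k hk => by
    rcases k with _ | k
    · exact h.symm
    · simp [homog, show k < δ by omega]⟩

/-- Moments of order at most `δ`, order `0` being the total weight, are homogeneous coordinates of
the represented point. Summing over a larger set `U` lets different label sets be compared. -/
theorem mem_labelHull {V U : Finset ℕ} (hVU : V ⊆ U) {x : Fin δ → ℝ} :
    x ∈ labelHull δ t V ↔ ∃ w : ℕ → ℝ, (∀ i, 0 ≤ w i) ∧ (∀ i ∉ V, w i = 0) ∧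
      ∀ k < δ + 1, ∑ i ∈ U, w i * t i ^ k = homog x k := by
  classical
  constructor
  · intro hx
    let T : Set (Fin δ → ℝ) := {x | ∃ w : ℕ → ℝ, (∀ i, 0 ≤ w i) ∧ (∀ i ∉ V, w i = 0) ∧
      ∀ k < δ + 1, ∑ i ∈ U, w i * t i ^ k = homog x k}
    refine convexHull_min (t := T) ?_ ?_ hx
    · rintro _ ⟨i, hi, rfl⟩
      refine ⟨Pi.single i 1, fun j => ?_, fun j hj => ?_, fun k hk => ?_⟩
      · rw [Pi.single_apply]; split_ifs <;> norm_num
      · exact Pi.single_eq_of_ne (fun h => hj (by rw [h]; exact hi)) _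
      · rw [Finset.sum_eq_single i (fun j _ hj => by rw [Pi.single_eq_of_ne hj, zero_mul])
          (fun h => absurd (hVU hi) h), Pi.single_eq_same, one_mul]
        rcases k with _ | k
        · simp [homog]
        · simp [homog, momentPoint, show k < δ by omega]
    · rintro x ⟨u, hu0, huV, hu⟩ y ⟨v, hv0, hvV, hv⟩ a b ha hb hab
      refine ⟨fun i => a * u i + b * v i, fun i => add_nonneg (mul_nonneg ha (hu0 i))
        (mul_nonneg hb (hv0 i)), fun i hi => by simp [huV i hi, hvV i hi], fun k hk => ?_⟩
      have : ∑ i ∈ U, (a * u i + b * v i) * t i ^ k =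
          a * ∑ i ∈ U, u i * t i ^ k + b * ∑ i ∈ U, v i * t i ^ k := by
        rw [Finset.mul_sum, Finset.mul_sum, ← Finset.sum_add_distrib]
        exact Finset.sum_congr rfl fun i _ => by ring
      rw [this, hu k hk, hv k hk]
      rcases k with _ | k
      · simp [homog, hab]
      · simp [homog, show k < δ by omega]
  · rintro ⟨w, hw0, hwV, hw⟩
    have hsub : ∀ f : ℕ → ℝ, ∑ i ∈ U, w i * f i = ∑ i ∈ V, w i * f i := fun f =>
      (Finset.sum_subset hVU fun i _ hi => by rw [hwV i hi, zero_mul]).symm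
    have hx : x = ∑ i ∈ V, w i • momentPoint δ (t i) := by
      ext j
      have := hw (j + 1) (by omega)
      rw [homog_succ, hsub] at this
      rw [← this, Finset.sum_apply]
      rfl
    rw [hx]
    refine (convex_convexHull ℝ _).sum_mem (fun i _ => hw0 i) ?_ fun i hi =>
      subset_convexHull ℝ _ ⟨i, hi, rfl⟩
    have := hw 0 (by omega)
    rw [hsub] at this
    simpa [homog] using this

theorem labelHull_mono {V W : Set ℕ} (h : V ⊆ W) : labelHull δ t V ⊆ labelHull δ t W :=
  convexHull_mono (Set.image_mono h)

/-- Representations of the same point by weights in a simplex coincide. -/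
theorem eq_of_moments (ht : StrictMono t) {V σ : Finset ℕ} (hσ : σ ⊆ V) {n : ℕ} (hn : σ.card ≤ n)
    {u v : ℕ → ℝ} (hu : ∀ i ∉ σ, u i = 0) (hv : ∀ i ∉ σ, v i = 0)
    (h : ∀ k < n, ∑ x ∈ V, u x * t x ^ k = ∑ x ∈ V, v x * t x ^ k) : u = v := by
  ext i
  by_cases hi : i ∈ σ
  · rw [← coord_eq_of_moments ht hσ hu (μ := v) (fun k hk => h k (by omega)) hi,
      ← coord_eq_of_moments ht hσ hv (μ := v) (fun k hk => rfl) hi]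
  · rw [hu i hi, hv i hi]

theorem labelsIndep_of_card_le (ht : StrictMono t) {V : Finset ℕ} (hV : V.card ≤ δ + 1) :
    LabelsIndep δ t V := by
  classical
  rw [LabelsIndep, affineIndependent_iff]
  intro s w h0 h1 e he
  let v : ℕ → ℝ := fun i => if h : i ∈ V then (if (⟨i, h⟩ : V) ∈ s then w ⟨i, h⟩ else 0) else 0
  have hsum : ∀ f : ℕ → ℝ, ∑ i ∈ V, v i * f i = ∑ e ∈ s, w e * f e := fun f => by
    rw [← Finset.sum_coe_sort V, ← Finset.sum_filter_add_sum_filter_not Finset.univ (· ∈ s),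
      Finset.sum_eq_zero (s := Finset.univ.filter (· ∉ s)), add_zero]
    · refine Finset.sum_congr (by ext; simp) fun i hi => ?_
      have : i ∈ s := by simpa using hi
      simp [v, this]
    · intro i hi
      have : i ∉ s := by simpa using hi
      simp [v, this]
  have hv : v = fun _ => 0 := by
    refine eq_of_moments ht (subset_refl V) hV (fun i hi => by simp [v, hi]) (fun _ _ => rfl)
      fun k hk => ?_
    rw [hsum fun i => t i ^ k]
    rcases k with _ | k
    · simpa using h0
    · have := congrFun h1 ⟨k, by omega⟩
      rw [Finset.sum_apply] at this
      simpa [momentPoint] using this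
  have := congrFun hv e
  simpa [v, he] using this

/-- The representations by weights of the points of the hull of `V` in a triangulation. -/
structure WeightTriangulation (δ : ℕ) (t : ℕ → ℝ) (V : Finset ℕ) (S : Finset (Finset ℕ)) :
    Prop where
  subset : ∀ σ ∈ S, σ ⊆ V
  card : ∀ σ ∈ S, σ.card = δ + 1
  cover : ∀ μ : ℕ → ℝ, (∀ i, 0 ≤ μ i) → ∃ σ ∈ S, ∃ w : ℕ → ℝ, (∀ i, 0 ≤ w i) ∧
    (∀ i ∉ σ, w i = 0) ∧ ∀ k < δ + 1, ∑ i ∈ V, w i * t i ^ k = ∑ i ∈ V, μ i * t i ^ k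
  unique : ∀ σ ∈ S, ∀ τ ∈ S, ∀ u v : ℕ → ℝ, (∀ i, 0 ≤ u i) → (∀ i, 0 ≤ v i) →
    (∀ i ∉ σ, u i = 0) → (∀ i ∉ τ, v i = 0) →
    (∀ k < δ + 1, ∑ i ∈ V, u i * t i ^ k = ∑ i ∈ V, v i * t i ^ k) → u = v

/-- Rescaling to total weight one passes between weights and points, the zero weight being treated
apart. The intersection axiom becomes uniqueness: a point of two simplices is in the hull of their
common labels, and its coordinates in either simplex agree with those. -/
theorem isTriangulationOf_iff (ht : StrictMono t) {V : Finset ℕ} (hV : V.Nonempty)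
    {S : Finset (Finset ℕ)} :
    IsTriangulationOf δ t V S ↔ WeightTriangulation δ t V S := by
  classical
  constructor
  · intro h
    have hsub : ∀ σ ∈ S, σ ⊆ V := fun σ hσ => Finset.coe_subset.1 (h.vertices σ hσ)
    have hzero : ∀ μ : ℕ → ℝ, (∀ i, 0 ≤ μ i) → ∑ i ∈ V, μ i = 0 → ∀ i ∈ V, μ i = 0 :=
      fun μ hμ h0 i hi => (Finset.sum_eq_zero_iff_of_nonneg fun i _ => hμ i).1 h0 i hi
    have hdiv : ∀ (μ : ℕ → ℝ) (a : ℝ) (k : ℕ), ∑ i ∈ V, μ i / a * t i ^ k =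
        (∑ i ∈ V, μ i * t i ^ k) / a := fun μ a k => by
      rw [Finset.sum_div]; exact Finset.sum_congr rfl fun i _ => by ring
    have hone : ∀ μ : ℕ → ℝ, ∑ i ∈ V, μ i * t i ^ 0 = ∑ i ∈ V, μ i := fun μ => by simp
    have hcover : ∀ x ∈ labelHull δ t V, ∃ σ ∈ S, x ∈ labelHull δ t σ := fun x hx => by
      rw [← h.cover] at hx
      simpa using hx
    refine ⟨hsub, h.card, fun μ hμ => ?_, fun σ hσ τ hτ u v hu hv huσ hvτ huv => ?_⟩
    · rcases eq_or_ne (∑ i ∈ V, μ i) 0 with h0 | h0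
      · obtain ⟨z, hz⟩ := hV
        obtain ⟨σ, hσ, -⟩ := hcover _ (subset_convexHull ℝ _ ⟨z, hz, rfl⟩)
        refine ⟨σ, hσ, fun _ => 0, fun _ => le_rfl, fun _ _ => rfl, fun k _ => ?_⟩
        exact Finset.sum_congr rfl fun i hi => by rw [hzero μ hμ h0 i hi]
      · obtain ⟨x, hx⟩ := exists_homog_eq (δ := δ)
          (fun k => (∑ i ∈ V, μ i * t i ^ k) / ∑ i ∈ V, μ i) (by rw [hone, div_self h0])
        have hpos : 0 ≤ ∑ i ∈ V, μ i := Finset.sum_nonneg fun i _ => hμ i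
        have hxV : x ∈ labelHull δ t V := by
          refine (mem_labelHull (subset_refl V)).2 ⟨fun i => if i ∈ V then μ i / ∑ i ∈ V, μ i else 0,
            fun i => ?_, fun i hi => by simp [hi], fun k hk => ?_⟩
          · change 0 ≤ if i ∈ V then μ i / ∑ i ∈ V, μ i else 0
            split_ifs
            exacts [div_nonneg (hμ i) hpos, le_rfl]
          · rw [hx k hk, ← hdiv]
            exact Finset.sum_congr rfl fun i hi => by simp [hi]
        obtain ⟨σ, hσ, hxσ⟩ := hcover x hxV
        obtain ⟨w, hw0, hwσ, hw⟩ := (mem_labelHull (hsub σ hσ)).1 hxσ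
        refine ⟨σ, hσ, fun i => (∑ i ∈ V, μ i) * w i, fun i => mul_nonneg hpos (hw0 i),
          fun i hi => by simp [hwσ i hi], fun k hk => ?_⟩
        simp_rw [mul_assoc]
        rw [← Finset.mul_sum, hw k hk, hx k hk, mul_div_cancel₀ _ h0]
    · have h00 := huv 0 (by omega)
      rw [hone, hone] at h00
      rcases eq_or_ne (∑ i ∈ V, u i) 0 with h0 | h0
      · ext i
        by_cases hi : i ∈ V
        · rw [hzero u hu h0 i hi, hzero v hv (h00 ▸ h0) i hi]
        · rw [huσ i fun h => hi (hsub σ hσ h), hvτ i fun h => hi (hsub τ hτ h)]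
      · have hpos : 0 ≤ ∑ i ∈ V, u i := Finset.sum_nonneg fun i _ => hu i
        obtain ⟨x, hx⟩ := exists_homog_eq (δ := δ)
          (fun k => (∑ i ∈ V, u i * t i ^ k) / ∑ i ∈ V, u i) (by rw [hone, div_self h0])
        have hxσ : x ∈ labelHull δ t σ := (mem_labelHull (hsub σ hσ)).2 ⟨fun i => u i / ∑ i ∈ V, u i,
          fun i => div_nonneg (hu i) hpos, fun i hi => by simp [huσ i hi], fun k hk => by
            rw [hx k hk, hdiv]⟩
        have hxτ : x ∈ labelHull δ t τ := (mem_labelHull (hsub τ hτ)).2 ⟨fun i => v i / ∑ i ∈ V, u i,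
          fun i => div_nonneg (hv i) hpos, fun i hi => by simp [hvτ i hi], fun k hk => by
            rw [hx k hk, hdiv, huv k hk]⟩
        have hxστ : x ∈ labelHull δ t ((σ ∩ τ : Finset ℕ) : Set ℕ) := h.inter σ hσ τ hτ ▸ ⟨hxσ, hxτ⟩
        obtain ⟨w, -, hwστ, hw⟩ :=
          (mem_labelHull (Finset.inter_subset_left.trans (hsub σ hσ))).1 hxστ
        have h1 : (fun i => u i / ∑ i ∈ V, u i) = w := eq_of_moments ht (hsub σ hσ) (h.card σ hσ).le
          (fun i hi => by simp [huσ i hi]) (fun i hi => hwστ i fun h => hi (Finset.mem_inter.1 h).1)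
          fun k hk => by rw [hdiv, hw k hk, hx k hk]
        have h2 : (fun i => v i / ∑ i ∈ V, u i) = w := eq_of_moments ht (hsub τ hτ) (h.card τ hτ).le
          (fun i hi => by simp [hvτ i hi]) (fun i hi => hwστ i fun h => hi (Finset.mem_inter.1 h).2)
          fun k hk => by rw [hdiv, hw k hk, hx k hk, huv k hk]
        ext i
        have := congrFun (h1.trans h2.symm) i
        exact (div_left_inj' h0).1 this
  · intro h
    refine ⟨fun σ hσ => Finset.coe_subset.2 (h.subset σ hσ), h.card,
      fun σ hσ => labelsIndep_of_card_le ht (h.card σ hσ).le, ?_, fun σ hσ τ hτ => ?_⟩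
    · refine Set.Subset.antisymm (Set.iUnion₂_subset fun σ hσ =>
        labelHull_mono (Finset.coe_subset.2 (h.subset σ hσ))) fun x hx => ?_
      obtain ⟨μ, hμ0, -, hμ⟩ := (mem_labelHull (subset_refl V)).1 hx
      obtain ⟨σ, hσ, w, hw0, hwσ, hw⟩ := h.cover μ hμ0
      exact Set.mem_iUnion₂.2 ⟨σ, hσ, (mem_labelHull (h.subset σ hσ)).2
        ⟨w, hw0, hwσ, fun k hk => by rw [hw k hk, hμ k hk]⟩⟩
    · refine Set.Subset.antisymm ?_ (Set.subset_inter
        (labelHull_mono (Finset.coe_subset.2 Finset.inter_subset_left))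
        (labelHull_mono (Finset.coe_subset.2 Finset.inter_subset_right)))
      rintro x ⟨hxσ, hxτ⟩
      obtain ⟨u, hu0, huσ, hu⟩ := (mem_labelHull (h.subset σ hσ)).1 hxσ
      obtain ⟨v, hv0, hvτ, hv⟩ := (mem_labelHull (h.subset τ hτ)).1 hxτ
      have huv := h.unique σ hσ τ hτ u v hu0 hv0 huσ hvτ fun k hk => by rw [hu k hk, hv k hk]
      refine (mem_labelHull (Finset.inter_subset_left.trans (h.subset σ hσ))).2
        ⟨u, hu0, fun i hi => ?_, hu⟩
      by_cases h1 : i ∈ σ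
      · rw [huv]
        exact hvτ i fun h2 => hi (Finset.mem_inter.2 ⟨h1, h2⟩)
      · exact huσ i h1

end Geometry

/-! ### Lower facets and Gale's evenness condition -/

section LowerFacets

variable {δ d : ℕ} {t : ℕ → ℝ}

/-- When the moments below order `δ` vanish, the weighted sum of the points is a multiple of the
upward vector. -/
theorem sum_mul_apply_momentPoint (l : (Fin δ → ℝ) →L[ℝ] ℝ) (V : Finset ℕ) (c : ℕ → ℝ)
    (hc : ∀ k < δ, ∑ i ∈ V, c i * t i ^ k = 0) :
    ∑ i ∈ V, c i * l (momentPoint δ (t i)) = (∑ i ∈ V, c i * t i ^ δ) * l (upVector δ) := by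
  have hl : ∑ i ∈ V, c i * l (momentPoint δ (t i)) = l (∑ i ∈ V, c i • momentPoint δ (t i)) := by
    simp
  rw [hl, ← smul_eq_mul, ← map_smul]
  congr 1
  ext j
  rw [Finset.sum_apply]
  simp only [Pi.smul_apply, smul_eq_mul, momentPoint, upVector]
  split_ifs with h
  · rw [h, mul_one]
  · rw [hc _ (by omega), mul_zero]

theorem momentPoint_mem_labelHull {V : Set ℕ} {i : ℕ} (hi : i ∈ V) :
    momentPoint δ (t i) ∈ labelHull δ t V :=
  subset_convexHull ℝ _ ⟨i, hi, rfl⟩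

/-- A gapped tuple does not lie on a lower facet. -/
theorem not_labelHull_subset_of_gapped (ht : StrictMono t) {m : ℕ} (hd : 1 ≤ d)
    {A : Fin (d + 1) → ℕ} (hA : Gapped A) (hAm : ∀ i, A i ∈ Set.Icc 1 m) {F : Set (Fin (2 * d) → ℝ)}
    (hF : IsLowerFacet (2 * d) m t F) : ¬ labelHull (2 * d) t (Set.range A) ⊆ F := by
  intro hAF
  obtain ⟨-, l, hl, rfl⟩ := hF
  have hmax : ∀ i, ∀ x ∈ Set.Icc 1 m, l (momentPoint (2 * d) (t x)) ≤
      l (momentPoint (2 * d) (t (A i))) := fun i x hx =>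
    (hAF (momentPoint_mem_labelHull ⟨i, rfl⟩)).2 _ (momentPoint_mem_labelHull hx)
  have hcross : Intertwines A (fun i => A i + 1) :=
    ⟨fun i => Nat.lt_succ_self _, fun i => by
      have := hA i
      change A i.castSucc + 1 < A i.succ
      omega⟩
  -- The circuit on `A 0, A 0 + 1, A 1, …, A d` is positive on `A`, negative on the labels between,
  -- and has positive moment of order `2 d`. A functional maximal on `A` would have nonnegative
  -- weighted sum, but that sum is this moment times a negative number.
  obtain ⟨c, hc1, hc2, hc3⟩ := exists_circuit ht (2 * d) (interleave A fun i => A i + 1)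
    fun j hj => interleave_lt hcross j (by omega)
  have hmem : ∀ j ≤ 2 * d, interleave A (fun i => A i + 1) j ∈ Finset.Icc 1 m := by
    intro j hj
    rcases interleave_cases A (fun i => A i + 1) (show j < 2 * d + 2 by omega) with
      ⟨i, -, h⟩ | ⟨i, rfl, h⟩
    · rw [h]; exact Finset.mem_Icc.2 (hAm i)
    · rw [h]
      have h1 := hAm ⟨i + 1, by omega⟩
      have h2 := hA ⟨i, by omega⟩
      simp only [Fin.castSucc_mk, Fin.succ_mk, Fin.eta] at h2
      exact Finset.mem_Icc.2 ⟨by omega, by have := h1.2; omega⟩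
  obtain ⟨hc4, hc5⟩ := hc3 _ hmem
  have hc0 : ∑ i ∈ Finset.Icc 1 m, c i = 0 := by simpa using hc4 0 (by omega)
  have h1 := sum_mul_apply_momentPoint (t := t) l _ c hc4
  have h2 : 0 ≤ ∑ i ∈ Finset.Icc 1 m, c i * (l (momentPoint (2 * d) (t i)) -
      l (momentPoint (2 * d) (t (A 0)))) := by
    refine Finset.sum_nonneg fun x hx => ?_
    by_cases hx' : ∃ j ≤ 2 * d, x = interleave A (fun i => A i + 1) j
    swap
    · push Not at hx'
      rw [hc1 x hx', zero_mul]
    obtain ⟨j, hj, rfl⟩ := hx'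
    have hle := hmax 0 _ (Finset.mem_Icc.1 hx)
    rcases interleave_cases A (fun i => A i + 1) (show j < 2 * d + 2 by omega) with
      ⟨i, -, h⟩ | ⟨i, rfl, -⟩
    · have hge := hmax i _ (hAm 0)
      rw [h] at hle ⊢
      rw [le_antisymm hle hge, sub_self, mul_zero]
    · have := hc2 _ hj
      rw [Odd.neg_one_pow ⟨d + i, by ring⟩] at this
      exact mul_nonneg_of_nonpos_of_nonpos (by linarith) (by linarith)
  simp_rw [mul_sub] at h2
  rw [Finset.sum_sub_distrib, ← Finset.sum_mul, hc0, zero_mul, sub_zero, h1] at h2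
  exact absurd h2 (not_le.2 (mul_neg_of_pos_of_neg hc5 hl))

/-- Every union of few labels, or of few labels with an adjacent pair, lies in a union of adjacent
pairs. -/
theorem exists_side_nonneg (ht : StrictMono t) (m : ℕ) : ∀ (d : ℕ) (A : Finset ℕ),
    A ⊆ Finset.Icc 1 m → 2 * d ≤ m →
    (A.card ≤ d ∨ A.card ≤ d + 1 ∧ ∃ j ∈ A, j + 1 ∈ A) →
    ∃ Z ⊆ Finset.Icc 1 m, Z.card = 2 * d ∧ A ⊆ Z ∧ ∀ x ∈ Finset.Icc 1 m, 0 ≤ side t Z x := by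
  induction m using Nat.strong_induction_on with
  | _ m ih =>
    intro d A hA hdm hcard
    rcases eq_or_lt_of_le hdm with heq | hlt
    · exact ⟨_, subset_refl _, by rw [Nat.card_Icc]; omega, hA, fun x hx =>
        ((side_eq_zero_iff ht).2 hx).ge⟩
    by_cases hmA : m ∈ A
    swap
    · have hA' : A ⊆ Finset.Icc 1 (m - 1) := fun x hx => by
        have h1 := Finset.mem_Icc.1 (hA hx)
        have : x ≠ m := fun h => hmA (h ▸ hx)
        exact Finset.mem_Icc.2 ⟨h1.1, by omega⟩
      obtain ⟨Z, hZ, hZc, hAZ, hside⟩ := ih (m - 1) (by omega) d A hA' (by omega) hcard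
      refine ⟨Z, hZ.trans (Finset.Icc_subset_Icc_right (by omega)), hZc, hAZ, fun x hx => ?_⟩
      have hx := Finset.mem_Icc.1 hx
      rcases eq_or_lt_of_le hx.2 with rfl | hxm
      · refine (side_pos_of_forall_lt ht fun f hf => ?_).le
        have := Finset.mem_Icc.1 (hZ hf)
        omega
      · exact hside x (Finset.mem_Icc.2 ⟨hx.1, by omega⟩)
    · have hd : 1 ≤ d := by
        rcases hcard with h | ⟨h, j, hj, hj'⟩
        · exact (Finset.card_pos.2 ⟨m, hmA⟩).trans_le h
        · have : ({j, j + 1} : Finset ℕ) ⊆ A := by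
            intro x hx
            rcases Finset.mem_insert.1 hx with rfl | hx
            · exact hj
            · rwa [Finset.mem_singleton.1 hx]
          have h2 := Finset.card_le_card this
          rw [Finset.card_pair (by omega)] at h2
          omega
      -- The pair `m - 1, m` is spent on covering `m`. On labels up to `m - 2` the two factors it
      -- adds to `side` are both nonpositive.
      set A' := (A.erase m).erase (m - 1) with hA'
      have hA'm : A' ⊆ Finset.Icc 1 (m - 2) := fun x hx => by
        obtain ⟨h1, h2⟩ := Finset.mem_erase.1 hx
        obtain ⟨h2, h3⟩ := Finset.mem_erase.1 h2
        have := Finset.mem_Icc.1 (hA h3)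
        exact Finset.mem_Icc.2 ⟨this.1, by omega⟩
      have hle : A'.card + 1 ≤ A.card := by
        have h1 : A'.card ≤ (A.erase m).card := Finset.card_le_card (Finset.erase_subset _ _)
        have h2 := Finset.card_erase_add_one hmA
        omega
      have hcard' : A'.card ≤ d - 1 ∨ A'.card ≤ (d - 1) + 1 ∧ ∃ j ∈ A', j + 1 ∈ A' := by
        rcases hcard with h | ⟨h, j, hj, hj'⟩
        · left; omega
        · by_cases hm1 : m - 1 ∈ A
          · have h1 : A'.card + 1 = (A.erase m).card :=
              Finset.card_erase_add_one (Finset.mem_erase.2 ⟨by omega, hm1⟩)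
            have h2 := Finset.card_erase_add_one hmA
            left; omega
          · have h1 : j + 1 ≠ m := by rintro rfl; exact hm1 hj
            have h2 : j + 1 ≠ m - 1 := fun h => hm1 (h ▸ hj')
            have h3 := Finset.mem_Icc.1 (hA hj')
            exact Or.inr ⟨by omega, j, Finset.mem_erase.2 ⟨by omega,
              Finset.mem_erase.2 ⟨by omega, hj⟩⟩, Finset.mem_erase.2 ⟨h2, Finset.mem_erase.2 ⟨h1, hj'⟩⟩⟩
      obtain ⟨Z, hZ, hZc, hAZ, hside⟩ := ih (m - 2) (by omega) (d - 1) A' hA'm (by omega) hcard'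
      have hm1Z : m - 1 ∉ Z := fun h => by have := Finset.mem_Icc.1 (hZ h); omega
      have hmZ : m ∉ insert (m - 1) Z := fun h => by
        rcases Finset.mem_insert.1 h with h | h
        · omega
        · have := Finset.mem_Icc.1 (hZ h); omega
      refine ⟨insert m (insert (m - 1) Z), fun x hx => ?_, ?_, fun x hx => ?_, fun x hx => ?_⟩
      · rcases Finset.mem_insert.1 hx with rfl | hx
        · exact Finset.mem_Icc.2 ⟨by omega, le_rfl⟩
        · rcases Finset.mem_insert.1 hx with rfl | hx
          · exact Finset.mem_Icc.2 ⟨by omega, by omega⟩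
          · exact Finset.Icc_subset_Icc_right (by omega) (hZ hx)
      · rw [Finset.card_insert_of_notMem hmZ, Finset.card_insert_of_notMem hm1Z]
        omega
      · by_cases h1 : x = m
        · rw [h1]; exact Finset.mem_insert_self _ _
        · by_cases h2 : x = m - 1
          · rw [h2]; exact Finset.mem_insert_of_mem (Finset.mem_insert_self _ _)
          · exact Finset.mem_insert_of_mem (Finset.mem_insert_of_mem
              (hAZ (Finset.mem_erase.2 ⟨h2, Finset.mem_erase.2 ⟨h1, hx⟩⟩)))
      · rw [side_insert hmZ, side_insert hm1Z, ← mul_assoc]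
        have hx := Finset.mem_Icc.1 hx
        by_cases h : x ≤ m - 2
        · refine mul_nonneg (mul_nonneg_of_nonpos_of_nonpos ?_ ?_)
            (hside x (Finset.mem_Icc.2 ⟨hx.1, h⟩))
          · exact sub_nonpos.2 (ht.monotone hx.2)
          · exact sub_nonpos.2 (ht.monotone (by omega))
        · have : x = m ∨ x = m - 1 := by omega
          rcases this with rfl | rfl <;> simp

/-- The hull of an even union of adjacent pairs is a lower facet. -/
theorem exists_lowerFacet (ht : StrictMono t) (hd : 1 ≤ d) {m : ℕ} {Z : Finset ℕ}
    (hZm : Z ⊆ Finset.Icc 1 m) (hZ : Z.card = 2 * d)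
    (hside : ∀ x ∈ Finset.Icc 1 m, 0 ≤ side t Z x) :
    ∃ F, IsLowerFacet (2 * d) m t F ∧ labelHull (2 * d) t Z ⊆ F := by
  classical
  set q := sidePoly t Z with hq
  -- Minus the nonconstant part of the polynomial with roots at `Z`. On the curve this is `q.coeff 0
  -- - side t Z x`, maximal on `Z`; monicity gives the value `-1` on the upward vector.
  let l : (Fin (2 * d) → ℝ) →L[ℝ] ℝ :=
    ∑ j : Fin (2 * d), (-q.coeff (j + 1)) • ContinuousLinearMap.proj (R := ℝ) j
  have hl : ∀ v, l v = ∑ j : Fin (2 * d), -q.coeff (j + 1) * v j := fun v => by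
    simp [l]
  have hlp : ∀ x, l (momentPoint (2 * d) (t x)) = q.coeff 0 - side t Z x := fun x => by
    rw [hl, ← eval_sidePoly, Polynomial.eval_eq_sum_range, natDegree_sidePoly, hZ,
      Finset.sum_range_succ', pow_zero, mul_one, Finset.sum_range, ← hq]
    simp [momentPoint]
  have hup : l (upVector (2 * d)) = -1 := by
    have hmon : q.coeff (2 * d) = 1 := by
      rw [← hZ, ← natDegree_sidePoly (t := t) Z]
      exact sidePoly_monic Z
    rw [hl, Finset.sum_eq_single ⟨2 * d - 1, by omega⟩]
    · simp only [upVector, Nat.sub_add_cancel (show 1 ≤ 2 * d by omega), hmon]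
      simp
    · intro j _ hj
      have : (j : ℕ) + 1 ≠ 2 * d := fun h => hj (Fin.ext (by simp; omega))
      simp [upVector, this]
    · simp
  have hle : ∀ y ∈ cyclicPolytope (2 * d) m t, l y ≤ q.coeff 0 := fun y hy => by
    refine convexHull_min (t := {y | l y ≤ q.coeff 0}) ?_
      (convex_halfSpace_le l.isLinear _) hy
    rintro _ ⟨x, hx, rfl⟩
    change l (momentPoint (2 * d) (t x)) ≤ _
    rw [hlp]
    linarith [hside x (Finset.mem_Icc.2 hx)]
  have heq : ∀ y ∈ labelHull (2 * d) t Z, l y = q.coeff 0 := fun y hy => by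
    refine convexHull_min (t := {y | l y = q.coeff 0}) ?_
      (convex_hyperplane l.isLinear _) hy
    rintro _ ⟨x, hx, rfl⟩
    change l (momentPoint (2 * d) (t x)) = _
    rw [hlp, (side_eq_zero_iff ht).2 hx, sub_zero]
  have hZF : labelHull (2 * d) t Z ⊆ l.toExposed (cyclicPolytope (2 * d) m t) := fun y hy => by
    refine ⟨labelHull_mono (fun x hx => Finset.mem_Icc.1 (hZm hx)) hy, fun z hz => ?_⟩
    rw [heq y hy]
    exact hle z hz
  refine ⟨l.toExposed (cyclicPolytope (2 * d) m t), ⟨?_, l, by rw [hup]; norm_num, rfl⟩, hZF⟩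
  have hne : (l : (Fin (2 * d) → ℝ) →ₗ[ℝ] ℝ) ≠ 0 := fun h => by
    have := LinearMap.congr_fun h (upVector (2 * d))
    rw [ContinuousLinearMap.coe_coe, hup] at this
    norm_num at this
  have hker := Module.Dual.finrank_ker_add_one_of_ne_zero (f := (l : (Fin (2 * d) → ℝ) →ₗ[ℝ] ℝ)) hne
  rw [Module.finrank_fintype_fun_eq_card, Fintype.card_fin] at hker
  refine le_antisymm ?_ ?_
  · refine le_trans (Nat.add_le_add_right (Submodule.finrank_mono ?_) 1) hker.le
    rw [vectorSpan_def, Submodule.span_le]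
    rintro _ ⟨x, hx, y, hy, rfl⟩
    have h1 := hx.2 y hy.1
    have h2 := hy.2 x hx.1
    change l (x - y) = 0
    rw [map_sub, le_antisymm h2 h1, sub_self]
  · have hind : LabelsIndep (2 * d) t Z := labelsIndep_of_card_le ht (by omega)
    have h1 := hind.finrank_vectorSpan (n := 2 * d - 1) (by rw [Fintype.card_coe, hZ]; omega)
    have h2 : vectorSpan ℝ (Set.range fun i : Z => momentPoint (2 * d) (t i)) ≤
        vectorSpan ℝ (l.toExposed (cyclicPolytope (2 * d) m t)) := by
      refine vectorSpan_mono ℝ ?_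
      rintro _ ⟨i, rfl⟩
      exact hZF (momentPoint_mem_labelHull i.2)
    have h3 := Submodule.finrank_mono h2
    rw [h1] at h3
    omega

/-- A tuple with two adjacent entries is on a lower facet by Gale's condition, a gapped one is not.
This makes `eSet` combinatorial. -/
theorem mem_eSet (ht : StrictMono t) (hd : 1 ≤ d) {m : ℕ} (hm : 2 * d + 1 ≤ m)
    {S : Finset (Finset ℕ)} {A : Fin (d + 1) → ℕ} :
    A ∈ eSet d m t S ↔ A ∈ separatedTuples d m ∧ ∃ σ ∈ S, ∀ i, A i ∈ σ := by
  classical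
  constructor
  · rintro ⟨hA, hAm, ⟨σ, hσ, hAσ⟩, hF⟩
    refine ⟨⟨hAm, ?_⟩, σ, hσ, fun i => hAσ ⟨i, rfl⟩⟩
    by_contra! h
    obtain ⟨i, hi⟩ := h
    have hlt := hA (Fin.castSucc_lt_succ (i := i))
    obtain ⟨Z, hZm, hZc, hAZ, hside⟩ := exists_side_nonneg ht m d (Finset.univ.image A)
      (fun x hx => by
        obtain ⟨i, -, rfl⟩ := Finset.mem_image.1 hx
        exact Finset.mem_Icc.2 (hAm i)) (by omega)
      (Or.inr ⟨by rw [Finset.card_image_of_injective _ hA.injective]; simp, A i.castSucc,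
        Finset.mem_image_of_mem _ (Finset.mem_univ _), by
          rw [show A i.castSucc + 1 = A i.succ by omega]
          exact Finset.mem_image_of_mem _ (Finset.mem_univ _)⟩)
    obtain ⟨F, hF1, hF2⟩ := exists_lowerFacet ht hd hZm hZc hside
    refine hF F hF1 (Set.Subset.trans (labelHull_mono ?_) hF2)
    rintro _ ⟨i, rfl⟩
    exact hAZ (Finset.mem_image_of_mem _ (Finset.mem_univ i))
  · rintro ⟨hA, σ, hσ, hAσ⟩
    have hg : Gapped A := hA.2
    exact ⟨hg.strictMono, hA.1, ⟨σ, hσ, by rintro _ ⟨i, rfl⟩; exact hAσ i⟩,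
      fun F hF => not_labelHull_subset_of_gapped ht hd hg hA.1 hF⟩

end LowerFacets

/-! ### Triangulations as maximal non-intertwining sets -/

section Correspondence

variable {d m : ℕ} {t : ℕ → ℝ}

/-- The compatible simplices of a set of tuples. -/
noncomputable def compatSimplices (m : ℕ) (R : Set (Fin (d + 1) → ℕ)) : Finset (Finset ℕ) := by
  classical
  exact ((Finset.Icc 1 m).powersetCard (2 * d + 1)).filter (Compat R)

theorem mem_compatSimplices {R : Set (Fin (d + 1) → ℕ)} {σ : Finset ℕ} :
    σ ∈ compatSimplices m R ↔ σ ⊆ Finset.Icc 1 m ∧ σ.card = 2 * d + 1 ∧ Compat R σ := by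
  simp [compatSimplices, Finset.mem_powersetCard, and_assoc]

/-- The positive and negative parts of the circuit would represent the same point in the two
simplices, against uniqueness. -/
theorem WeightTriangulation.not_intertwines (ht : StrictMono t) {V : Finset ℕ}
    {S : Finset (Finset ℕ)} (h : WeightTriangulation (2 * d) t V S) {σ τ : Finset ℕ} (hσ : σ ∈ S)
    (hτ : τ ∈ S) {X Y : Fin (d + 1) → ℕ} (hX : ∀ i, X i ∈ σ) (hY : ∀ i, Y i ∈ τ) :
    ¬ Intertwines X Y := by
  intro hXY
  obtain ⟨c, hc1, hc2, hc3, hc4⟩ := exists_circuit_of_intertwines ht (Or.inl hXY)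
  have hV := hc4 V (fun i => h.subset σ hσ (hX i)) fun i => h.subset τ hτ (hY i)
  have huv := h.unique σ hσ τ hτ (fun x => max (-c x) 0) (fun x => max (c x) 0)
    (fun x => le_max_right _ _) (fun x => le_max_right _ _) (fun x hx => ?_) (fun x hx => ?_)
    fun k hk => ?_
  · have := congrFun huv (X 0)
    simp only [max_eq_right (hc1 0).le] at this
    linarith [le_max_left (-c (X 0)) 0, hc1 0]
  · by_cases hxY : ∃ i, x = Y i
    · obtain ⟨i, rfl⟩ := hxY
      exact max_eq_right (by linarith [hc2 i])
    · simp [hc3 x (fun i h => hx (h ▸ hX i)) (not_exists.1 hxY)]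
  · by_cases hxX : ∃ i, x = X i
    · obtain ⟨i, rfl⟩ := hxX
      exact max_eq_right (hc1 i).le
    · simp [hc3 x (not_exists.1 hxX) fun i h => hx (h ▸ hY i)]
  · have hsum : ∑ x ∈ V, max (c x) 0 * t x ^ k - ∑ x ∈ V, max (-c x) 0 * t x ^ k =
        ∑ x ∈ V, c x * t x ^ k := by
      rw [← Finset.sum_sub_distrib]
      refine Finset.sum_congr rfl fun x _ => ?_
      rcases le_total (c x) 0 with hx | hx
      · rw [max_eq_left (show 0 ≤ -c x by linarith), max_eq_right hx]; ring
      · rw [max_eq_right (show -c x ≤ 0 by linarith), max_eq_left hx]; ring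
    rw [hV k hk, sub_eq_zero] at hsum
    exact hsum.symm

theorem isCyclicTriangulation_iff (ht : StrictMono t) (hm : 1 ≤ m) {δ : ℕ}
    {S : Finset (Finset ℕ)} :
    IsCyclicTriangulation δ m t S ↔ WeightTriangulation δ t (Finset.Icc 1 m) S := by
  rw [IsCyclicTriangulation, ← isTriangulationOf_iff ht (Finset.nonempty_Icc.2 hm),
    Finset.coe_Icc]

theorem eSet_subset (S : Finset (Finset ℕ)) (ht : StrictMono t) (hd : 1 ≤ d)
    (hm : 2 * d + 1 ≤ m) : eSet d m t S ⊆ separatedTuples d m := fun _ hA =>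
  ((mem_eSet ht hd hm).1 hA).1

theorem nonIntertwining_eSet (ht : StrictMono t) (hd : 1 ≤ d) (hm : 2 * d + 1 ≤ m)
    {S : Finset (Finset ℕ)} (hS : IsCyclicTriangulation (2 * d) m t S) :
    NonIntertwining (eSet d m t S) := by
  intro X hX Y hY
  obtain ⟨-, σ, hσ, hXσ⟩ := (mem_eSet ht hd hm).1 hX
  obtain ⟨-, τ, hτ, hYτ⟩ := (mem_eSet ht hd hm).1 hY
  exact ((isCyclicTriangulation_iff ht (by omega)).1 hS).not_intertwines ht hσ hτ hXσ hYτ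

theorem compat_eSet (ht : StrictMono t) (hd : 1 ≤ d) (hm : 2 * d + 1 ≤ m)
    {S : Finset (Finset ℕ)} (hS : IsCyclicTriangulation (2 * d) m t S) {σ : Finset ℕ}
    (hσ : σ ∈ S) : Compat (eSet d m t S) σ := fun _ hC hCσ =>
  (mem_eSet ht hd hm).2 ⟨mem_separatedTuples.2 ⟨fun i =>
    ((isCyclicTriangulation_iff ht (by omega)).1 hS).subset σ hσ (hCσ i), hC⟩, σ, hσ, hCσ⟩

theorem facetExtension_eSet (ht : StrictMono t) (hd : 1 ≤ d) (hm : 2 * d + 1 ≤ m)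
    {S : Finset (Finset ℕ)} (hS : IsCyclicTriangulation (2 * d) m t S) :
    FacetExtension t m (eSet d m t S) := by
  have hcov : Covers t m (eSet d m t S) := fun μ hμ => by
    have hW := (isCyclicTriangulation_iff ht (by omega)).1 hS
    obtain ⟨σ, hσ, w, hw0, hwσ, hw⟩ := hW.cover μ hμ
    refine ⟨σ, hW.subset σ hσ, hW.card σ hσ, compat_eSet ht hd hm hS hσ, fun i hi => ?_⟩
    rw [coord_eq_of_moments ht (hW.subset σ hσ) hwσ (fun k hk => hw k (by rwa [hW.card σ hσ] at hk))
      hi]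
    exact hw0 i
  exact hcov.weaklyCovers.facetExtension ht (nonIntertwining_eSet ht hd hm hS)

/-- A triangulation consists of the simplices that are compatible with its set of tuples. -/
theorem eq_compatSimplices_eSet (ht : StrictMono t) (hd : 1 ≤ d) (hm : 2 * d + 1 ≤ m)
    {S : Finset (Finset ℕ)} (hS : IsCyclicTriangulation (2 * d) m t S) :
    S = compatSimplices m (eSet d m t S) := by
  classical
  have hW := (isCyclicTriangulation_iff ht (by omega)).1 hS
  ext σ
  rw [mem_compatSimplices]
  refine ⟨fun hσ => ⟨hW.subset σ hσ, hW.card σ hσ, compat_eSet ht hd hm hS hσ⟩, ?_⟩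
  rintro ⟨hσV, hσcard, hσ⟩
  have h0 : ∀ i, (0 : ℝ) ≤ if i ∈ σ then 1 else 0 := fun i => by split_ifs <;> norm_num
  obtain ⟨τ, hτ, w, hw0, hwτ, hw⟩ := hW.cover (fun i => if i ∈ σ then 1 else 0) h0
  have huv := eq_of_compat_supports ht (nonIntertwining_eSet ht hd hm hS) _ σ τ hσ
    (compat_eSet ht hd hm hS hτ) h0 hw0 (fun x hx => if_neg hx) hwτ fun k hk => (hw k hk).symm
  have hστ : σ ⊆ τ := fun x hx => by
    by_contra h
    have := huv x (hσV hx)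
    rw [if_pos hx, hwτ x h] at this
    exact one_ne_zero this
  rwa [Finset.eq_of_subset_of_card_le hστ (by rw [hW.card τ hτ, hσcard])]

theorem isCyclicTriangulation_compatSimplices (ht : StrictMono t) (hm : 2 * d + 1 ≤ m)
    {R : Set (Fin (d + 1) → ℕ)} (hR : NonIntertwining R) (hF : FacetExtension t m R) :
    IsCyclicTriangulation (2 * d) m t (compatSimplices m R) := by
  classical
  rw [isCyclicTriangulation_iff ht (by omega)]
  refine ⟨fun σ hσ => (mem_compatSimplices.1 hσ).1, fun σ hσ => (mem_compatSimplices.1 hσ).2.1,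
    fun μ hμ => ?_, fun σ hσ τ hτ u v hu hv huσ hvτ huv => ?_⟩
  · obtain ⟨σ, hσV, hσcard, hσc, hco⟩ := hF.covers ht hm μ hμ
    refine ⟨σ, mem_compatSimplices.2 ⟨hσV, hσcard, hσc⟩,
      fun i => if i ∈ σ then coord t (Finset.Icc 1 m) σ μ i else 0, fun i => ?_,
      fun i hi => if_neg hi, fun k hk => ?_⟩
    · change 0 ≤ if i ∈ σ then coord t (Finset.Icc 1 m) σ μ i else 0
      split_ifs with hi
      exacts [hco i hi, le_rfl]
    · rw [← sum_coord_mul_pow ht _ σ μ k (by omega)]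
      rw [← Finset.sum_subset hσV fun i _ hi => by simp only [if_neg hi, zero_mul]]
      exact Finset.sum_congr rfl fun i hi => by simp only [if_pos hi]
  · obtain ⟨hσV, -, hσc⟩ := mem_compatSimplices.1 hσ
    obtain ⟨hτV, -, hτc⟩ := mem_compatSimplices.1 hτ
    ext i
    by_cases hi : i ∈ Finset.Icc 1 m
    · exact eq_of_compat_supports ht hR _ σ τ hσc hτc hu hv huσ hvτ huv i hi
    · rw [huσ i fun h => hi (hσV h), hvτ i fun h => hi (hτV h)]

theorem eSet_compatSimplices (ht : StrictMono t) (hd : 1 ≤ d) (hm : 2 * d + 1 ≤ m)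
    {R : Set (Fin (d + 1) → ℕ)} (hRs : R ⊆ separatedTuples d m) (hR : NonIntertwining R)
    (hF : FacetExtension t m R) : eSet d m t (compatSimplices m R) = R := by
  ext A
  rw [mem_eSet ht hd hm]
  constructor
  · rintro ⟨hA, σ, hσ, hAσ⟩
    exact (mem_compatSimplices.1 hσ).2.2 A (mem_separatedTuples.1 hA).2 hAσ
  · intro hA
    have hA' := mem_separatedTuples.1 (hRs hA)
    obtain ⟨σ, hσV, hσcard, hσc, hAσ⟩ := (hF.covers ht hm).exists_superset ht (subset_refl _) hR
      (F := Finset.univ.image A) (fun x hx => by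
        obtain ⟨i, -, rfl⟩ := Finset.mem_image.1 hx
        exact hA'.1 i) (compat_image_of_mem hA'.2.strictMono hA)
    exact ⟨hRs hA, σ, mem_compatSimplices.2 ⟨hσV, hσcard, hσc⟩,
      fun i => hAσ (Finset.mem_image_of_mem _ (Finset.mem_univ i))⟩

theorem ncard_eSet (ht : StrictMono t) (hd : 1 ≤ d) (hm : 2 * d + 1 ≤ m)
    {S : Finset (Finset ℕ)} (hS : IsCyclicTriangulation (2 * d) m t S) :
    (eSet d m t S).ncard = (m - d - 1).choose d :=
  (facetExtension_iff_ncard ht d m hm (eSet_subset S ht hd hm)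
    (nonIntertwining_eSet ht hd hm hS)).1 (facetExtension_eSet ht hd hm hS)

/-- The geometric existence question becomes a count, which reduces complements and exchangeability
to combinatorics. -/
theorem exists_eSet_eq_iff (ht : StrictMono t) (hd : 1 ≤ d) (hm : 2 * d + 1 ≤ m)
    {R : Set (Fin (d + 1) → ℕ)} :
    (∃ S, IsCyclicTriangulation (2 * d) m t S ∧ eSet d m t S = R) ↔
      R ⊆ separatedTuples d m ∧ NonIntertwining R ∧ R.ncard = (m - d - 1).choose d := by
  constructor
  · rintro ⟨S, hS, rfl⟩
    exact ⟨eSet_subset S ht hd hm, nonIntertwining_eSet ht hd hm hS, ncard_eSet ht hd hm hS⟩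
  · rintro ⟨hRs, hR, hcard⟩
    have hF := (facetExtension_iff_ncard ht d m hm hRs hR).2 hcard
    exact ⟨_, isCyclicTriangulation_compatSimplices ht hm hR hF,
      eSet_compatSimplices ht hd hm hRs hR hF⟩

theorem isComplement_iff (ht : StrictMono t) (hd : 1 ≤ d) (hm : 2 * d + 1 ≤ m)
    {R : Set (Fin (d + 1) → ℕ)} {A : Fin (d + 1) → ℕ} :
    IsComplement d m t A R ↔ A ∈ separatedTuples d m ∧ R ⊆ separatedTuples d m ∧ A ∉ R ∧
      NonIntertwining (insert A R) ∧ R.ncard + 1 = (m - d - 1).choose d := by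
  rw [IsComplement, exists_eSet_eq_iff ht hd hm, Set.union_singleton]
  constructor
  · rintro ⟨hA, hRs, -, hAR, -, hR, hcard⟩
    rw [Set.ncard_insert_of_notMem hAR ((finite_separatedTuples d m).subset hRs)] at hcard
    exact ⟨hA, hRs, hAR, hR, hcard⟩
  · rintro ⟨hA, hRs, hAR, hR, hcard⟩
    refine ⟨hA, hRs, hR.mono (Set.subset_insert _ _), hAR, Set.insert_subset hA hRs, hR, ?_⟩
    rw [Set.ncard_insert_of_notMem hAR ((finite_separatedTuples d m).subset hRs), hcard]

theorem facetExtension_of_isComplement (ht : StrictMono t) (hd : 1 ≤ d) (hm : 2 * d + 1 ≤ m)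
    {R : Set (Fin (d + 1) → ℕ)} {A : Fin (d + 1) → ℕ} (h : IsComplement d m t A R) :
    FacetExtension t m (insert A R) := by
  obtain ⟨-, -, -, -, S, hS, heS⟩ := h
  rw [← Set.union_singleton, ← heS]
  exact facetExtension_eSet ht hd hm hS

end Correspondence

/-! ### Exchangeable tuples and the sets they both complete -/

section ExchangeableTuples

variable {d m : ℕ} {t : ℕ → ℝ}

/-- Otherwise `R` together with both tuples would be non-intertwining and exceed the maximal size by
one. -/
theorem intertwines_of_isComplement (ht : StrictMono t) (hd : 1 ≤ d) (hm : 2 * d + 1 ≤ m)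
    {R : Set (Fin (d + 1) → ℕ)} {A B : Fin (d + 1) → ℕ} (hAB : A ≠ B)
    (hA : IsComplement d m t A R) (hB : IsComplement d m t B R) :
    Intertwines A B ∨ Intertwines B A := by
  obtain ⟨hAs, hRs, hAR, hA, hcard⟩ := (isComplement_iff ht hd hm).1 hA
  obtain ⟨hBs, -, hBR, hB, -⟩ := (isComplement_iff ht hd hm).1 hB
  by_contra! h
  have hins : NonIntertwining (insert B (insert A R)) := hA.insert fun C hC => by
    rcases Set.mem_insert_iff.1 hC with rfl | hC
    · exact ⟨h.2, h.1⟩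
    · exact ⟨hB B (Set.mem_insert _ _) C (Set.mem_insert_of_mem _ hC),
        hB C (Set.mem_insert_of_mem _ hC) B (Set.mem_insert _ _)⟩
  have hAs' : insert A R ⊆ separatedTuples d m := Set.insert_subset hAs hRs
  have hle := NonIntertwining.ncard_le d m (Set.insert_subset hBs hAs') hins
  rw [Set.ncard_insert_of_notMem _ ((finite_separatedTuples d m).subset hAs'),
    Set.ncard_insert_of_notMem hAR ((finite_separatedTuples d m).subset hRs)] at hle
  · omega
  · rw [Set.mem_insert_iff]
    exact fun h => h.elim (fun h => hAB h.symm) hBR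

/-- A tuple other than `B` that belongs to a non-intertwining set with the further tuples from
`A ∪ B` does not cross `A`. -/
theorem nonIntertwining_insert_of_pair (hd : 1 ≤ d) {R : Set (Fin (d + 1) → ℕ)}
    (hR : NonIntertwining R) {A B : Fin (d + 1) → ℕ} (hA : A ∈ separatedTuples d m)
    (hB : B ∈ separatedTuples d m) (hAB : Intertwines A B ∨ Intertwines B A) (hBR : B ∉ R)
    (hpair : ∀ C ∈ separatedTuples d m, (∀ i, C i ∈ Set.range A ∪ Set.range B) → C ≠ A → C ≠ B →
      C ∈ R) : NonIntertwining (insert A R) := by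
  have key : ∀ C ∈ R, ¬ (Intertwines C A ∨ Intertwines A C) := fun C hC hCA => by
    obtain ⟨D, hD, hDA, hDB, hCD⟩ := exists_intertwines_of_intertwines hd hAB hCA
      (fun h => hBR (h ▸ hC))
    have hDR : D ∈ R := by
      refine hpair D (mem_separatedTuples.2 ⟨fun i => ?_, ?_⟩) hD hDA hDB
      · rcases hD i with ⟨j, hj⟩ | ⟨j, hj⟩
        · rw [← hj]; exact (mem_separatedTuples.1 hA).1 j
        · rw [← hj]; exact (mem_separatedTuples.1 hB).1 j
      · exact hCD.elim Intertwines.gapped_right Intertwines.gapped_left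
    exact hCD.elim (hR C hC D hDR) (hR D hDR C hC)
  exact hR.insert fun C hC => ⟨fun h => key C hC (Or.inr h), fun h => key C hC (Or.inl h)⟩

theorem exchangeable_iff (ht : StrictMono t) (hd : 1 ≤ d) (hm : 2 * d + 1 ≤ m)
    {A B : Fin (d + 1) → ℕ} (hA : A ∈ separatedTuples d m) (hB : B ∈ separatedTuples d m) :
    Exchangeable d m t A B ↔ Intertwines A B ∨ Intertwines B A := by
  constructor
  · rintro ⟨hne, R, hAR, hBR⟩
    exact intertwines_of_isComplement ht hd hm hne hAR hBR
  · intro hAB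
    have hne : A ≠ B := fun h => ne_of_intertwines hAB 0 0 (by rw [h])
    -- This set contains every separated tuple on `A ∪ B` except `B`. With `A` removed, `B` fits in:
    -- a remaining tuple crossing `B` would also cross a remaining tuple on `A ∪ B`.
    obtain ⟨R, hRs, hR, hF, hpair⟩ := exists_facetExtension_of_intertwines ht hm hAB
    have hcard := (facetExtension_iff_ncard ht d m hm hRs hR).1 hF
    have hAR : A ∈ R := hpair A hA (fun i => Or.inl ⟨i, rfl⟩) hne
    have hBR : B ∉ R := fun h => hAB.elim (hR A hAR B h) (hR B h A hAR)
    have hcard' : (R \ {A}).ncard + 1 = R.ncard :=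
      Set.ncard_sdiff_singleton_add_one hAR ((finite_separatedTuples d m).subset hRs)
    have hsub : R \ {A} ⊆ separatedTuples d m := Set.sdiff_subset.trans hRs
    refine ⟨hne, R \ {A}, (isComplement_iff ht hd hm).2 ⟨hA, hsub, fun h => h.2 rfl, ?_, ?_⟩,
      (isComplement_iff ht hd hm).2 ⟨hB, hsub, fun h => hBR h.1, ?_, ?_⟩⟩
    · rwa [Set.insert_sdiff_singleton, Set.insert_eq_of_mem hAR]
    · omega
    · refine nonIntertwining_insert_of_pair hd (hR.mono Set.sdiff_subset) hB hA hAB.symm (fun h => h.2 rfl)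
        fun C hC hCAB hCB hCA => ⟨hpair C hC (fun i => (hCAB i).symm) hCB, hCA⟩
    · omega

/-- The tuples from the vertices of an exchangeable pair belong to every set that the two complete
to a triangulation. -/
theorem mem_of_isComplement (ht : StrictMono t) (hd : 1 ≤ d) (hm : 2 * d + 1 ≤ m)
    {R : Set (Fin (d + 1) → ℕ)} {A B : Fin (d + 1) → ℕ} (hne : A ≠ B)
    (hA : IsComplement d m t A R) (hB : IsComplement d m t B R) {C : Fin (d + 1) → ℕ}
    (hC : C ∈ separatedTuples d m) (hCAB : ∀ i, C i ∈ Set.range A ∪ Set.range B) (hCA : C ≠ A)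
    (hCB : C ≠ B) : C ∈ R := by
  classical
  have hAB := intertwines_of_isComplement ht hd hm hne hA hB
  have hg : Gapped C := (mem_separatedTuples.1 hC).2
  -- Since `C ≠ B`, it misses some `B j` and lies in the compatible simplex omitting that entry.
  obtain ⟨j, hj⟩ : ∃ j, ∀ i, C i ≠ B j := by
    by_contra! h
    exact hCB (eq_of_forall_mem_range (mem_separatedTuples.1 hB.1).2.strictMono hg.strictMono h).symm
  have hcomp := compat_erase_of_exchange ht hm hA.1 hB.1 hAB hA.2.2.2.1 hB.2.2.2.1
    ((isComplement_iff ht hd hm).1 hA).2.2.2.1 (facetExtension_of_isComplement ht hd hm hA)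
    (facetExtension_of_isComplement ht hd hm hB) j
  exact (Set.mem_insert_iff.1 (hcomp C hg fun i => Finset.mem_erase.2
    ⟨hj i, mem_pairSupport.2 (hCAB i)⟩)).resolve_left hCA

theorem isComplement_and_isComplement_iff (ht : StrictMono t) (hd : 1 ≤ d) (hm : 2 * d + 1 ≤ m)
    {A B : Fin (d + 1) → ℕ} (hE : Exchangeable d m t A B) (R : Set (Fin (d + 1) → ℕ)) :
    IsComplement d m t A R ∧ IsComplement d m t B R ↔
      R ⊆ separatedTuples d m \ {A, B} ∧ NonIntertwining R ∧
        R.ncard = (m - d - 1).choose d - 1 ∧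
        ∀ C ∈ separatedTuples d m, (∀ i, C i ∈ Set.range A ∪ Set.range B) →
          C ≠ A → C ≠ B → C ∈ R := by
  have hA : A ∈ separatedTuples d m := hE.2.choose_spec.1.1
  have hB : B ∈ separatedTuples d m := hE.2.choose_spec.2.1
  have hAB := (exchangeable_iff ht hd hm hA hB).1 hE
  have hpos : 0 < (m - d - 1).choose d := Nat.choose_pos (by omega)
  constructor
  · rintro ⟨hAR, hBR⟩
    refine ⟨fun C hC => ⟨hAR.2.1 hC, ?_⟩, hAR.2.2.1, ?_, fun C hC hCAB hCA hCB =>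
      mem_of_isComplement ht hd hm hE.1 hAR hBR hC hCAB hCA hCB⟩
    · rintro (rfl | rfl)
      · exact hAR.2.2.2.1 hC
      · exact hBR.2.2.2.1 hC
    · have := ((isComplement_iff ht hd hm).1 hAR).2.2.2.2
      omega
  · rintro ⟨hRs, hR, hcard, hpair⟩
    have hRs' : R ⊆ separatedTuples d m := fun C hC => (hRs hC).1
    have hAR : A ∉ R := fun h => (hRs h).2 (Or.inl rfl)
    have hBR : B ∉ R := fun h => (hRs h).2 (Or.inr rfl)
    exact ⟨(isComplement_iff ht hd hm).2 ⟨hA, hRs', hAR,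
        nonIntertwining_insert_of_pair hd hR hA hB hAB hBR hpair, by omega⟩,
      (isComplement_iff ht hd hm).2 ⟨hB, hRs', hBR,
        nonIntertwining_insert_of_pair hd hR hB hA hAB.symm hAR fun C hC hCAB hCB hCA =>
          hpair C hC (fun i => (hCAB i).symm) hCA hCB, by omega⟩⟩

end ExchangeableTuples

/-! ### Bistellar flips -/

section Flips

variable {d m : ℕ} {t : ℕ → ℝ}

/-- The barycentre of a simplex `σ` of `S'` is covered by a simplex of `S`, and uniqueness in `S'`
forces `σ` into that simplex. -/
theorem WeightTriangulation.eq_of_subset {δ : ℕ} {V : Finset ℕ} {S S' : Finset (Finset ℕ)}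
    (hS : WeightTriangulation δ t V S) (hS' : WeightTriangulation δ t V S') (h : S ⊆ S') :
    S = S' := by
  classical
  refine Finset.Subset.antisymm h fun σ hσ => ?_
  have h0 : ∀ i, (0 : ℝ) ≤ if i ∈ σ then 1 else 0 := fun i => by split_ifs <;> norm_num
  obtain ⟨τ, hτ, w, hw0, hwτ, hw⟩ := hS.cover (fun i => if i ∈ σ then 1 else 0) h0
  have huv := hS'.unique σ hσ τ (h hτ) (fun i => if i ∈ σ then 1 else 0) w h0 hw0
    (fun x hx => if_neg hx) hwτ fun k hk => (hw k hk).symm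
  have hστ : σ ⊆ τ := fun x hx => by
    by_contra h
    have := congrFun huv x
    rw [hwτ x h] at this
    simp [hx] at this
  rwa [Finset.eq_of_subset_of_card_le hστ (by rw [hS.card τ hτ, hS'.card σ hσ])]

/-- The simplices on the vertices of an intertwining pair that omit a vertex of its second tuple. -/
def omissions (A B : Fin (d + 1) → ℕ) : Finset (Finset ℕ) :=
  Finset.univ.image fun j => (pairSupport A B).erase (B j)

theorem mem_omissions {A B : Fin (d + 1) → ℕ} {σ : Finset ℕ} :
    σ ∈ omissions A B ↔ ∃ j, (pairSupport A B).erase (B j) = σ := by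
  simp [omissions]

theorem left_mem_of_mem_omissions {A B : Fin (d + 1) → ℕ} (hAB : Intertwines A B ∨ Intertwines B A)
    {σ : Finset ℕ} (hσ : σ ∈ omissions A B) (i : Fin (d + 1)) : A i ∈ σ := by
  obtain ⟨j, rfl⟩ := mem_omissions.1 hσ
  exact Finset.mem_erase.2 ⟨ne_of_intertwines hAB i j, mem_pairSupport.2 (Or.inl ⟨i, rfl⟩)⟩

/-- Subtract from a weight the multiple of the circuit at which an entry of `B` first reaches zero;
the entries of `A`, negative in the circuit, only grow. This represents the point without that entry
of `B`. -/
theorem weightTriangulation_omissions (ht : StrictMono t) {A B : Fin (d + 1) → ℕ}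
    (hAB : Intertwines A B ∨ Intertwines B A) :
    WeightTriangulation (2 * d) t (pairSupport A B) (omissions A B) := by
  have hAZ : ∀ i, A i ∈ pairSupport A B := fun i => mem_pairSupport.2 (Or.inl ⟨i, rfl⟩)
  have hBZ : ∀ i, B i ∈ pairSupport A B := fun i => mem_pairSupport.2 (Or.inr ⟨i, rfl⟩)
  obtain ⟨c, hcA, hcB, hc0, hc⟩ := exists_circuit_of_intertwines ht hAB
  have hc0 : ∀ z ∉ pairSupport A B, c z = 0 := fun z hz =>
    hc0 z (fun i h => hz (h ▸ hAZ i)) fun i h => hz (h ▸ hBZ i)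
  have hc := hc _ hAZ hBZ
  have hsum : ∀ (s : ℝ) (u : ℕ → ℝ), ∀ k < 2 * d + 1,
      ∑ x ∈ pairSupport A B, (u x - s * c x) * t x ^ k = ∑ x ∈ pairSupport A B, u x * t x ^ k := by
    intro s u k hk
    simp_rw [sub_mul, mul_assoc]
    rw [Finset.sum_sub_distrib, ← Finset.mul_sum, hc k hk, mul_zero, sub_zero]
  refine ⟨fun σ hσ => ?_, fun σ hσ => ?_, fun μ hμ => ?_, fun σ hσ τ hτ u v hu hv huσ hvτ huv => ?_⟩
  · obtain ⟨j, rfl⟩ := mem_omissions.1 hσ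
    exact Finset.erase_subset _ _
  · obtain ⟨j, rfl⟩ := mem_omissions.1 hσ
    exact card_pairSupport_erase hAB (hBZ j)
  · classical
    obtain ⟨j, -, hj⟩ := Finset.exists_min_image Finset.univ (fun j => μ (B j) / c (B j))
      Finset.univ_nonempty
    set s := μ (B j) / c (B j) with hs
    have hs0 : 0 ≤ s := div_nonneg (hμ _) (hcB j).le
    refine ⟨_, mem_omissions.2 ⟨j, rfl⟩,
      fun x => (if x ∈ pairSupport A B then μ x else 0) - s * c x, fun x => ?_, fun x hx => ?_,
      fun k hk => ?_⟩
    · by_cases hx : x ∈ pairSupport A B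
      · simp only [if_pos hx]
        rcases mem_pairSupport.1 hx with ⟨i, rfl⟩ | ⟨i, rfl⟩
        · nlinarith [hμ (A i), mul_nonneg hs0 (neg_nonneg.2 (hcA i).le)]
        · have := (le_div_iff₀ (hcB i)).1 (hj i (Finset.mem_univ _))
          linarith
      · simp [hx, hc0 x hx]
    · by_cases hxB : x = B j
      · simp [hxB, hBZ j, hs, (hcB j).ne']
      · have hxZ : x ∉ pairSupport A B := fun h => hx (Finset.mem_erase.2 ⟨hxB, h⟩)
        simp [hxZ, hc0 x hxZ]
    · rw [hsum s _ k hk]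
      exact Finset.sum_congr rfl fun x hx => by simp [hx]
  · obtain ⟨j, rfl⟩ := mem_omissions.1 hσ
    obtain ⟨k, rfl⟩ := mem_omissions.1 hτ
    have huZ : ∀ x ∉ pairSupport A B, u x = 0 := fun x hx =>
      huσ x fun h => hx (Finset.mem_of_mem_erase h)
    have hvZ : ∀ x ∉ pairSupport A B, v x = 0 := fun x hx =>
      hvτ x fun h => hx (Finset.mem_of_mem_erase h)
    have huj : u (B j) = 0 := huσ _ (Finset.notMem_erase _ _)
    have hvk : v (B k) = 0 := hvτ _ (Finset.notMem_erase _ _)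
    -- Two representations differ by `s` times the circuit. Vanishing of `u` at `B j` gives `s ≤ 0`,
    -- and vanishing of `v` at `B k` gives `s ≥ 0`.
    set s := (u (B j) - v (B j)) / c (B j) with hs
    have hs0 : s ≤ 0 := div_nonpos_of_nonpos_of_nonneg (by linarith [hv (B j)]) (hcB j).le
    have hzero : (fun x => u x - v x - s * c x) = fun _ => 0 := by
      refine eq_of_moments ht (Finset.erase_subset (B j) (pairSupport A B))
        (card_pairSupport_erase hAB (hBZ j)).le (fun x hx => ?_) (fun _ _ => rfl) fun k hk => ?_
      · by_cases hxB : x = B j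
        · rw [hxB, hs, div_mul_cancel₀ _ (hcB j).ne', sub_self]
        · have hxZ : x ∉ pairSupport A B := fun h => hx (Finset.mem_erase.2 ⟨hxB, h⟩)
          simp [huZ x hxZ, hvZ x hxZ, hc0 x hxZ]
      · rw [hsum s _ k hk]
        simp [sub_mul, Finset.sum_sub_distrib, huv k hk]
    have hk := congrFun hzero (B k)
    simp only [hvk, sub_zero] at hk
    have hs1 : s * c (B k) = 0 :=
      le_antisymm (mul_nonpos_of_nonpos_of_nonneg hs0 (hcB k).le) (by linarith [hu (B k)])
    have hs2 : s = 0 := (mul_eq_zero.1 hs1).resolve_right (hcB k).ne'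
    ext x
    have := congrFun hzero x
    simp only [hs2, zero_mul, sub_zero] at this
    linarith

/-- The polytope of an intertwining pair has only two triangulations without new vertices. -/
theorem WeightTriangulation.eq_omissions (ht : StrictMono t) {A B : Fin (d + 1) → ℕ}
    (hAB : Intertwines A B ∨ Intertwines B A) {P : Finset (Finset ℕ)}
    (hP : WeightTriangulation (2 * d) t (pairSupport A B) P) :
    P = omissions A B ∨ P = omissions B A := by
  have hform : ∀ σ ∈ P, σ ∈ omissions A B ∨ σ ∈ omissions B A := by
    intro σ hσ
    have hsub := hP.subset σ hσ
    obtain ⟨z, hz⟩ : ∃ z, pairSupport A B \ σ = {z} := by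
      rw [← Finset.card_eq_one, Finset.card_sdiff_of_subset hsub, hP.card σ hσ,
        card_pairSupport hAB]
      omega
    have hzZ : z ∈ pairSupport A B :=
      (Finset.mem_sdiff.1 (hz ▸ Finset.mem_singleton_self z)).1
    have hσz : (pairSupport A B).erase z = σ := by
      rw [Finset.erase_eq, ← hz, Finset.sdiff_sdiff_eq_self hsub]
    rcases mem_pairSupport.1 hzZ with ⟨i, rfl⟩ | ⟨i, rfl⟩
    · exact Or.inr (mem_omissions.2 ⟨i, by rw [pairSupport_comm]; exact hσz⟩)
    · exact Or.inl (mem_omissions.2 ⟨i, hσz⟩)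
  by_cases h : ∃ σ ∈ P, σ ∈ omissions B A
  · right
    obtain ⟨σ, hσ, hσB⟩ := h
    have hP' := hP
    rw [pairSupport_comm] at hP'
    refine hP'.eq_of_subset (weightTriangulation_omissions ht hAB.symm) fun τ hτ => ?_
    refine (hform τ hτ).resolve_left fun hτA => ?_
    have hA := left_mem_of_mem_omissions hAB hτA
    have hB := left_mem_of_mem_omissions hAB.symm hσB
    rcases hAB with h | h
    · exact hP.not_intertwines ht hτ hσ hA hB h
    · exact hP.not_intertwines ht hσ hτ hB hA h
  · left
    push Not at h
    exact hP.eq_of_subset (weightTriangulation_omissions ht hAB) fun τ hτ =>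
      (hform τ hτ).resolve_right (h τ hτ)

theorem exists_pairSupport_eq (ht : StrictMono t) {Z : Finset ℕ} (hZ : Z.card = 2 * d + 2) :
    ∃ A B : Fin (d + 1) → ℕ, Intertwines A B ∧ Z = pairSupport A B := by
  obtain ⟨c, P, N, -, -, -, hPN, -, hcross⟩ := exists_intertwines_of_card ht Z hZ
  refine ⟨N, P, hcross, ?_⟩
  ext z
  rw [hPN, mem_pairSupport, or_comm]
  simp only [eq_comm]

/-- A tuple in a new simplex that misses some `B j` already lies in the old simplex omitting `B j`.
So `B` is the only new tuple. -/
theorem ncard_sdiff_of_flip (ht : StrictMono t) (hd : 1 ≤ d) (hm : 2 * d + 1 ≤ m)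
    {S T : Finset (Finset ℕ)} (hS : IsCyclicTriangulation (2 * d) m t S)
    (hT : IsCyclicTriangulation (2 * d) m t T) {A B : Fin (d + 1) → ℕ}
    (hAB : Intertwines A B ∨ Intertwines B A) (hP : omissions A B ⊆ S)
    (hST : T = (S \ omissions A B) ∪ omissions B A) :
    (eSet d m t T \ eSet d m t S).ncard = 1 := by
  have hnS := nonIntertwining_eSet ht hd hm hS
  have hAS : A ∈ eSet d m t S := by
    have hmem : (pairSupport A B).erase (B 0) ∈ omissions A B := mem_omissions.2 ⟨0, rfl⟩
    exact compat_eSet ht hd hm hS (hP hmem) A (hAB.elim Intertwines.gapped_left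
      Intertwines.gapped_right) (left_mem_of_mem_omissions hAB hmem)
  have hBg : Gapped B := hAB.elim Intertwines.gapped_right Intertwines.gapped_left
  have hBT : B ∈ eSet d m t T := by
    have hmem : (pairSupport B A).erase (A 0) ∈ omissions B A := mem_omissions.2 ⟨0, rfl⟩
    exact compat_eSet ht hd hm hT (hST ▸ Finset.mem_union_right _ hmem) B hBg
      (left_mem_of_mem_omissions hAB.symm hmem)
  rw [Set.ncard_eq_one]
  refine ⟨B, Set.eq_singleton_iff_unique_mem.2 ⟨⟨hBT, fun hBS => ?_⟩, fun C hC => ?_⟩⟩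
  · exact hAB.elim (hnS A hAS B hBS) (hnS B hBS A hAS)
  · obtain ⟨hCT, hCS⟩ := hC
    obtain ⟨hC, σ, hσ, hCσ⟩ := (mem_eSet ht hd hm).1 hCT
    rw [hST, Finset.mem_union, Finset.mem_sdiff] at hσ
    rcases hσ with hσ | hσ
    · exact absurd ((mem_eSet ht hd hm).2 ⟨hC, σ, hσ.1, hCσ⟩) hCS
    · obtain ⟨i, rfl⟩ := mem_omissions.1 hσ
      refine (eq_of_forall_mem_range hBg.strictMono (mem_separatedTuples.1 hC).2.strictMono
        fun j => ?_).symm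
      by_contra! hj
      refine hCS ((mem_eSet ht hd hm).2 ⟨hC, _, hP (mem_omissions.2 ⟨j, rfl⟩), fun k =>
        Finset.mem_erase.2 ⟨hj k, ?_⟩⟩)
      rw [pairSupport_comm]
      exact Finset.mem_of_mem_erase (hCσ k)

theorem isBistellarFlip_iff (ht : StrictMono t) (hd : 1 ≤ d) (hm : 2 * d + 1 ≤ m)
    {S T : Finset (Finset ℕ)} (hS : IsCyclicTriangulation (2 * d) m t S)
    (hT : IsCyclicTriangulation (2 * d) m t T) :
    IsBistellarFlip (2 * d) t S T ↔
      (eSet d m t S \ eSet d m t T).ncard = 1 ∧ (eSet d m t T \ eSet d m t S).ncard = 1 := by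
  have hfin : ∀ S : Finset (Finset ℕ), (eSet d m t S).Finite := fun S =>
    (finite_separatedTuples d m).subset (eSet_subset S ht hd hm)
  have hsymm : (eSet d m t S \ eSet d m t T).ncard = (eSet d m t T \ eSet d m t S).ncard :=
    (Set.ncard_eq_ncard_iff_ncard_sdiff_eq_ncard_sdiff (hfin S) (hfin T)).1
      ((ncard_eSet ht hd hm hS).trans (ncard_eSet ht hd hm hT).symm)
  constructor
  · rintro ⟨Z, hZ, -, -, P, Q, hP, hQ, hPQ, hPS, hST⟩
    suffices h : (eSet d m t T \ eSet d m t S).ncard = 1 from ⟨hsymm.trans h, h⟩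
    obtain ⟨A, B, hAB, rfl⟩ := exists_pairSupport_eq ht hZ
    have hne : (pairSupport A B).Nonempty := ⟨A 0, mem_pairSupport.2 (Or.inl ⟨0, rfl⟩)⟩
    rw [isTriangulationOf_iff ht hne] at hP hQ
    rcases hP.eq_omissions ht (Or.inl hAB) with rfl | rfl <;>
      rcases hQ.eq_omissions ht (Or.inl hAB) with rfl | rfl
    · exact absurd rfl hPQ
    · exact ncard_sdiff_of_flip ht hd hm hS hT (Or.inl hAB) hPS hST
    · exact ncard_sdiff_of_flip ht hd hm hS hT (Or.inr hAB) hPS hST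
    · exact absurd rfl hPQ
  · rintro ⟨h1, h2⟩
    obtain ⟨A, hA⟩ := Set.ncard_eq_one.1 h1
    obtain ⟨B, hB⟩ := Set.ncard_eq_one.1 h2
    have hA' : A ∈ eSet d m t S \ eSet d m t T := hA ▸ Set.mem_singleton A
    have hB' : B ∈ eSet d m t T \ eSet d m t S := hB ▸ Set.mem_singleton B
    set R := eSet d m t S ∩ eSet d m t T with hR
    have hSR : eSet d m t S = R ∪ {A} := by rw [← hA, hR, Set.inter_union_sdiff]
    have hTR : eSet d m t T = R ∪ {B} := by rw [← hB, hR, Set.inter_comm, Set.inter_union_sdiff]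
    have hRs : R ⊆ separatedTuples d m := Set.inter_subset_left.trans (eSet_subset S ht hd hm)
    have hRn : NonIntertwining R := (nonIntertwining_eSet ht hd hm hS).mono Set.inter_subset_left
    have hAR : A ∉ R := fun h => hA'.2 h.2
    have hBR : B ∉ R := fun h => hB'.2 h.1
    have hAc : IsComplement d m t A R :=
      ⟨eSet_subset S ht hd hm hA'.1, hRs, hRn, hAR, S, hS, hSR⟩
    have hBc : IsComplement d m t B R :=
      ⟨eSet_subset T ht hd hm hB'.1, hRs, hRn, hBR, T, hT, hTR⟩
    have hne : A ≠ B := fun h => hB'.2 (h ▸ hA'.1)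
    have hAB := intertwines_of_isComplement ht hd hm hne hAc hBc
    rw [Set.union_singleton] at hSR hTR
    have hAn : NonIntertwining (insert A R) := hSR ▸ nonIntertwining_eSet ht hd hm hS
    have hBn : NonIntertwining (insert B R) := hTR ▸ nonIntertwining_eSet ht hd hm hT
    have hAF := facetExtension_of_isComplement ht hd hm hAc
    have hBF := facetExtension_of_isComplement ht hd hm hBc
    have hZm : pairSupport A B ⊆ Finset.Icc 1 m := fun z hz => by
      rcases mem_pairSupport.1 hz with ⟨i, rfl⟩ | ⟨i, rfl⟩
      · exact (mem_separatedTuples.1 hAc.1).1 i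
      · exact (mem_separatedTuples.1 hBc.1).1 i
    have hSmem : ∀ σ, σ ∈ S ↔ σ ⊆ Finset.Icc 1 m ∧ σ.card = 2 * d + 1 ∧ Compat (insert A R) σ :=
      fun σ => by rw [← hSR, ← mem_compatSimplices, ← eq_compatSimplices_eSet ht hd hm hS]
    have hTmem : ∀ σ, σ ∈ T ↔ σ ⊆ Finset.Icc 1 m ∧ σ.card = 2 * d + 1 ∧ Compat (insert B R) σ :=
      fun σ => by rw [← hTR, ← mem_compatSimplices, ← eq_compatSimplices_eSet ht hd hm hT]
    have hPS : omissions A B ⊆ S := fun σ hσ => by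
      obtain ⟨j, rfl⟩ := mem_omissions.1 hσ
      exact (hSmem _).2 ⟨(Finset.erase_subset _ _).trans hZm,
        card_pairSupport_erase hAB (mem_pairSupport.2 (Or.inr ⟨j, rfl⟩)),
        compat_erase_of_exchange ht hm hAc.1 hBc.1 hAB hAR hBR hAn hAF hBF j⟩
    have hQT : omissions B A ⊆ T := fun σ hσ => by
      obtain ⟨j, rfl⟩ := mem_omissions.1 hσ
      exact (hTmem _).2 ⟨(Finset.erase_subset _ _).trans (pairSupport_comm A B ▸ hZm),
        card_pairSupport_erase hAB.symm (mem_pairSupport.2 (Or.inr ⟨j, rfl⟩)),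
        compat_erase_of_exchange ht hm hBc.1 hAc.1 hAB.symm hBR hAR hBn hBF hAF j⟩
    have hZne : (pairSupport A B).Nonempty := ⟨A 0, mem_pairSupport.2 (Or.inl ⟨0, rfl⟩)⟩
    -- a simplex without the exchanged tuple survives the exchange
    have hkeep : ∀ {X Y : Fin (d + 1) → ℕ} {σ : Finset ℕ}, Compat (insert X R) σ →
        (¬ ∀ i, X i ∈ σ) → Compat (insert Y R) σ := fun {X Y σ} h hX C hC hCσ =>
      Set.mem_insert_of_mem _ ((Set.mem_insert_iff.1 (h C hC hCσ)).resolve_left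
        fun h => hX (h ▸ hCσ))
    refine ⟨pairSupport A B, card_pairSupport hAB, fun z hz => ?_,
      fun W _ hW => labelsIndep_of_card_le ht hW.le, omissions A B, omissions B A,
      (isTriangulationOf_iff ht hZne).2 (weightTriangulation_omissions ht hAB),
      (isTriangulationOf_iff ht hZne).2 (pairSupport_comm A B ▸
        weightTriangulation_omissions ht hAB.symm), fun h => ?_, hPS, ?_⟩
    · have : Nontrivial (Fin (d + 1)) := Fin.nontrivial_iff_two_le.2 (by omega)
      rcases mem_pairSupport.1 hz with ⟨i, rfl⟩ | ⟨i, rfl⟩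
      · exact ⟨_, hPS (mem_omissions.2 ⟨0, rfl⟩),
          left_mem_of_mem_omissions hAB (mem_omissions.2 ⟨0, rfl⟩) i⟩
      · obtain ⟨j, hj⟩ := exists_ne i
        exact ⟨_, hPS (mem_omissions.2 ⟨j, rfl⟩), Finset.mem_erase.2
          ⟨fun h => hj ((mem_separatedTuples.1 hBc.1).2.strictMono.injective h.symm), hz⟩⟩
    · have h0 : (pairSupport A B).erase (B 0) ∈ omissions B A := h ▸ mem_omissions.2 ⟨0, rfl⟩
      exact Finset.notMem_erase _ _ (left_mem_of_mem_omissions hAB.symm h0 0)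
    -- By `eq_erase_of_exchange`, the simplices of `T` containing `B` and those of `S` containing
    -- `A` are the omissions; all others use neither tuple and are common to both.
    · ext σ
      rw [Finset.mem_union, Finset.mem_sdiff]
      constructor
      · intro hσ
        obtain ⟨hσm, hσc, hσR⟩ := (hTmem σ).1 hσ
        by_cases hB : ∀ i, B i ∈ σ
        · obtain ⟨j, rfl⟩ := eq_erase_of_exchange ht hBc.1 hAc.1 hAB.symm hBR hAR hBn hAF hσm hσc
            hσR hB
          exact Or.inr (mem_omissions.2 ⟨j, rfl⟩)
        · refine Or.inl ⟨(hSmem σ).2 ⟨hσm, hσc, hkeep hσR hB⟩, fun h => ?_⟩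
          refine (Set.mem_insert_iff.1 (hσR A (mem_separatedTuples.1 hAc.1).2
            (left_mem_of_mem_omissions hAB h))).elim hne hAR
      · rintro (⟨hσ, hσP⟩ | hσ)
        · obtain ⟨hσm, hσc, hσR⟩ := (hSmem σ).1 hσ
          refine (hTmem σ).2 ⟨hσm, hσc, hkeep hσR fun hA => hσP ?_⟩
          obtain ⟨j, rfl⟩ := eq_erase_of_exchange ht hAc.1 hBc.1 hAB hAR hBR hAn hBF hσm hσc hσR hA
          exact mem_omissions.2 ⟨j, rfl⟩
        · exact hQT hσ

end Flips

/-! ### Reduction to parameters increasing on all of `ℕ` -/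

section Transfer

variable {δ d m : ℕ} {t t' : ℕ → ℝ}

/-- Only the parameters of `1, …, m` are constrained, whereas the preceding arguments use a strictly
increasing sequence. The values elsewhere do not affect the notions involved, so any increasing
extension serves. -/
theorem exists_strictMono_eqOn (hm : 1 ≤ m) (ht : StrictMonoOn t (Set.Icc 1 m)) :
    ∃ t' : ℕ → ℝ, StrictMono t' ∧ Set.EqOn t t' (Set.Icc 1 m) := by
  refine ⟨fun i => if i < 1 then t 1 - 1 else if i ≤ m then t i else t m + i,
    strictMono_nat_of_lt_succ fun i => ?_, fun i hi => ?_⟩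
  · change (if i < 1 then t 1 - 1 else if i ≤ m then t i else t m + i) <
      if i + 1 < 1 then t 1 - 1 else if i + 1 ≤ m then t (i + 1) else t m + (i + 1 : ℕ)
    have hpos : (0 : ℝ) ≤ i := Nat.cast_nonneg i
    rw [if_neg (show ¬ i + 1 < 1 by omega)]
    push_cast
    rcases Nat.eq_zero_or_pos i with rfl | hi
    · simp [hm]
    rw [if_neg (by omega)]
    rcases lt_trichotomy i m with him | rfl | him
    · rw [if_pos him.le, if_pos (show i + 1 ≤ m from him)]
      exact ht ⟨hi, him.le⟩ ⟨by omega, him⟩ (Nat.lt_succ_self i)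
    · rw [if_pos le_rfl, if_neg (by omega)]
      linarith
    · rw [if_neg (by omega), if_neg (by omega)]
      linarith
  · simp [show ¬ i < 1 from not_lt.2 hi.1, show i ≤ m from hi.2]

theorem labelHull_congr {V : Set ℕ} (h : Set.EqOn t t' V) :
    labelHull δ t V = labelHull δ t' V := by
  unfold labelHull
  rw [Set.image_congr fun i hi => by rw [h hi]]

theorem LabelsIndep.congr {V : Finset ℕ} (h : Set.EqOn t t' V) (hV : LabelsIndep δ t V) :
    LabelsIndep δ t' V := by
  have : (fun i : V => momentPoint δ (t' i)) = fun i : V => momentPoint δ (t i) :=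
    funext fun i => by rw [h i.2]
  rw [LabelsIndep, this]
  exact hV

theorem IsTriangulationOf.congr {V : Set ℕ} (h : Set.EqOn t t' V) {S : Finset (Finset ℕ)}
    (hS : IsTriangulationOf δ t V S) : IsTriangulationOf δ t' V S := by
  have hσ : ∀ σ ∈ S, labelHull δ t' (σ : Set ℕ) = labelHull δ t (σ : Set ℕ) := fun σ hσ =>
    (labelHull_congr (h.mono (hS.vertices σ hσ))).symm
  refine ⟨hS.vertices, hS.card, fun σ hσ => (hS.indep σ hσ).congr (h.mono (hS.vertices σ hσ)), ?_,
    fun σ hσS τ hτS => ?_⟩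
  · rw [Set.iUnion₂_congr hσ, hS.cover, labelHull_congr h]
  · rw [hσ σ hσS, hσ τ hτS, hS.inter σ hσS τ hτS]
    refine labelHull_congr (h.mono ?_)
    exact (Finset.coe_subset.2 Finset.inter_subset_left).trans (hS.vertices σ hσS)

theorem isTriangulationOf_congr {V : Set ℕ} (h : Set.EqOn t t' V) {S : Finset (Finset ℕ)} :
    IsTriangulationOf δ t V S ↔ IsTriangulationOf δ t' V S :=
  ⟨fun hS => hS.congr h, fun hS => hS.congr h.symm⟩

theorem eSet_congr (h : Set.EqOn t t' (Set.Icc 1 m)) (S : Finset (Finset ℕ)) :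
    eSet d m t S = eSet d m t' S := by
  ext A
  have hF : ∀ F, IsLowerFacet (2 * d) m t F ↔ IsLowerFacet (2 * d) m t' F := fun F => by
    rw [IsLowerFacet, IsLowerFacet, cyclicPolytope, cyclicPolytope, labelHull_congr h]
  simp only [eSet, Set.mem_ofPred_eq, hF]
  refine and_congr_right fun _ => and_congr_right fun hA => ?_
  rw [labelHull_congr (h.mono (by rintro _ ⟨i, rfl⟩; exact hA i))]

theorem isComplement_congr (h : Set.EqOn t t' (Set.Icc 1 m)) (A : Fin (d + 1) → ℕ)
    (R : Set (Fin (d + 1) → ℕ)) : IsComplement d m t A R ↔ IsComplement d m t' A R := by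
  simp only [IsComplement, IsCyclicTriangulation, eSet_congr h, isTriangulationOf_congr h]

theorem IsBistellarFlip.congr (h : Set.EqOn t t' (Set.Icc 1 m)) {S T : Finset (Finset ℕ)}
    (hS : ∀ σ ∈ S, (σ : Set ℕ) ⊆ Set.Icc 1 m) (hST : IsBistellarFlip δ t S T) :
    IsBistellarFlip δ t' S T := by
  obtain ⟨Z, hZ, hZS, hZi, P, Q, hP, hQ, hPQ⟩ := hST
  have hZm : Set.EqOn t t' (Z : Set ℕ) := h.mono fun z hz => by
    obtain ⟨σ, hσ, hzσ⟩ := hZS z hz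
    exact hS σ hσ hzσ
  exact ⟨Z, hZ, hZS, fun W hW hWc => (hZi W hW hWc).congr (hZm.mono (Finset.coe_subset.2 hW)), P, Q,
    hP.congr hZm, hQ.congr hZm, hPQ⟩

end Transfer

theorem mainTheorem4 (d m : ℕ) (hd : 1 ≤ d) (hm : 2 * d + 1 ≤ m)
    (t : ℕ → ℝ) (ht : StrictMonoOn t (Set.Icc 1 m)) :
    (∀ S T : Finset (Finset ℕ),
      IsCyclicTriangulation (2 * d) m t S → IsCyclicTriangulation (2 * d) m t T →
        (IsBistellarFlip (2 * d) t S T ↔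
          (eSet d m t S \ eSet d m t T).ncard = 1 ∧ (eSet d m t T \ eSet d m t S).ncard = 1)) ∧
    (∀ A ∈ separatedTuples d m, ∀ B ∈ separatedTuples d m,
      (Exchangeable d m t A B ↔ Intertwines A B ∨ Intertwines B A)) ∧
    (∀ A B : Fin (d + 1) → ℕ, Exchangeable d m t A B → ∀ R : Set (Fin (d + 1) → ℕ),
      (IsComplement d m t A R ∧ IsComplement d m t B R ↔
        R ⊆ separatedTuples d m \ {A, B} ∧ NonIntertwining R ∧
          R.ncard = (m - d - 1).choose d - 1 ∧
          ∀ C ∈ separatedTuples d m, (∀ i, C i ∈ Set.range A ∪ Set.range B) →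
            C ≠ A → C ≠ B → C ∈ R)) := by
  obtain ⟨t', ht', h⟩ := exists_strictMono_eqOn (by omega) ht
  have hE : ∀ A B, Exchangeable d m t A B ↔ Exchangeable d m t' A B := fun A B => by
    simp only [Exchangeable, isComplement_congr h]
  refine ⟨fun S T hS hT => ?_, fun A hA B hB => ?_, fun A B hAB R => ?_⟩
  · rw [eSet_congr h S, eSet_congr h T,
      ← isBistellarFlip_iff ht' hd hm ((isTriangulationOf_congr h).1 hS)
        ((isTriangulationOf_congr h).1 hT)]
    exact ⟨IsBistellarFlip.congr h hS.vertices, IsBistellarFlip.congr h.symm hS.vertices⟩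
  · rw [hE]
    exact exchangeable_iff ht' hd hm hA hB
  · rw [isComplement_congr h, isComplement_congr h]
    exact isComplement_and_isComplement_iff ht' hd hm ((hE A B).1 hAB) R
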